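/- **Setting.** Let $Sp(8,\mathbf Z)=\{N\in M_8(\mathbf Z): NE\,{}^tN=E\}$ with $E=\begin{pmatrix}0&I\\-I&0\end{pmatrix}$ act on the Siegel space $\mathcal H_4$ of symmetric complex $4\times4$ matrices with positive definite imaginary part by $N\cdot\tau=(a\tau+b)(c\tau+d)^{-1}$. For $\sigma\in(\mathbf Z/2\mathbf Z)^4$, with representative in $\{0,1\}^4$, let $$\theta[{}^\sigma_0](2\tau,0)=\sum_{m\in\mathbf Z^4}e^{2\pi i\,(m+\sigma/2)\,\tau\,{}^t(m+\sigma/2)},$$ and let $\Theta:\mathcal H_4\to\mathbf P^{15}$, $\tau\mapsto(\ldots:\theta[{}^\sigma_0](2\tau,0):\ldots)$. An element $N\in Sp(8,\mathbf Z)$ acts on $\mathbf P^{15}$ by the projective transformation for which $\Theta(N\cdot\tau)=N\,\Theta(\tau)$ for all $\tau\in\mathcal H_4$. With $2\times2$ blocks let $$A=\begin{pmatrix}-I&-I\\I&0\end{pmatrix},\qquad M=\begin{pmatrix}A&0\\0&{}^tA^{-1}\end{pmatrix}\in Sp(8,\mathbf Z),$$ let $\mathcal H_4^M$ be the set of fixed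 points of $M$ in $\mathcal H_4$ and $N_M$ the normalizer of $\langle M\rangle$ in $Sp(8,\mathbf Z)$. Let $\mathbf P^5\subset\mathbf P^{15}$ be the $M$-eigenspace defined by $X_\sigma=X_{\sigma A}$ for all $\sigma$. Writing $X_i=X_\sigma$ for $i=8\sigma_1+4\sigma_2+2\sigma_3+\sigma_4$, it is parametrized by $X=(X_0,X_1,X_2,X_3,X_6,X_7)\in\mathbf C^6$ through $$X\mapsto(X_0:X_1:X_2:X_3:X_1:X_1:X_6:X_7:X_2:X_7:X_2:X_6:X_3:X_6:X_7:X_3).$$ One has $\Theta(\mathcal H_4^M)\subset\mathbf P^5$; let $\mathcal X\subset\mathbf P^5$ be the Zariski closure of $\Theta(\mathcal H_4^M)$. On $\mathbf C^6$ let $b(X,Y)=\frac13X_0Y_0+X_1Y_1+X_2Y_2+X_3Y_3+X_6Y_6+X_7Y_7$, and let $$\begin{array}{lll}\alpha_1=(0,-1,-1,0,0,0),&\alpha_3=(0,1,-1,0,0,0),&\alpha_5=(0,0,0,1,-1,0),\\ \alpha_2=\frac12(3,-1,1,1,1,1),&\alpha_4=(0,0,1,-1,0,0),&\alpha_6=(0,0,0,0,1,-1),\end{array}$$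 $R(E_6)=\sum_i\mathbf Z\alpha_i$, $s_{\alpha}(X)=X-b(X,\alpha)\alpha$, and let $W(E_6)\subset GL(\mathbf C^6)$ be the group generated by $s_{\alpha_1},\ldots,s_{\alpha_6}$. Let, with $4\times 4$ blocks, $$M_B=\begin{pmatrix}B&0\\0&B\end{pmatrix},\quad M_d=\begin{pmatrix}I&S\\0&I\end{pmatrix},\quad M_e=\begin{pmatrix}D&T\\0&D\end{pmatrix},\quad M_f=\begin{pmatrix}0&B_f\\-B_f&0\end{pmatrix},$$ where $B=\begin{pmatrix}0&I\\I&0\end{pmatrix}$ and $B_f=\begin{pmatrix}I&0\\0&-I\end{pmatrix}$ with $2\times2$ blocks, $D=\mathrm{diag}(-1,1,-1,1)$ and $$S=\begin{pmatrix}2&0&-1&0\\0&0&0&0\\-1&0&2&0\\0&0&0&0\end{pmatrix},\qquad T=\begin{pmatrix}0&1&0&-2\\-1&0&-1&0\\0&1&0&1\\2&0&-1&0\end{pmatrix}.$$ These four matrices lie in $N_M$. **Proposition.** 1. The actions of $M_B,M_d,M_e,M_f$ on $\mathbf P^{15}$ map $\mathbf P^5$ into itself, and on $\mathbf P^5$ they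 are induced by the following linear transformations of $\mathbf C^6$: $$\begin{array}{ll}M_B:&(X_0,X_1,X_2,X_3,X_6,X_7)\mapsto(X_0,X_1,X_2,X_3,X_7,X_6),\\ M_d:&(X_0,X_1,X_2,X_3,X_6,X_7)\mapsto(X_0,X_1,-X_2,-X_3,-X_6,-X_7),\\ M_e:&(X_0,X_1,X_2,X_3,X_6,X_7)\mapsto(X_0,X_1,X_2,-X_3,-X_6,X_7),\end{array}$$ $$M_f:\ X\mapsto\frac14\begin{pmatrix}1&3&3&3&3&3\\1&-1&3&-1&-1&-1\\1&3&-1&-1&-1&-1\\1&-1&-1&3&-1&-1\\1&-1&-1&-1&-1&3\\1&-1&-1&-1&3&-1\end{pmatrix}X\qquad(X\text{ a column vector}).$$ In particular $M_B$ acts as the reflection $s_{\alpha_6}$. 2. The $\alpha_i$ are simple roots of type $E_6$ for $b$, the natural map $R(E_6)\otimes_{\mathbf Z}\mathbf C\to\mathbf C^6$ is an isomorphism, $W(E_6)$ preserves $R(E_6)$, and $W(E_6)$ is generated by the four linear transformations of part 1. 3. The normalizer $N_M$ acts on $\mathcal X\subset\mathbf P^5=\mathbf P(R(E_6)\otimes_{\mathbf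 Z}\mathbf C)$ through $W(E_6)$: there is a surjective homomorphism $\rho:N_M\to W(E_6)$, which takes $M_B,M_d,M_e,M_f$ to the four linear transformations of part 1, such that for every $N\in N_M$ the action of $N$ on $\mathbf P^{15}$ maps $\mathbf P^5$ into itself and is induced there by $\rho(N)$, one has $N\cdot\tau\in\mathcal H_4^M$ and $\Theta(N\cdot\tau)=\rho(N)\Theta(\tau)$ for all $\tau\in\mathcal H_4^M$, and $\rho(N)$ maps $\mathcal X$ onto itself. -/

import Mathlib

open scoped LinearAlgebra.Projectivization TensorProduct

noncomputable section

namespace PicardE6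

/-! ### The symplectic group, the Siegel space and the theta functions -/

/-- `Sp(8, ℤ)`, as matrices with `4 × 4` blocks. Mathlib's `J` is `-E`, with
`E = (0, I; -I, 0)`, so `N * J * Nᵀ = J` is the condition `N E ᵗN = E`. -/
abbrev Sp8 : Type := Matrix.symplecticGroup (Fin 4) ℤ

/-- The Siegel space `ℋ₄`: symmetric complex matrices with positive definite imaginary part. -/
def siegelSpace : Set (Matrix (Fin 4) (Fin 4) ℂ) :=
  {τ | τ.IsSymm ∧ (τ.map Complex.im).PosDef}

/-- `N · τ = (a τ + b) (c τ + d)⁻¹`, where `a, b, c, d` are the blocks of `N`. -/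
def siegelAct (N : Sp8) (τ : Matrix (Fin 4) (Fin 4) ℂ) : Matrix (Fin 4) (Fin 4) ℂ :=
  let P : Matrix (Fin 4 ⊕ Fin 4) (Fin 4 ⊕ Fin 4) ℂ := N.1.map (Int.cast : ℤ → ℂ)
  (P.toBlocks₁₁ * τ + P.toBlocks₁₂) * (P.toBlocks₂₁ * τ + P.toBlocks₂₂)⁻¹

/-- The classical theta function with characteristic `[ε, ε']`:
`∑ₘ exp(π i ((m + ε/2) τ ᵗ(m + ε/2) + 2 (m + ε/2) ᵗ(z + ε'/2)))`, the sum over `m ∈ ℤ⁴`. -/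
def theta (ε ε' : Fin 4 → ℤ) (τ : Matrix (Fin 4) (Fin 4) ℂ) (z : Fin 4 → ℂ) : ℂ :=
  ∑' m : Fin 4 → ℤ,
    let v : Fin 4 → ℂ := fun i => (m i : ℂ) + (ε i : ℂ) / 2
    let w : Fin 4 → ℂ := fun i => z i + (ε' i : ℂ) / 2
    Complex.exp (Real.pi * Complex.I *
      (dotProduct v (Matrix.mulVec τ v) + 2 * dotProduct v w))

/-- The second order thetanulls `θ[σ, 0](2τ, 0)`, the homogeneous coordinates of the
map `Θ : ℋ₄ → ℙ¹⁵`; the coordinates on `ℙ¹⁵` are indexed by `σ ∈ (ℤ/2ℤ)⁴`. -/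
def thetaNulls (τ : Matrix (Fin 4) (Fin 4) ℂ) : (Fin 4 → ZMod 2) → ℂ :=
  fun σ => theta (fun i => ((σ i).val : ℤ)) 0 ((2 : ℂ) • τ) 0

/-! ### The automorphism `M`, its normalizer and explicit elements of it -/

/-- `A = (-I, -I; I, 0)` with `2 × 2` blocks. -/
def matA : Matrix (Fin 4) (Fin 4) ℤ :=
  !![-1, 0, -1, 0;
     0, -1, 0, -1;
     1, 0, 0, 0;
     0, 1, 0, 0]

/-- `ᵗA⁻¹`. -/
def matAInvT : Matrix (Fin 4) (Fin 4) ℤ :=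
  !![0, 0, -1, 0;
     0, 0, 0, -1;
     1, 0, -1, 0;
     0, 1, 0, -1]

theorem matAInvT_eq : matAInvT = (matA⁻¹).transpose := by
  have h : matAInvT.transpose * matA = 1 := by decide
  rw [Matrix.inv_eq_left_inv h, Matrix.transpose_transpose]

/-- `M = diag(A, ᵗA⁻¹)`. -/
def matM : Sp8 :=
  ⟨Matrix.fromBlocks matA 0 0 matAInvT, by rw [SymplecticGroup.mem_iff]; decide⟩

theorem matM_sq_inv : matM⁻¹ = matM * matM := by
  have h : matM * matM * matM = 1 := by
    apply Subtype.ext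
    change matM.1 * matM.1 * matM.1 = 1
    decide
  exact (eq_inv_of_mul_eq_one_left h).symm

/-- The fixed point locus `ℋ₄ᴹ`. -/
def siegelFixed : Set (Matrix (Fin 4) (Fin 4) ℂ) :=
  {τ | τ ∈ siegelSpace ∧ siegelAct matM τ = τ}

/-- `N_M`, the normalizer of `⟨M⟩` in `Sp(8, ℤ)`. -/
def normM : Subgroup Sp8 := Subgroup.normalizer (Subgroup.zpowers matM : Set Sp8)

theorem mem_normM_of_comm {N : Sp8} (h : N.1 * matM.1 = matM.1 * N.1) : N ∈ normM := by
  have h' : N * matM = matM * N := Subtype.ext h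
  have e : MulAut.conj N matM = matM := by
    rw [MulAut.conj_apply, h', mul_inv_cancel_right]
  have hm : (Subgroup.zpowers matM).map (MulAut.conj N).toMonoidHom = Subgroup.zpowers matM := by
    rw [MonoidHom.map_zpowers]; exact congrArg Subgroup.zpowers e
  intro n
  change n ∈ Subgroup.zpowers matM ↔ MulAut.conj N n ∈ Subgroup.zpowers matM
  nth_rewrite 2 [← hm]
  exact (Subgroup.mem_map_iff_mem (f := (MulAut.conj N).toMonoidHom)
    (MulAut.conj N).injective).symm

theorem mem_normM_of_anti {N : Sp8} (h : N.1 * matM.1 = matM.1 * matM.1 * N.1) :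
    N ∈ normM := by
  have h' : N * matM = matM⁻¹ * N := by rw [matM_sq_inv]; exact Subtype.ext h
  have e : MulAut.conj N matM = matM⁻¹ := by
    rw [MulAut.conj_apply, h', mul_inv_cancel_right]
  have hm : (Subgroup.zpowers matM).map (MulAut.conj N).toMonoidHom = Subgroup.zpowers matM := by
    rw [MonoidHom.map_zpowers, ← Subgroup.zpowers_inv (g := matM)]
    exact congrArg Subgroup.zpowers e
  intro n
  change n ∈ Subgroup.zpowers matM ↔ MulAut.conj N n ∈ Subgroup.zpowers matM
  nth_rewrite 2 [← hm]
  exact (Subgroup.mem_map_iff_mem (f := (MulAut.conj N).toMonoidHom)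
    (MulAut.conj N).injective).symm

/-- `M_B = diag(B, B)` with `B = (0, I; I, 0)`. -/
def spB : Sp8 :=
  let B : Matrix (Fin 4) (Fin 4) ℤ :=
    !![0, 0, 1, 0;
       0, 0, 0, 1;
       1, 0, 0, 0;
       0, 1, 0, 0]
  ⟨Matrix.fromBlocks B 0 0 B, by rw [SymplecticGroup.mem_iff]; decide⟩

/-- `M_d`. -/
def spD : Sp8 :=
  ⟨Matrix.fromBlocks
    1
    !![2, 0, -1, 0;
       0, 0, 0, 0;
       -1, 0, 2, 0;
       0, 0, 0, 0]
    0
    1, by rw [SymplecticGroup.mem_iff]; decide⟩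

/-- `M_e`. -/
def spE : Sp8 :=
  ⟨Matrix.fromBlocks
    !![-1, 0, 0, 0;
       0, 1, 0, 0;
       0, 0, -1, 0;
       0, 0, 0, 1]
    !![0, 1, 0, -2;
       -1, 0, -1, 0;
       0, 1, 0, 1;
       2, 0, -1, 0]
    0
    !![-1, 0, 0, 0;
       0, 1, 0, 0;
       0, 0, -1, 0;
       0, 0, 0, 1], by rw [SymplecticGroup.mem_iff]; decide⟩

/-- `M_f = (0, B_f; -B_f, 0)` with `B_f = diag(I, -I)`. -/
def spF : Sp8 :=
  let Bf : Matrix (Fin 4) (Fin 4) ℤ :=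
    !![1, 0, 0, 0;
       0, 1, 0, 0;
       0, 0, -1, 0;
       0, 0, 0, -1]
  ⟨Matrix.fromBlocks 0 Bf (-Bf) 0, by rw [SymplecticGroup.mem_iff]; decide⟩

/-- `M_B` as an element of `N_M`; similarly `M_d, M_e, M_f` below. -/
def nB : normM := ⟨spB, mem_normM_of_anti (by decide)⟩

def nD : normM := ⟨spD, mem_normM_of_comm (by decide)⟩

def nE : normM := ⟨spE, mem_normM_of_comm (by decide)⟩

def nF : normM := ⟨spF, mem_normM_of_anti (by decide)⟩

/-! ### The eigenspace `ℙ⁵ ⊂ ℙ¹⁵` and the variety `𝒳` -/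

/-- The linear subspace of `ℂ¹⁶` lying over `ℙ⁵`: it is given by `X_σ = X_{σA}` for all
`σ ∈ (ℤ/2ℤ)⁴` (row vectors). -/
def eigenspaceM : Submodule ℂ ((Fin 4 → ZMod 2) → ℂ) where
  carrier := {X | ∀ σ, X σ = X (Matrix.vecMul σ (matA.map (Int.cast : ℤ → ZMod 2)))}
  add_mem' := fun hX hY σ => by rw [Pi.add_apply, Pi.add_apply, ← hX σ, ← hY σ]
  zero_mem' := fun _ => rfl
  smul_mem' := fun c X hX σ => by rw [Pi.smul_apply, Pi.smul_apply, ← hX σ]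

/-- `σ` corresponds to the number `8σ₁ + 4σ₂ + 2σ₃ + σ₄`. -/
def charNumber (σ : Fin 4 → ZMod 2) : Fin 16 :=
  Fin.ofNat 16 (8 * (σ 0).val + 4 * (σ 1).val + 2 * (σ 2).val + (σ 3).val)

/-- The parametrization of the eigenspace by `(X₀, X₁, X₂, X₃, X₆, X₇)`, which sends it to
`(X₀,X₁,X₂,X₃,X₁,X₁,X₆,X₇,X₂,X₇,X₂,X₆,X₃,X₆,X₇,X₃)`. The vector `X : Fin 6 → ℂ`
lists `X₀, X₁, X₂, X₃, X₆, X₇` in this order. -/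
def paramP5 : (Fin 6 → ℂ) →ₗ[ℂ] ((Fin 4 → ZMod 2) → ℂ) :=
  LinearMap.funLeft ℂ ℂ fun σ =>
    (![0, 1, 2, 3, 1, 1, 4, 5, 2, 5, 2, 4, 3, 4, 5, 3] : Fin 16 → Fin 6) (charNumber σ)

/-- The six coordinates `θ₀, θ₁, θ₂, θ₃, θ₆, θ₇` of `Θ(τ)`. -/
def thetaP5 (τ : Matrix (Fin 4) (Fin 4) ℂ) : Fin 6 → ℂ :=
  ![thetaNulls τ ![0, 0, 0, 0], thetaNulls τ ![0, 0, 0, 1], thetaNulls τ ![0, 0, 1, 0],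
    thetaNulls τ ![0, 0, 1, 1], thetaNulls τ ![0, 1, 1, 0], thetaNulls τ ![0, 1, 1, 1]]

/-- The image `Θ(ℋ₄ᴹ)`, as a subset of `ℙ⁵`. -/
def thetaImage : Set (ℙ ℂ (Fin 6 → ℂ)) :=
  {p | ∃ τ ∈ siegelFixed, ∃ h : thetaP5 τ ≠ 0, p = Projectivization.mk ℂ (thetaP5 τ) h}

/-- The variety `𝒳`, the (Zariski) closure of `Θ(ℋ₄ᴹ)` in `ℙ⁵`. -/
def varietyX : Set (ℙ ℂ (Fin 6 → ℂ)) :=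
  {p | ∀ (n : ℕ) (G : MvPolynomial (Fin 6) ℂ), G.IsHomogeneous n →
    (∀ q ∈ thetaImage, MvPolynomial.eval q.rep G = 0) → MvPolynomial.eval p.rep G = 0}

/-- The projective transformation of `ℙ¹⁵` defined by `U` is the action of `N ∈ Sp(8, ℤ)`
on `ℙ¹⁵`: it makes `Θ` equivariant, `Θ(N · τ) = U Θ(τ)` in `ℙ¹⁵` for all `τ ∈ ℋ₄`. -/
def ActsOnP15 (N : Sp8) (U : ((Fin 4 → ZMod 2) → ℂ) ≃ₗ[ℂ] ((Fin 4 → ZMod 2) → ℂ)) : Prop :=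
  ∀ τ ∈ siegelSpace, ∃ c : ℂ, c ≠ 0 ∧ thetaNulls (siegelAct N τ) = c • U (thetaNulls τ)

/-- The action of `N` on `ℙ¹⁵` maps `ℙ⁵` into itself, and on `ℙ⁵` it is induced by the
linear transformation `g` of `ℂ⁶`. -/
def InducedOnP5 (N : Sp8) (g : (Fin 6 → ℂ) ≃ₗ[ℂ] (Fin 6 → ℂ)) : Prop :=
  ∃ U : ((Fin 4 → ZMod 2) → ℂ) ≃ₗ[ℂ] ((Fin 4 → ZMod 2) → ℂ),
    ActsOnP15 N U ∧ ∀ X, U (paramP5 X) = paramP5 (g X)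

/-! ### The root system `E₆` -/

/-- `b(X, Y) = X₀Y₀/3 + X₁Y₁ + X₂Y₂ + X₃Y₃ + X₆Y₆ + X₇Y₇`. -/
def bForm : LinearMap.BilinForm ℂ (Fin 6 → ℂ) :=
  LinearMap.mk₂ ℂ
    (fun X Y => 1 / 3 * (X 0 * Y 0) + X 1 * Y 1 + X 2 * Y 2 + X 3 * Y 3 + X 4 * Y 4 + X 5 * Y 5)
    (fun _ _ _ => by simp only [Pi.add_apply]; ring)
    (fun _ _ _ => by simp only [Pi.smul_apply, smul_eq_mul]; ring)
    (fun _ _ _ => by simp only [Pi.add_apply]; ring)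
    (fun _ _ _ => by simp only [Pi.smul_apply, smul_eq_mul]; ring)

/-- The simple roots `α₁, …, α₆` (numbered here from `0` to `5`). -/
def simpleRoot : Fin 6 → (Fin 6 → ℂ) :=
  ![![0, -1, -1, 0, 0, 0],
    ![3 / 2, -1 / 2, 1 / 2, 1 / 2, 1 / 2, 1 / 2],
    ![0, 1, -1, 0, 0, 0],
    ![0, 0, 1, -1, 0, 0],
    ![0, 0, 0, 1, -1, 0],
    ![0, 0, 0, 0, 1, -1]]

theorem bForm_simpleRoot_self (i : Fin 6) : bForm (simpleRoot i) (simpleRoot i) = 2 := by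
  fin_cases i <;> simp [bForm, simpleRoot] <;> norm_num

/-- The root lattice `R(E₆) = ⊕ ℤ αᵢ`. -/
def rootLattice : Submodule ℤ (Fin 6 → ℂ) := Submodule.span ℤ (Set.range simpleRoot)

/-- The reflection `s_α(X) = X - b(X, α) α` in a simple root `α`. -/
def simpleReflection (i : Fin 6) : (Fin 6 → ℂ) ≃ₗ[ℂ] (Fin 6 → ℂ) :=
  Module.reflection (x := simpleRoot i) (f := bForm.flip (simpleRoot i))
    (bForm_simpleRoot_self i)

/-- The Weyl group `W(E₆)` in its reflection representation on `R(E₆) ⊗ ℂ = ℂ⁶`. -/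
def weylE6 : Subgroup ((Fin 6 → ℂ) ≃ₗ[ℂ] (Fin 6 → ℂ)) :=
  Subgroup.closure (Set.range simpleReflection)

/-! ### The four linear transformations -/

/-- `(X₀, X₁, X₂, X₃, X₆, X₇) ↦ (X₀, X₁, X₂, X₃, X₇, X₆)`. -/
def linB : (Fin 6 → ℂ) ≃ₗ[ℂ] (Fin 6 → ℂ) where
  toFun X := ![X 0, X 1, X 2, X 3, X 5, X 4]
  map_add' X Y := by ext i; fin_cases i <;> rfl
  map_smul' c X := by ext i; fin_cases i <;> rfl
  invFun X := ![X 0, X 1, X 2, X 3, X 5, X 4]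
  left_inv X := by ext i; fin_cases i <;> rfl
  right_inv X := by ext i; fin_cases i <;> rfl

/-- `(X₀, X₁, X₂, X₃, X₆, X₇) ↦ (X₀, X₁, -X₂, -X₃, -X₆, -X₇)`. -/
def linD : (Fin 6 → ℂ) ≃ₗ[ℂ] (Fin 6 → ℂ) where
  toFun X := ![X 0, X 1, -X 2, -X 3, -X 4, -X 5]
  map_add' X Y := by ext i; fin_cases i <;> simp [add_comm]
  map_smul' c X := by ext i; fin_cases i <;> simp
  invFun X := ![X 0, X 1, -X 2, -X 3, -X 4, -X 5]
  left_inv X := by ext i; fin_cases i <;> simp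
  right_inv X := by ext i; fin_cases i <;> simp

/-- `(X₀, X₁, X₂, X₃, X₆, X₇) ↦ (X₀, X₁, X₂, -X₃, -X₆, X₇)`. -/
def linE : (Fin 6 → ℂ) ≃ₗ[ℂ] (Fin 6 → ℂ) where
  toFun X := ![X 0, X 1, X 2, -X 3, -X 4, X 5]
  map_add' X Y := by ext i; fin_cases i <;> simp [add_comm]
  map_smul' c X := by ext i; fin_cases i <;> simp
  invFun X := ![X 0, X 1, X 2, -X 3, -X 4, X 5]
  left_inv X := by ext i; fin_cases i <;> simp
  right_inv X := by ext i; fin_cases i <;> simp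

/-- The `6 × 6` matrix of the linear transformation of `M_f`. -/
def matF : Matrix (Fin 6) (Fin 6) ℂ :=
  (1 / 4 : ℂ) •
    !![1, 3, 3, 3, 3, 3;
       1, -1, 3, -1, -1, -1;
       1, 3, -1, -1, -1, -1;
       1, -1, -1, 3, -1, -1;
       1, -1, -1, -1, -1, 3;
       1, -1, -1, -1, 3, -1]

theorem matF_mul_self : matF * matF = 1 := by
  ext i j
  fin_cases i <;> fin_cases j <;>
    simp [matF, Matrix.mul_apply, Fin.sum_univ_succ] <;> norm_num

/-- `X ↦ matF X`, with `X` a column vector. -/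
def linF : (Fin 6 → ℂ) ≃ₗ[ℂ] (Fin 6 → ℂ) :=
  LinearEquiv.ofInvolutive (Matrix.mulVecLin matF) fun X => by
    rw [Matrix.mulVecLin_apply, Matrix.mulVecLin_apply, Matrix.mulVec_mulVec, matF_mul_self,
      Matrix.one_mulVec]

end PicardE6

end

open PicardE6

noncomputable section

namespace PicardE6

section Symplectic

open Matrix

section SiegelSpace

open scoped ComplexOrder

/-! ### The action on the Siegel space -/

/-! ### Positive definite real matrices viewed over the complex numbers -/

section PosDef

variable {n : Type*} [Fintype n]

/-! Since A² + A + I = 0, the matrix M makes ℤ⁴ a module of rank 2 over the Eisenstein integers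
ℤ[ω], and modulo 2 it acts on (ℤ/2ℤ)⁴ = 𝔽₄² as a primitive cube root of unity in 𝔽₄. Its orbits are
{0} and the five points of ℙ¹(𝔽₄); they index the six coordinates of ℂ⁶. The centralizer of M is a
unitary group of signature (2,2) over ℤ[ω].

Three kinds of symplectic matrices act visibly on second order thetanulls: block-diagonal ones
permute the characteristics (`actsOnP15_spLevi`), translations multiply the coordinates by powers of
i (`actsOnP15_spTrans`), and the inversion of one variable is a partial Fourier transform, by
Poisson summation in that variable (`actsOnP15_spInv`). M_B, M_d, M_e, M_f are products of such
matrices, which gives part 1. On ℙ⁵ a block-diagonal matrix commuting with M permutes the last five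
coordinates, and an M-invariant translation changes an even number of their signs; together these
lie in the subgroup W(D₅) of W(E₆). The remaining element `spJ` acts as an even sign change
conjugated by s_{α₂}.

These elements generate the centralizer (`centralizer_matM_le`): the Euclidean algorithm in ℤ[ω]
clears the lower left block column by column. Since M has order 3 and M_B inverts it, the normalizer
is the centralizer together with its coset by M_B, so all of N_M acts through W(E₆). Every element
of W(E₆) occurs, because each simple reflection is conjugate to M_B = s_{α₆} by a word in the four
transformations (`closure_eq_weylE6`).

The element of W(E₆) induced by N is unique (`weylE6_eq_of_inducedOnP5`), and this makes ρ a
homomorphism. If two elements are induced by N, their quotient h has every Θ(τ) as an eigenvector.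
Going to a cusp, e₀ is an eigenvector, and by equivariance so is every vector in its W(E₆)-orbit,
which consists of halves of minuscule weights. These vectors share one eigenvalue ±1 and span ℂ⁶,
and -1 is excluded because it acts nontrivially on weights modulo roots
(`eq_one_of_forall_eigenvector`). -/

theorem star_dotProduct_map_ofReal_mulVec {Y : Matrix n n ℝ} (hY : Y.IsSymm) (z : n → ℂ) :
    star z ⬝ᵥ (Y.map Complex.ofReal *ᵥ z) =
      (((fun i => (z i).re) ⬝ᵥ (Y *ᵥ fun i => (z i).re) +
        (fun i => (z i).im) ⬝ᵥ (Y *ᵥ fun i => (z i).im) : ℝ) : ℂ) := by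
  have h : (fun i => (z i).re) ⬝ᵥ (Y *ᵥ fun i => (z i).im) =
      (fun i => (z i).im) ⬝ᵥ (Y *ᵥ fun i => (z i).re) := by
    rw [dotProduct_mulVec, ← mulVec_transpose, hY.eq, dotProduct_comm]
  apply Complex.ext
  · simp only [dotProduct, mulVec, Complex.re_sum, Complex.ofReal_re, ← Finset.sum_add_distrib]
    refine Finset.sum_congr rfl fun i _ => ?_
    simp [Complex.mul_re, Complex.re_sum, Complex.im_sum]
  · rw [Complex.ofReal_im]
    rw [← sub_eq_zero] at h
    rw [← h]
    simp only [dotProduct, mulVec, Complex.im_sum, ← Finset.sum_sub_distrib]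
    refine Finset.sum_congr rfl fun i _ => ?_
    simp [Complex.mul_im, Complex.re_sum, Complex.im_sum]
    ring

theorem posDef_map_ofReal_iff {Y : Matrix n n ℝ} :
    (Y.map Complex.ofReal).PosDef ↔ Y.PosDef := by
  constructor
  · intro h
    have hs : Y.IsSymm := by
      ext i j
      have := congrFun (congrFun h.isHermitian i) j
      simpa using this
    refine .of_dotProduct_mulVec_pos (by rw [IsHermitian, conjTranspose_eq_transpose_of_trivial]; exact hs)
      fun x hx => ?_
    have := h.dotProduct_mulVec_pos (x := fun i => (x i : ℂ)) fun h0 => hx <| by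
      ext i; simpa using congrFun h0 i
    rw [star_dotProduct_map_ofReal_mulVec hs] at this
    simp only [Complex.ofReal_re, Complex.ofReal_im] at this
    have h0 : (fun _ : n => (0 : ℝ)) = 0 := rfl
    rw [h0, zero_dotProduct, add_zero, Complex.zero_lt_real] at this
    simpa using this
  · intro h
    have hs : Y.IsSymm := by
      have := h.isHermitian
      rwa [IsHermitian, conjTranspose_eq_transpose_of_trivial] at this
    refine .of_dotProduct_mulVec_pos ?_ fun z hz => ?_
    · ext i j
      simpa using congrFun (congrFun hs i) j
    rw [star_dotProduct_map_ofReal_mulVec hs, Complex.zero_lt_real]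
    have hp : ∀ x : n → ℝ, 0 ≤ x ⬝ᵥ (Y *ᵥ x) := fun x => by
      simpa using h.posSemidef.dotProduct_mulVec_nonneg x
    by_cases h1 : (fun i => (z i).re) = 0
    · have h2 : (fun i => (z i).im) ≠ 0 := fun h2 => hz <| by
        ext i
        exact Complex.ext (congrFun h1 i) (congrFun h2 i)
      exact add_pos_of_nonneg_of_pos (hp _) (by simpa using h.dotProduct_mulVec_pos h2)
    · exact add_pos_of_pos_of_nonneg (by simpa using h.dotProduct_mulVec_pos h1) (hp _)

end PosDef

/-- The complexification of the upper left block of `N`. -/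
def blockA (N : Sp8) : Matrix (Fin 4) (Fin 4) ℂ := (N.1.map (Int.cast : ℤ → ℂ)).toBlocks₁₁
/-- The complexification of the upper right block of `N`. -/
def blockB (N : Sp8) : Matrix (Fin 4) (Fin 4) ℂ := (N.1.map (Int.cast : ℤ → ℂ)).toBlocks₁₂
/-- The complexification of the lower left block of `N`. -/
def blockC (N : Sp8) : Matrix (Fin 4) (Fin 4) ℂ := (N.1.map (Int.cast : ℤ → ℂ)).toBlocks₂₁
/-- The complexification of the lower right block of `N`. -/
def blockD (N : Sp8) : Matrix (Fin 4) (Fin 4) ℂ := (N.1.map (Int.cast : ℤ → ℂ)).toBlocks₂₂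

theorem siegelAct_eq (N : Sp8) (τ : Matrix (Fin 4) (Fin 4) ℂ) :
    siegelAct N τ = (blockA N * τ + blockB N) * (blockC N * τ + blockD N)⁻¹ := rfl

theorem fromBlocks_block (N : Sp8) :
    fromBlocks (blockA N) (blockB N) (blockC N) (blockD N) = N.1.map (Int.cast : ℤ → ℂ) :=
  fromBlocks_toBlocks _

theorem block_relations (N : Sp8) :
    (blockA N)ᵀ * blockC N = (blockC N)ᵀ * blockA N ∧
    (blockB N)ᵀ * blockD N = (blockD N)ᵀ * blockB N ∧
    (blockA N)ᵀ * blockD N - (blockC N)ᵀ * blockB N = 1 := by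
  rw [← SymplecticGroup.fromBlocks_mem_iff, fromBlocks_block]
  exact SymplecticGroup.map_mem N.2 (Int.castRingHom ℂ)

theorem block_conjTranspose (N : Sp8) :
    (blockA N)ᴴ = (blockA N)ᵀ ∧ (blockB N)ᴴ = (blockB N)ᵀ ∧
    (blockC N)ᴴ = (blockC N)ᵀ ∧ (blockD N)ᴴ = (blockD N)ᵀ := by
  refine ⟨?_, ?_, ?_, ?_⟩ <;> ext i j <;>
    simp [blockA, blockB, blockC, blockD, toBlocks₁₁, toBlocks₁₂, toBlocks₂₁, toBlocks₂₂]

theorem block_mul (N N' : Sp8) :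
    blockA (N * N') = blockA N * blockA N' + blockB N * blockC N' ∧
    blockB (N * N') = blockA N * blockB N' + blockB N * blockD N' ∧
    blockC (N * N') = blockC N * blockA N' + blockD N * blockC N' ∧
    blockD (N * N') = blockC N * blockB N' + blockD N * blockD N' := by
  have h : (N * N').1.map (Int.cast : ℤ → ℂ) =
      N.1.map (Int.cast : ℤ → ℂ) * N'.1.map (Int.cast : ℤ → ℂ) :=
    Matrix.map_mul (f := Int.castRingHom ℂ)
  rw [← fromBlocks_block, ← fromBlocks_block, ← fromBlocks_block, fromBlocks_multiply,
    fromBlocks_inj] at h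
  exact h

theorem sub_conjTranspose_of_isSymm {τ : Matrix (Fin 4) (Fin 4) ℂ} (hτ : τ.IsSymm) :
    τ - τᴴ = (2 * Complex.I) • (τ.map Complex.im).map Complex.ofReal := by
  ext i j
  have h : τ j i = τ i j := congrFun (congrFun hτ i) j
  apply Complex.ext <;> simp [h]
  ring

section

variable (N : Sp8) {τ : Matrix (Fin 4) (Fin 4) ℂ}

theorem automorphy_symm (hτ : τ.IsSymm) :
    (blockC N * τ + blockD N)ᵀ * (blockA N * τ + blockB N) =
      (blockA N * τ + blockB N)ᵀ * (blockC N * τ + blockD N) := by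
  obtain ⟨h1, h2, h3⟩ := block_relations N
  have h4 : (blockD N)ᵀ * blockA N - (blockB N)ᵀ * blockC N = 1 := by
    have := congrArg transpose h3
    simpa using this
  rw [sub_eq_iff_eq_add] at h3 h4
  rw [transpose_add, transpose_add, transpose_mul, transpose_mul, hτ.eq]
  have e1 : (τ * (blockC N)ᵀ + (blockD N)ᵀ) * (blockA N * τ + blockB N) =
    τ * ((blockC N)ᵀ * blockA N) * τ + τ * ((blockC N)ᵀ * blockB N) +
      ((blockD N)ᵀ * blockA N) * τ + (blockD N)ᵀ * blockB N := by noncomm_ring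
  have e2 : (τ * (blockA N)ᵀ + (blockB N)ᵀ) * (blockC N * τ + blockD N) =
    τ * ((blockA N)ᵀ * blockC N) * τ + τ * ((blockA N)ᵀ * blockD N) +
      ((blockB N)ᵀ * blockC N) * τ + (blockB N)ᵀ * blockD N := by noncomm_ring
  rw [e1, e2, h1, h2, h3, h4]
  noncomm_ring

/-- The sesquilinear companion of `automorphy_symm`: the blocks are real, so the symplectic
relations cancel everything but τ - τᴴ, which is 2i Im τ for symmetric τ. It yields both the
invertibility of cτ + d and the positivity of Im (N · τ). -/
theorem automorphy_herm :
    (blockC N * τ + blockD N)ᴴ * (blockA N * τ + blockB N) -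
      (blockA N * τ + blockB N)ᴴ * (blockC N * τ + blockD N) = τ - τᴴ := by
  obtain ⟨h1, h2, h3⟩ := block_relations N
  obtain ⟨g1, g2, g3, g4⟩ := block_conjTranspose N
  have h4 : (blockD N)ᵀ * blockA N - (blockB N)ᵀ * blockC N = 1 := by
    have := congrArg transpose h3
    simpa using this
  rw [sub_eq_iff_eq_add] at h3 h4
  rw [conjTranspose_add, conjTranspose_add, conjTranspose_mul, conjTranspose_mul, g1, g2, g3, g4]
  have e1 : (τᴴ * (blockC N)ᵀ + (blockD N)ᵀ) * (blockA N * τ + blockB N) =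
    τᴴ * ((blockC N)ᵀ * blockA N) * τ + τᴴ * ((blockC N)ᵀ * blockB N) +
      ((blockD N)ᵀ * blockA N) * τ + (blockD N)ᵀ * blockB N := by noncomm_ring
  have e2 : (τᴴ * (blockA N)ᵀ + (blockB N)ᵀ) * (blockC N * τ + blockD N) =
    τᴴ * ((blockA N)ᵀ * blockC N) * τ + τᴴ * ((blockA N)ᵀ * blockD N) +
      ((blockB N)ᵀ * blockC N) * τ + (blockB N)ᵀ * blockD N := by noncomm_ring
  rw [e1, e2, h1, h2, h3, h4]
  noncomm_ring

theorem posDef_im_complex (hτ : τ ∈ siegelSpace) :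
    ((τ.map Complex.im).map Complex.ofReal).PosDef :=
  posDef_map_ofReal_iff.mpr hτ.2

theorem isUnit_automorphy (hτ : τ ∈ siegelSpace) : IsUnit (blockC N * τ + blockD N) := by
  rw [← Matrix.mulVec_injective_iff_isUnit]
  rw [← Matrix.coe_mulVecLin, ← LinearMap.ker_eq_bot, LinearMap.ker_eq_bot']
  intro z hz
  rw [mulVecLin_apply] at hz
  by_contra h0
  have h := (posDef_im_complex hτ).dotProduct_mulVec_pos h0
  -- If (cτ + d)z = 0, the Hermitian identity evaluated at z gives 2i · zᴴ (Im τ) z = 0, against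
  -- positivity.
  have key := congrArg (fun Q => star z ⬝ᵥ (Q *ᵥ z)) (automorphy_herm N (τ := τ))
  rw [sub_conjTranspose_of_isSymm hτ.1] at key
  simp only [sub_mulVec, dotProduct_sub, smul_mulVec, dotProduct_smul] at key
  rw [← mulVec_mulVec, ← mulVec_mulVec, hz, mulVec_zero, dotProduct_zero, dotProduct_mulVec,
    ← star_mulVec, hz, star_zero, zero_dotProduct, sub_zero, smul_eq_mul] at key
  have h2 : (2 * Complex.I : ℂ) ≠ 0 := by simp
  exact h.ne ((mul_eq_zero.mp key.symm).resolve_left h2).symm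

theorem siegelAct_mul_automorphy (hτ : τ ∈ siegelSpace) :
    siegelAct N τ * (blockC N * τ + blockD N) = blockA N * τ + blockB N := by
  have h := (Matrix.isUnit_iff_isUnit_det _).mp (isUnit_automorphy N hτ)
  rw [siegelAct_eq, Matrix.mul_assoc, Matrix.nonsing_inv_mul _ h, Matrix.mul_one]

theorem siegelAct_eq_of_mul_eq (hτ : τ ∈ siegelSpace) {τ' : Matrix (Fin 4) (Fin 4) ℂ}
    (h : τ' * (blockC N * τ + blockD N) = blockA N * τ + blockB N) : siegelAct N τ = τ' := by
  have hu := (Matrix.isUnit_iff_isUnit_det _).mp (isUnit_automorphy N hτ)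
  rw [siegelAct_eq, ← h, Matrix.mul_assoc, Matrix.mul_nonsing_inv _ hu, Matrix.mul_one]

theorem siegelAct_mem (hτ : τ ∈ siegelSpace) : siegelAct N τ ∈ siegelSpace := by
  have hu := isUnit_automorphy N hτ
  set q := blockC N * τ + blockD N with hq
  have hp := siegelAct_mul_automorphy N hτ
  rw [← hq] at hp
  have hs : (siegelAct N τ).IsSymm := by
    have h := automorphy_symm N hτ.1
    rw [← hq, ← hp, transpose_mul, ← Matrix.mul_assoc] at h
    have h' := hu.mul_right_cancel h
    have hu' : IsUnit qᵀ := by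
      rw [Matrix.isUnit_iff_isUnit_det, det_transpose]
      exact (Matrix.isUnit_iff_isUnit_det _).mp hu
    exact (hu'.mul_left_cancel h').symm
  refine ⟨hs, ?_⟩
  rw [← posDef_map_ofReal_iff, ← hu.posDef_star_left_conjugate_iff]
  have h := automorphy_herm N (τ := τ)
  -- With q = cτ + d the identity reads qᴴ Im(N · τ) q = Im τ up to the factor 2i, so positivity
  -- passes through the congruence by q.
  rw [← hq, ← hp, conjTranspose_mul, ← Matrix.mul_assoc, ← sub_mul, ← mul_sub,
    sub_conjTranspose_of_isSymm hτ.1, sub_conjTranspose_of_isSymm hs, Matrix.mul_smul,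
    Matrix.smul_mul] at h
  have h2 : (2 * Complex.I : ℂ) ≠ 0 := by simp
  rw [Matrix.star_eq_conjTranspose, smul_right_injective _ h2 h]
  exact posDef_im_complex hτ

theorem siegelAct_mul (N' : Sp8) (hτ : τ ∈ siegelSpace) :
    siegelAct (N * N') τ = siegelAct N (siegelAct N' τ) := by
  have hτ' := siegelAct_mem N' hτ
  have h1 := siegelAct_mul_automorphy N' hτ
  have h2 := siegelAct_mul_automorphy N hτ'
  obtain ⟨e1, e2, e3, e4⟩ := block_mul N N'
  apply siegelAct_eq_of_mul_eq _ hτ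
  have k1 : blockA (N * N') * τ + blockB (N * N') =
      (blockA N * siegelAct N' τ + blockB N) * (blockC N' * τ + blockD N') := by
    rw [add_mul, Matrix.mul_assoc, h1, e1, e2]
    noncomm_ring
  have k2 : blockC (N * N') * τ + blockD (N * N') =
      (blockC N * siegelAct N' τ + blockD N) * (blockC N' * τ + blockD N') := by
    rw [add_mul, Matrix.mul_assoc, h1, e3, e4]
    noncomm_ring
  rw [k1, k2, ← h2, Matrix.mul_assoc]

theorem siegelAct_one (hτ : τ ∈ siegelSpace) : siegelAct 1 τ = τ := by
  apply siegelAct_eq_of_mul_eq _ hτ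
  have h : fromBlocks (blockA 1) (blockB 1) (blockC 1) (blockD 1) = fromBlocks 1 0 0 1 := by
    rw [fromBlocks_block, fromBlocks_one]
    exact Matrix.map_one _ Int.cast_zero Int.cast_one
  rw [fromBlocks_inj] at h
  obtain ⟨h1, h2, h3, h4⟩ := h
  rw [h1, h2, h3, h4]
  simp

theorem siegelAct_inv_cancel (hτ : τ ∈ siegelSpace) : siegelAct N⁻¹ (siegelAct N τ) = τ := by
  rw [← siegelAct_mul _ _ hτ, inv_mul_cancel, siegelAct_one hτ]

theorem siegelAct_cancel_inv (hτ : τ ∈ siegelSpace) : siegelAct N (siegelAct N⁻¹ τ) = τ := by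
  rw [← siegelAct_mul _ _ hτ, mul_inv_cancel, siegelAct_one hτ]

end

theorem siegelAct_zpowers_matM {τ : Matrix (Fin 4) (Fin 4) ℂ} (hτ : τ ∈ siegelFixed) {K : Sp8}
    (hK : K ∈ Subgroup.zpowers matM) : siegelAct K τ = τ := by
  have hinv : siegelAct matM⁻¹ τ = τ := by
    conv_lhs => rw [← hτ.2]
    exact siegelAct_inv_cancel _ hτ.1
  obtain ⟨n, rfl⟩ := hK
  induction n using Int.induction_on with
  | zero => simpa using siegelAct_one hτ.1
  | succ i h => simpa only [_root_.zpow_add_one, siegelAct_mul _ _ hτ.1, hτ.2] using h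
  | pred i h => simpa only [_root_.zpow_sub_one, siegelAct_mul _ _ hτ.1, hinv] using h

theorem siegelAct_mem_siegelFixed {N : Sp8} (hN : N ∈ normM) {τ : Matrix (Fin 4) (Fin 4) ℂ}
    (hτ : τ ∈ siegelFixed) : siegelAct N τ ∈ siegelFixed := by
  refine ⟨siegelAct_mem N hτ.1, ?_⟩
  have h : N⁻¹ * matM * N ∈ Subgroup.zpowers matM :=
    (Subgroup.mem_normalizer_iff''.mp hN matM).mp (Subgroup.mem_zpowers matM)
  have e : matM * N = N * (N⁻¹ * matM * N) := by group
  rw [← siegelAct_mul _ _ hτ.1, e, siegelAct_mul _ _ hτ.1, siegelAct_zpowers_matM hτ h]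

end SiegelSpace

/-! ### Summability of the theta series -/

theorem summable_pi_prod {n : ℕ} {f : Fin n → ℤ → ℝ} (h0 : ∀ i k, 0 ≤ f i k)
    (hf : ∀ i, Summable (f i)) : Summable fun m : Fin n → ℤ => ∏ i, f i (m i) := by
  induction n with
  | zero => exact Summable.of_finite
  | succ n ih =>
    rw [← (Fin.consEquiv fun _ : Fin (n + 1) => ℤ).summable_iff]
    have h := (hf 0).mul_of_nonneg (ih (fun i => h0 i.succ) fun i => hf i.succ) (h0 0)
      fun m => Finset.prod_nonneg fun i _ => h0 _ _
    refine h.congr fun p => ?_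
    simp [Fin.prod_univ_succ, Fin.consEquiv]

theorem summable_exp_neg_mul_sq {c : ℝ} (hc : 0 < c) (x : ℝ) :
    Summable fun n : ℤ => Real.exp (-c * ((n : ℝ) + x) ^ 2) := by
  -- With z = icx/π and τ = ic/π the Jacobi theta terms have norm exp(-cn² - 2cnx), which is the
  -- required Gaussian up to the constant exp(-cx²).
  have h := (summable_jacobiTheta₂_term_iff (Complex.I * ((c * x / Real.pi : ℝ) : ℂ))
    (Complex.I * ((c / Real.pi : ℝ) : ℂ))).mpr (by simpa using by positivity)
  refine (h.norm.mul_left (Real.exp (-c * x ^ 2))).congr fun n => ?_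
  rw [norm_jacobiTheta₂_term, ← Real.exp_add]
  congr 1
  simp only [Complex.mul_im, Complex.I_re, Complex.I_im, Complex.ofReal_re, Complex.ofReal_im]
  field_simp
  ring

theorem exists_sum_sq_le_of_posDef {n : ℕ} {Y : Matrix (Fin n) (Fin n) ℝ} (hY : Y.PosDef) :
    ∃ c : ℝ, 0 < c ∧ ∀ x : Fin n → ℝ, c * ∑ i, x i ^ 2 ≤ x ⬝ᵥ (Y *ᵥ x) := by
  rcases Nat.eq_zero_or_pos n with rfl | hn
  · exact ⟨1, one_pos, fun x => by simp⟩
  have : Nonempty (Fin n) := ⟨⟨0, hn⟩⟩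
  have hcont : Continuous fun x : Fin n → ℝ => x ⬝ᵥ (Y *ᵥ x) := by
    simp only [dotProduct, mulVec]; fun_prop
  obtain ⟨x₀, hx₀, hmin⟩ := (isCompact_sphere (0 : Fin n → ℝ) 1).exists_isMinOn
    (NormedSpace.sphere_nonempty.mpr zero_le_one) hcont.continuousOn
  have hx₀' : x₀ ≠ 0 := by
    rintro rfl
    simp at hx₀
  have hpos : 0 < x₀ ⬝ᵥ (Y *ᵥ x₀) := by simpa using hY.dotProduct_mulVec_pos hx₀'
  -- The minimum is taken on the unit sphere of the sup norm; the division by n pays for ∑ xᵢ² ≤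
  -- n‖x‖².
  refine ⟨x₀ ⬝ᵥ (Y *ᵥ x₀) / n, by positivity, fun x => ?_⟩
  have hle : ∑ i, x i ^ 2 ≤ n * ‖x‖ ^ 2 := by
    calc ∑ i, x i ^ 2 ≤ ∑ _i : Fin n, ‖x‖ ^ 2 := by
          refine Finset.sum_le_sum fun i _ => ?_
          rw [← sq_abs]
          exact pow_le_pow_left₀ (abs_nonneg _) (norm_le_pi_norm x i) 2
      _ = n * ‖x‖ ^ 2 := by simp
  have hn' : (0 : ℝ) < n := by exact_mod_cast hn
  calc x₀ ⬝ᵥ (Y *ᵥ x₀) / n * ∑ i, x i ^ 2 ≤ x₀ ⬝ᵥ (Y *ᵥ x₀) / n * (n * ‖x‖ ^ 2) := by gcongr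
    _ = ‖x‖ ^ 2 * (x₀ ⬝ᵥ (Y *ᵥ x₀)) := by field_simp
    _ ≤ x ⬝ᵥ (Y *ᵥ x) := by
      by_cases hx : x = 0
      · simp [hx]
      · have hx' : 0 < ‖x‖ := norm_pos_iff.mpr hx
        have h := hmin (a := ‖x‖⁻¹ • x) (by simp [norm_smul, hx'.ne'])
        simp only [mulVec_smul, dotProduct_smul, smul_dotProduct, smul_eq_mul, Set.mem_ofPred_eq] at h
        calc _ ≤ ‖x‖ ^ 2 * (‖x‖⁻¹ * (‖x‖⁻¹ * x ⬝ᵥ (Y *ᵥ x))) := by gcongr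
          _ = _ := by field_simp

/-- The term `exp(2πi v τ ᵗv)` of the theta series. -/
def quadExp (τ : Matrix (Fin 4) (Fin 4) ℂ) (v : Fin 4 → ℂ) : ℂ :=
  Complex.exp (2 * Real.pi * Complex.I * (v ⬝ᵥ (τ *ᵥ v)))

/-- The point `m + s / 2`. -/
def halfShift (s m : Fin 4 → ℤ) : Fin 4 → ℂ := fun i => (m i : ℂ) + (s i : ℂ) / 2

/-- The series `∑ₘ exp(2πi (m + s/2) τ ᵗ(m + s/2))`, for an integral vector `s`. -/
def thetaSeries (τ : Matrix (Fin 4) (Fin 4) ℂ) (s : Fin 4 → ℤ) : ℂ :=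
  ∑' m, quadExp τ (halfShift s m)

theorem norm_quadExp_ofReal (τ : Matrix (Fin 4) (Fin 4) ℂ) (x : Fin 4 → ℝ) :
    ‖quadExp τ fun i => (x i : ℂ)‖ =
      Real.exp (-(2 * Real.pi) * (x ⬝ᵥ (τ.map Complex.im *ᵥ x))) := by
  rw [quadExp, Complex.norm_exp]
  congr 1
  have h : ((fun i => (x i : ℂ)) ⬝ᵥ (τ *ᵥ fun i => (x i : ℂ))).im =
      x ⬝ᵥ (τ.map Complex.im *ᵥ x) := by
    simp [dotProduct, mulVec, Complex.im_sum, Complex.re_sum]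
  rw [← h]
  simp [Complex.mul_re, Complex.mul_im]

theorem halfShift_eq_ofReal (s m : Fin 4 → ℤ) :
    halfShift s m = fun i => (((m i : ℝ) + (s i : ℝ) / 2 : ℝ) : ℂ) := by
  ext i; simp [halfShift]

theorem summable_norm_quadExp {τ : Matrix (Fin 4) (Fin 4) ℂ} (hτ : τ ∈ siegelSpace)
    (s : Fin 4 → ℤ) : Summable fun m => ‖quadExp τ (halfShift s m)‖ := by
  obtain ⟨c, hc, h⟩ := exists_sum_sq_le_of_posDef hτ.2
  have hs := summable_pi_prod (f := fun i n => Real.exp (-(2 * Real.pi * c) * ((n : ℝ) + s i / 2) ^ 2))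
    (fun _ _ => (Real.exp_pos _).le) fun i => summable_exp_neg_mul_sq (by positivity) _
  refine hs.of_nonneg_of_le (fun _ => norm_nonneg _) fun m => ?_
  rw [halfShift_eq_ofReal, norm_quadExp_ofReal, ← Real.exp_sum, Real.exp_le_exp, ← Finset.mul_sum]
  have := h fun i => (m i : ℝ) + (s i : ℝ) / 2
  have hpi := Real.pi_pos
  nlinarith

theorem summable_quadExp {τ : Matrix (Fin 4) (Fin 4) ℂ} (hτ : τ ∈ siegelSpace)
    (s : Fin 4 → ℤ) : Summable fun m => quadExp τ (halfShift s m) :=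
  (summable_norm_quadExp hτ s).of_norm

theorem thetaNulls_eq (τ : Matrix (Fin 4) (Fin 4) ℂ) (σ : Fin 4 → ZMod 2) :
    thetaNulls τ σ = thetaSeries τ fun i => ((σ i).val : ℤ) := by
  unfold thetaNulls theta thetaSeries
  refine tsum_congr fun m => ?_
  simp only [quadExp]
  congr 1
  have h : (fun i => (0 : Fin 4 → ℂ) i + (((0 : Fin 4 → ℤ) i : ℤ) : ℂ) / 2) = 0 := by
    ext i; simp
  rw [h, dotProduct_zero, smul_mulVec, dotProduct_smul, smul_eq_mul]
  have hv : (fun i => (m i : ℂ) + (((σ i).val : ℤ) : ℂ) / 2) =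
      halfShift (fun i => ((σ i).val : ℤ)) m := rfl
  rw [hv]
  ring

/-- Changing s by 2k is absorbed by the shift m ↦ m + k of the summation lattice. Integral lifts of
a characteristic can therefore be chosen freely. -/
theorem thetaSeries_congr (τ : Matrix (Fin 4) (Fin 4) ℂ) {s s' : Fin 4 → ℤ}
    (h : ∀ i, (s i : ZMod 2) = s' i) : thetaSeries τ s = thetaSeries τ s' := by
  have h' : ∀ i, ∃ k, s i = s' i + 2 * k := fun i => by
    obtain ⟨k, hk⟩ := (ZMod.intCast_eq_intCast_iff_dvd_sub _ _ 2).mp (h i).symm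
    exact ⟨k, by push_cast at hk; linarith⟩
  choose k hk using h'
  unfold thetaSeries
  rw [← (Equiv.addRight k).tsum_eq fun m => quadExp τ (halfShift s' m)]
  refine tsum_congr fun m => ?_
  congr 1
  ext i
  simp only [halfShift, hk, Equiv.coe_addRight, Pi.add_apply]
  push_cast
  ring

theorem thetaNulls_intCast (τ : Matrix (Fin 4) (Fin 4) ℂ) (s : Fin 4 → ℤ) :
    thetaNulls τ (fun i => (s i : ZMod 2)) = thetaSeries τ s := by
  rw [thetaNulls_eq]
  exact thetaSeries_congr τ fun i => by simp

theorem exists_int_lift (σ : Fin 4 → ZMod 2) : ∃ s : Fin 4 → ℤ, σ = fun i => (s i : ZMod 2) :=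
  ⟨fun i => ((σ i).val : ℤ), by ext i; simp⟩

/-! ### The action of `Sp(8, ℤ)` on theta series -/

theorem ActsOnP15.mul {N N' : Sp8} {U U' : ((Fin 4 → ZMod 2) → ℂ) ≃ₗ[ℂ] ((Fin 4 → ZMod 2) → ℂ)}
    (h : ActsOnP15 N U) (h' : ActsOnP15 N' U') : ActsOnP15 (N * N') (U * U') := by
  intro τ hτ
  obtain ⟨c', hc', e'⟩ := h' τ hτ
  obtain ⟨c, hc, e⟩ := h _ (siegelAct_mem N' hτ)
  exact ⟨c * c', mul_ne_zero hc hc', by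
    rw [siegelAct_mul _ _ hτ, e, e', map_smul, smul_smul]; rfl⟩

theorem ActsOnP15.one : ActsOnP15 1 1 := fun τ hτ =>
  ⟨1, one_ne_zero, by rw [siegelAct_one hτ, one_smul]; rfl⟩

theorem ActsOnP15.inv {N : Sp8} {U : ((Fin 4 → ZMod 2) → ℂ) ≃ₗ[ℂ] ((Fin 4 → ZMod 2) → ℂ)}
    (h : ActsOnP15 N U) : ActsOnP15 N⁻¹ U⁻¹ := by
  intro τ hτ
  obtain ⟨c, hc, e⟩ := h _ (siegelAct_mem N⁻¹ hτ)
  refine ⟨c⁻¹, inv_ne_zero hc, ?_⟩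
  rw [siegelAct_cancel_inv _ hτ] at e
  rw [e, map_smul, smul_smul, inv_mul_cancel₀ hc, one_smul]
  exact (U.symm_apply_apply _).symm

/-- The translation `τ ↦ τ + S`. -/
def spTrans (S : Matrix (Fin 4) (Fin 4) ℤ) (hS : S.IsSymm) : Sp8 :=
  ⟨fromBlocks 1 S 0 1, by
    rw [SymplecticGroup.fromBlocks_mem_iff]
    simp [hS.eq]⟩

/-- The transformation `τ ↦ a τ ᵗa`. -/
def spLevi (a d : Matrix (Fin 4) (Fin 4) ℤ) (h : aᵀ * d = 1) : Sp8 :=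
  ⟨fromBlocks a 0 0 d, by
    rw [SymplecticGroup.fromBlocks_mem_iff]
    simp [h]⟩

theorem blocks_of_eq {N : Sp8} {a b c d : Matrix (Fin 4) (Fin 4) ℤ} (h : N.1 = fromBlocks a b c d) :
    blockA N = a.map (Int.cast : ℤ → ℂ) ∧ blockB N = b.map (Int.cast : ℤ → ℂ) ∧
    blockC N = c.map (Int.cast : ℤ → ℂ) ∧ blockD N = d.map (Int.cast : ℤ → ℂ) := by
  simp [blockA, blockB, blockC, blockD, h, fromBlocks_map]

theorem siegelAct_spTrans {S : Matrix (Fin 4) (Fin 4) ℤ} (hS : S.IsSymm)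
    {τ : Matrix (Fin 4) (Fin 4) ℂ} (hτ : τ ∈ siegelSpace) :
    siegelAct (spTrans S hS) τ = τ + S.map (Int.cast : ℤ → ℂ) := by
  obtain ⟨h1, h2, h3, h4⟩ := blocks_of_eq (N := spTrans S hS) rfl
  apply siegelAct_eq_of_mul_eq _ hτ
  rw [h1, h2, h3, h4]
  simp [Matrix.map_one, Matrix.map_zero]

theorem siegelAct_spLevi {a d : Matrix (Fin 4) (Fin 4) ℤ} (h : aᵀ * d = 1)
    {τ : Matrix (Fin 4) (Fin 4) ℂ} (hτ : τ ∈ siegelSpace) :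
    siegelAct (spLevi a d h) τ = a.map (Int.cast : ℤ → ℂ) * τ * (a.map (Int.cast : ℤ → ℂ))ᵀ := by
  obtain ⟨h1, h2, h3, h4⟩ := blocks_of_eq (N := spLevi a d h) rfl
  apply siegelAct_eq_of_mul_eq _ hτ
  rw [h1, h2, h3, h4]
  have h' := congrArg (fun X : Matrix (Fin 4) (Fin 4) ℤ => X.map (Int.castRingHom ℂ)) h
  simp only [Matrix.map_mul] at h'
  have h'' : (a.map (Int.cast : ℤ → ℂ))ᵀ * d.map (Int.cast : ℤ → ℂ) = 1 := by
    refine h'.trans ?_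
    exact Matrix.map_one _ Int.cast_zero Int.cast_one
  simp [Matrix.map_zero, Matrix.mul_assoc, h'']

theorem quadExp_conj (τ a : Matrix (Fin 4) (Fin 4) ℂ) (v : Fin 4 → ℂ) :
    quadExp (a * τ * aᵀ) v = quadExp τ (v ᵥ* a) := by
  unfold quadExp
  rw [← mulVec_mulVec, ← mulVec_mulVec, dotProduct_mulVec, mulVec_transpose]

theorem halfShift_vecMul (a : Matrix (Fin 4) (Fin 4) ℤ) (s m : Fin 4 → ℤ) :
    halfShift s m ᵥ* a.map (Int.cast : ℤ → ℂ) = halfShift (s ᵥ* a) (m ᵥ* a) := by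
  ext j
  simp only [vecMul, dotProduct, halfShift, map_apply, Int.cast_sum, Int.cast_mul, Finset.sum_div,
    ← Finset.sum_add_distrib]
  refine Finset.sum_congr rfl fun i _ => ?_
  ring

theorem thetaSeries_conj {a d : Matrix (Fin 4) (Fin 4) ℤ} (h : aᵀ * d = 1)
    (τ : Matrix (Fin 4) (Fin 4) ℂ) (s : Fin 4 → ℤ) :
    thetaSeries (a.map (Int.cast : ℤ → ℂ) * τ * (a.map (Int.cast : ℤ → ℂ))ᵀ) s =
      thetaSeries τ (s ᵥ* a) := by
  have h1 : a * dᵀ = 1 := by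
    have := congrArg transpose (mul_eq_one_comm.mp h)
    simpa using this
  have h2 : dᵀ * a = 1 := mul_eq_one_comm.mp h1
  let e : (Fin 4 → ℤ) ≃ (Fin 4 → ℤ) :=
    { toFun := fun m => m ᵥ* a
      invFun := fun m => m ᵥ* dᵀ
      left_inv := fun m => by simp [h1]
      right_inv := fun m => by simp [h2] }
  unfold thetaSeries
  rw [← e.tsum_eq fun m => quadExp τ (halfShift (s ᵥ* a) m)]
  refine tsum_congr fun m => ?_
  rw [quadExp_conj, halfShift_vecMul]
  rfl

theorem intCast_vecMul (s : Fin 4 → ℤ) (a : Matrix (Fin 4) (Fin 4) ℤ) :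
    (fun i => ((s ᵥ* a) i : ZMod 2)) =
      (fun i => (s i : ZMod 2)) ᵥ* a.map (Int.cast : ℤ → ZMod 2) := by
  ext j
  simp [vecMul, dotProduct]

theorem thetaNulls_conj {a d : Matrix (Fin 4) (Fin 4) ℤ} (h : aᵀ * d = 1)
    (τ : Matrix (Fin 4) (Fin 4) ℂ) (σ : Fin 4 → ZMod 2) :
    thetaNulls (a.map (Int.cast : ℤ → ℂ) * τ * (a.map (Int.cast : ℤ → ℂ))ᵀ) σ =
      thetaNulls τ (σ ᵥ* a.map (Int.cast : ℤ → ZMod 2)) := by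
  obtain ⟨s, rfl⟩ := exists_int_lift σ
  rw [← intCast_vecMul, thetaNulls_intCast, thetaNulls_intCast, thetaSeries_conj h]

/-- Right multiplication by the reduction of `a`, as a permutation of `(ℤ/2ℤ)⁴`. -/
def charPerm (a d : Matrix (Fin 4) (Fin 4) ℤ) (h : aᵀ * d = 1) :
    (Fin 4 → ZMod 2) ≃ (Fin 4 → ZMod 2) :=
  have h1 : a.map (Int.cast : ℤ → ZMod 2) * (d.map (Int.cast : ℤ → ZMod 2))ᵀ = 1 := by
    have e : a * dᵀ = 1 := by
      have := congrArg transpose (mul_eq_one_comm.mp h)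
      simpa using this
    have := congrArg (fun X : Matrix (Fin 4) (Fin 4) ℤ => X.map (Int.castRingHom (ZMod 2))) e
    simp only [Matrix.map_mul] at this
    exact this.trans (Matrix.map_one _ Int.cast_zero Int.cast_one)
  { toFun := fun σ => σ ᵥ* a.map (Int.cast : ℤ → ZMod 2)
    invFun := fun σ => σ ᵥ* (d.map (Int.cast : ℤ → ZMod 2))ᵀ
    left_inv := fun σ => by simp only [vecMul_vecMul, h1, vecMul_one]
    right_inv := fun σ => by simp only [vecMul_vecMul, mul_eq_one_comm.mp h1, vecMul_one] }

theorem actsOnP15_spLevi {a d : Matrix (Fin 4) (Fin 4) ℤ} (h : aᵀ * d = 1) :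
    ActsOnP15 (spLevi a d h) (LinearEquiv.funCongrLeft ℂ ℂ (charPerm a d h)) := by
  intro τ hτ
  refine ⟨1, one_ne_zero, ?_⟩
  rw [siegelAct_spLevi h hτ, one_smul]
  ext σ
  exact thetaNulls_conj h τ σ

/-- By symmetry of S the two half-integral cross terms combine into the integer m S ᵗs, which the
exponential does not see; only s S ᵗs / 4 remains, a power of i. -/
theorem quadExp_add_intCast (τ : Matrix (Fin 4) (Fin 4) ℂ) {S : Matrix (Fin 4) (Fin 4) ℤ}
    (hS : S.IsSymm) (s m : Fin 4 → ℤ) :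
    quadExp (τ + S.map (Int.cast : ℤ → ℂ)) (halfShift s m) =
      Complex.I ^ (s ⬝ᵥ (S *ᵥ s)) * quadExp τ (halfShift s m) := by
  have hc : ∀ u v : Fin 4 → ℤ, (fun i => (u i : ℂ)) ⬝ᵥ (S.map (Int.cast : ℤ → ℂ) *ᵥ fun i => (v i : ℂ)) =
      ((u ⬝ᵥ (S *ᵥ v) : ℤ) : ℂ) := fun u v => by
    simp [dotProduct, mulVec]
  have e : halfShift s m = (fun i => (m i : ℂ)) + (2⁻¹ : ℂ) • fun i => (s i : ℂ) := by
    ext i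
    simp only [halfShift, Pi.add_apply, Pi.smul_apply, smul_eq_mul]
    ring
  have hsym : s ⬝ᵥ (S *ᵥ m) = m ⬝ᵥ (S *ᵥ s) := by
    rw [dotProduct_mulVec, ← mulVec_transpose, hS.eq, dotProduct_comm]
  have key : halfShift s m ⬝ᵥ (S.map (Int.cast : ℤ → ℂ) *ᵥ halfShift s m) =
      ((m ⬝ᵥ (S *ᵥ m) + m ⬝ᵥ (S *ᵥ s) : ℤ) : ℂ) + ((s ⬝ᵥ (S *ᵥ s) : ℤ) : ℂ) / 4 := by
    rw [e]
    simp only [mulVec_add, mulVec_smul, dotProduct_add, add_dotProduct, dotProduct_smul,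
      smul_dotProduct, hc, hsym, smul_eq_mul]
    push_cast
    ring
  have hI : ∀ n : ℤ, Complex.I ^ n = Complex.exp (n * (Real.pi / 2 * Complex.I)) := fun n => by
    rw [Complex.exp_int_mul, Complex.exp_pi_div_two_mul_I]
  unfold quadExp
  rw [add_mulVec, dotProduct_add, key, mul_add, Complex.exp_add, mul_comm]
  congr 1
  rw [mul_add, Complex.exp_add, mul_comm (2 * Real.pi * Complex.I : ℂ), Complex.exp_int_mul_two_pi_mul_I,
    one_mul, hI]
  congr 1
  ring

theorem thetaSeries_add_intCast (τ : Matrix (Fin 4) (Fin 4) ℂ) {S : Matrix (Fin 4) (Fin 4) ℤ}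
    (hS : S.IsSymm) (s : Fin 4 → ℤ) :
    thetaSeries (τ + S.map (Int.cast : ℤ → ℂ)) s = Complex.I ^ (s ⬝ᵥ (S *ᵥ s)) * thetaSeries τ s := by
  unfold thetaSeries
  rw [← tsum_mul_left]
  exact tsum_congr fun m => quadExp_add_intCast τ hS s m

/-- The factor by which the translation by `S` multiplies the coordinate `X_σ`. -/
def transFactor (S : Matrix (Fin 4) (Fin 4) ℤ) (σ : Fin 4 → ZMod 2) : ℂ :=
  Complex.I ^ ((fun i => ((σ i).val : ℤ)) ⬝ᵥ (S *ᵥ fun i => ((σ i).val : ℤ)))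

theorem transFactor_ne_zero (S : Matrix (Fin 4) (Fin 4) ℤ) (σ : Fin 4 → ZMod 2) :
    transFactor S σ ≠ 0 := zpow_ne_zero _ Complex.I_ne_zero

/-- The diagonal transformation of `ℂ¹⁶` with entries `f`. -/
def diagEquiv {ι : Type*} (f : ι → ℂ) (hf : ∀ i, f i ≠ 0) : (ι → ℂ) ≃ₗ[ℂ] (ι → ℂ) :=
  LinearEquiv.piCongrRight fun i => LinearEquiv.smulOfNeZero ℂ ℂ (f i) (hf i)

theorem diagEquiv_apply {ι : Type*} (f : ι → ℂ) (hf : ∀ i, f i ≠ 0) (X : ι → ℂ) (i : ι) :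
    diagEquiv f hf X i = f i * X i := rfl

theorem actsOnP15_spTrans {S : Matrix (Fin 4) (Fin 4) ℤ} (hS : S.IsSymm) :
    ActsOnP15 (spTrans S hS) (diagEquiv (transFactor S) (transFactor_ne_zero S)) := by
  intro τ hτ
  refine ⟨1, one_ne_zero, ?_⟩
  rw [siegelAct_spTrans hS hτ, one_smul]
  ext σ
  rw [diagEquiv_apply, thetaNulls_eq, thetaNulls_eq, thetaSeries_add_intCast _ hS]
  rfl

/-! ### Partial inversions -/

theorem hasSum_int_even_add_odd {f : ℤ → ℂ} {x y : ℂ} (he : HasSum (fun k => f (2 * k)) x)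
    (ho : HasSum (fun k => f (2 * k + 1)) y) : HasSum f (x + y) := by
  have h := mul_right_injective₀ (two_ne_zero' ℤ)
  replace ho := ((add_left_injective 1).comp h).hasSum_range_iff.2 ho
  refine (h.hasSum_range_iff.2 he).add_isCompl ?_ ho
  have e : Set.range (fun k : ℤ => 2 * k) = {n | Even n} := by
    ext n
    refine ⟨fun ⟨k, hk⟩ => hk ▸ even_two_mul k, fun hn => ?_⟩
    obtain ⟨k, hk⟩ := Even.two_dvd hn
    exact ⟨k, hk.symm⟩
  have e' : Set.range ((fun k : ℤ => k + 1) ∘ fun k : ℤ => 2 * k) = {n | Odd n} := by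
    ext n
    exact ⟨fun ⟨k, hk⟩ => hk ▸ odd_two_mul_add_one k, fun ⟨k, hk⟩ => ⟨k, hk.symm⟩⟩
  rw [e, e']
  exact Int.isCompl_even_odd

/-- The exponent on the left is -((n + s/2) - L)²/t. Jacobi's functional equation at the point L -
s/2 and the modulus t/2 turns the sum into a theta series whose even and odd indices give the
characteristics 0 and 1. -/
theorem tsum_gaussian_inversion {t : ℂ} (ht : 0 < t.im) (L : ℂ) (s : ℤ) :
    ∑' n : ℤ, Complex.exp (2 * Real.pi * Complex.I *
        (-1 / t * (n + s / 2) ^ 2 + 2 * (n + s / 2) * (L / t) - L ^ 2 / t)) =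
      (-Complex.I * (t / 2)) ^ (1 / 2 : ℂ) *
        (∑' n : ℤ, Complex.exp (2 * Real.pi * Complex.I *
            (t * (n + (0 : ℤ) / 2) ^ 2 + 2 * (n + (0 : ℤ) / 2) * L)) +
          (-1) ^ s * ∑' n : ℤ, Complex.exp (2 * Real.pi * Complex.I *
            (t * (n + (1 : ℤ) / 2) ^ 2 + 2 * (n + (1 : ℤ) / 2) * L))) := by
  have ht0 : t ≠ 0 := fun h => by simp [h] at ht
  have ht2 : 0 < (t / 2).im := by
    rw [Complex.div_ofNat_im]
    positivity
  have hexp : ∀ n : ℤ, Complex.exp (Real.pi * Complex.I * n) = (-1) ^ n := fun n => by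
    rw [mul_comm, Complex.exp_int_mul, Complex.exp_pi_mul_I]
  have hF := jacobiTheta₂_functional_equation (L - s / 2) (t / 2)
  have hroot : (-Complex.I * (t / 2)) ^ (1 / 2 : ℂ) ≠ 0 := by
    rw [Complex.cpow_ne_zero_iff_of_exponent_ne_zero (by norm_num)]
    simp [ht0]
  have hsum : ∑' n : ℤ, Complex.exp (2 * Real.pi * Complex.I *
        (-1 / t * (n + s / 2) ^ 2 + 2 * (n + s / 2) * (L / t) - L ^ 2 / t)) =
      Complex.exp (-Real.pi * Complex.I * (L - s / 2) ^ 2 / (t / 2)) *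
        jacobiTheta₂ ((L - s / 2) / (t / 2)) (-1 / (t / 2)) := by
    unfold jacobiTheta₂
    rw [← tsum_mul_left]
    refine tsum_congr fun n => ?_
    rw [jacobiTheta₂_term, ← Complex.exp_add]
    congr 1
    field_simp
    ring
  have hF' : ∑' n : ℤ, Complex.exp (2 * Real.pi * Complex.I *
        (-1 / t * (n + s / 2) ^ 2 + 2 * (n + s / 2) * (L / t) - L ^ 2 / t)) =
      (-Complex.I * (t / 2)) ^ (1 / 2 : ℂ) * jacobiTheta₂ (L - s / 2) (t / 2) := by
    rw [hF, hsum]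
    field_simp
  rw [hF']
  congr 1
  have hs := hasSum_jacobiTheta₂_term (L - s / 2) ht2
  have h0 : ∀ n : ℤ, jacobiTheta₂_term (2 * n) (L - s / 2) (t / 2) =
      Complex.exp (2 * Real.pi * Complex.I *
            (t * (n + (0 : ℤ) / 2) ^ 2 + 2 * (n + (0 : ℤ) / 2) * L)) := fun n => by
    rw [jacobiTheta₂_term]
    rw [Complex.exp_eq_exp_iff_exists_int]
    refine ⟨-(n * s), ?_⟩
    push_cast
    ring
  have h1 : ∀ n : ℤ, jacobiTheta₂_term (2 * n + 1) (L - s / 2) (t / 2) =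
      (-1) ^ s * Complex.exp (2 * Real.pi * Complex.I *
            (t * (n + (1 : ℤ) / 2) ^ 2 + 2 * (n + (1 : ℤ) / 2) * L)) := fun n => by
    rw [jacobiTheta₂_term, ← hexp, ← Complex.exp_add]
    rw [Complex.exp_eq_exp_iff_exists_int]
    refine ⟨-(n * s) - s, ?_⟩
    push_cast
    ring
  have hs0 : Summable fun n : ℤ => jacobiTheta₂_term (2 * n) (L - s / 2) (t / 2) :=
    hs.summable.comp_injective fun a b h => by simpa using h
  have hs1 : Summable fun n : ℤ => jacobiTheta₂_term (2 * n + 1) (L - s / 2) (t / 2) :=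
    hs.summable.comp_injective (i := fun n : ℤ => 2 * n + 1) fun a b h => by simpa using h
  rw [hs.unique (hasSum_int_even_add_odd hs0.hasSum hs1.hasSum)]
  simp_rw [h0, h1]
  rw [tsum_mul_left]

/-- The matrix `τ` transformed by the inversion in the coordinate `j`. -/
def invTau (j : Fin 4) (τ : Matrix (Fin 4) (Fin 4) ℂ) : Matrix (Fin 4) (Fin 4) ℂ :=
  fun k l => if k = j then (if l = j then -1 / τ j j else τ j l / τ j j)
    else if l = j then τ k j / τ j j else τ k l - τ k j * τ j l / τ j j

/-- The inversion in the coordinate `j`. -/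
def spInv (j : Fin 4) : Sp8 :=
  ⟨fromBlocks (1 - Matrix.single j j 1) (-Matrix.single j j 1) (Matrix.single j j 1)
    (1 - Matrix.single j j 1), by
    rw [SymplecticGroup.fromBlocks_mem_iff]
    simp [mul_sub, sub_mul]⟩

theorem im_diag_pos {τ : Matrix (Fin 4) (Fin 4) ℂ} (hτ : τ ∈ siegelSpace) (j : Fin 4) :
    0 < (τ j j).im := hτ.2.diag_pos

theorem siegelAct_spInv (j : Fin 4) {τ : Matrix (Fin 4) (Fin 4) ℂ} (hτ : τ ∈ siegelSpace) :
    siegelAct (spInv j) τ = invTau j τ := by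
  obtain ⟨h1, h2, h3, h4⟩ := blocks_of_eq (N := spInv j) rfl
  apply siegelAct_eq_of_mul_eq _ hτ
  have hm : (Matrix.single j j (1 : ℤ)).map (Int.cast : ℤ → ℂ) = Matrix.single j j 1 := by
    ext k l; simp [Matrix.single_apply]
  have hm' : (1 - Matrix.single j j (1 : ℤ)).map (Int.cast : ℤ → ℂ) = 1 - Matrix.single j j 1 := by
    ext k l
    simp [Matrix.single_apply, Matrix.one_apply]
  have hm'' : (-Matrix.single j j (1 : ℤ)).map (Int.cast : ℤ → ℂ) = -Matrix.single j j 1 := by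
    ext k l; simp [Matrix.single_apply]
  have h0 : τ j j ≠ 0 := fun h => by have := im_diag_pos hτ j; simp [h] at this
  rw [h1, h2, h3, h4, hm, hm', hm'']
  ext k l
  have e : ∀ X : Matrix (Fin 4) (Fin 4) ℂ, ∀ k l, (Matrix.single j j (1 : ℂ) * X) k l =
      if k = j then X j l else 0 := fun X k l => by
    simp only [Matrix.mul_apply, Matrix.single_apply]
    by_cases h : k = j
    · subst h; simp
    · simp [h, Ne.symm h]
  have e' : ∀ X : Matrix (Fin 4) (Fin 4) ℂ, ∀ k l, (X * Matrix.single j j (1 : ℂ)) k l =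
      if l = j then X k j else 0 := fun X k l => by
    simp only [Matrix.mul_apply, Matrix.single_apply]
    by_cases h : l = j
    · subst h; simp
    · simp [h, Ne.symm h]
  simp only [mul_add, mul_sub, sub_mul, Matrix.mul_one, Matrix.one_mul, Matrix.add_apply, Matrix.sub_apply, e, e',
    ← Matrix.mul_assoc, Matrix.neg_apply, Matrix.single_apply]
  have e2 : (invTau j τ * Matrix.single j j (1 : ℂ) * τ) k l = invTau j τ k j * τ j l := by
    simp only [Matrix.mul_apply, Matrix.single_apply]
    simp [ite_and]
  rw [e2]
  unfold invTau
  by_cases hk : k = j <;> by_cases hl : l = j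
  · subst hk; subst hl; simp; field_simp
  · subst hk; simp [hl, Ne.symm hl]; field_simp; simp
  · subst hl; simp [hk, Ne.symm hk]; field_simp
  · simp [hk, hl, Ne.symm hk]; field_simp; simp

/-- The linear part of the quadratic form `τ` in the variable with index `j`. -/
def crossTerm (τ : Matrix (Fin 4) (Fin 4) ℂ) (j : Fin 4) (w : Fin 3 → ℂ) : ℂ :=
  ∑ k, τ j (j.succAbove k) * w k

/-- The part of the quadratic form `τ` not involving the variable with index `j`. -/
def restTerm (τ : Matrix (Fin 4) (Fin 4) ℂ) (j : Fin 4) (w : Fin 3 → ℂ) : ℂ :=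
  ∑ k, ∑ l, w k * τ (j.succAbove k) (j.succAbove l) * w l

theorem quadExp_insertNth {τ : Matrix (Fin 4) (Fin 4) ℂ} (hτ : τ.IsSymm) (j : Fin 4) (x : ℂ)
    (w : Fin 3 → ℂ) : quadExp τ (j.insertNth x w) =
      Complex.exp (2 * Real.pi * Complex.I * restTerm τ j w) *
        Complex.exp (2 * Real.pi * Complex.I * (τ j j * x ^ 2 + 2 * x * crossTerm τ j w)) := by
  rw [quadExp, ← Complex.exp_add]
  congr 1
  have hs : ∀ k l, τ k l = τ l k := fun k l => congrFun (congrFun hτ l) k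
  simp only [dotProduct, mulVec, Fin.sum_univ_succAbove _ j, Fin.insertNth_apply_same,
    Fin.insertNth_apply_succAbove, crossTerm, restTerm]
  have e1 : ∀ k, τ (j.succAbove k) j = τ j (j.succAbove k) := fun k => hs _ _
  simp only [e1, mul_add, Finset.mul_sum, Finset.sum_add_distrib]
  have e2 : ∑ k, 2 * Real.pi * Complex.I * (w k * (τ j (j.succAbove k) * x)) =
      ∑ k, 2 * Real.pi * Complex.I * (x * (τ j (j.succAbove k) * w k)) :=
    Finset.sum_congr rfl fun k _ => by ring
  have e3 : ∑ k, 2 * Real.pi * Complex.I * (2 * x * (τ j (j.succAbove k) * w k)) =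
      ∑ k, 2 * Real.pi * Complex.I * (x * (τ j (j.succAbove k) * w k)) +
      ∑ k, 2 * Real.pi * Complex.I * (x * (τ j (j.succAbove k) * w k)) := by
    rw [← Finset.sum_add_distrib]
    exact Finset.sum_congr rfl fun k _ => by ring
  have e4 : ∀ k l, 2 * Real.pi * Complex.I * (w k * (τ (j.succAbove k) (j.succAbove l) * w l)) =
      2 * Real.pi * Complex.I * (w k * τ (j.succAbove k) (j.succAbove l) * w l) :=
    fun k l => by ring
  simp only [e2, e3, e4]
  ring

theorem crossTerm_invTau (τ : Matrix (Fin 4) (Fin 4) ℂ) (j : Fin 4) (w : Fin 3 → ℂ) :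
    crossTerm (invTau j τ) j w = crossTerm τ j w / τ j j := by
  simp only [crossTerm, Finset.sum_div]
  refine Finset.sum_congr rfl fun k _ => ?_
  simp [invTau, Fin.succAbove_ne]
  ring

/-- The correction is the square completed in the variable j: off that variable `invTau` is the
Schur complement of τ j j. -/
theorem restTerm_invTau {τ : Matrix (Fin 4) (Fin 4) ℂ} (hτ : τ.IsSymm) (j : Fin 4)
    (w : Fin 3 → ℂ) :
    restTerm (invTau j τ) j w = restTerm τ j w - crossTerm τ j w ^ 2 / τ j j := by
  have hs : ∀ k l, τ k l = τ l k := fun k l => congrFun (congrFun hτ l) k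
  simp only [restTerm, crossTerm, sq, Finset.sum_mul_sum, Finset.sum_div, ← Finset.sum_sub_distrib]
  refine Finset.sum_congr rfl fun k _ => Finset.sum_congr rfl fun l _ => ?_
  simp only [invTau, Fin.succAbove_ne, if_false]
  rw [hs _ j]
  ring

theorem halfShift_insertNth (s : Fin 4 → ℤ) (j : Fin 4) (n : ℤ) (m : Fin 3 → ℤ) :
    halfShift s (j.insertNth (α := fun _ => ℤ) n m) =
      j.insertNth (α := fun _ => ℂ) ((n : ℂ) + s j / 2)
        fun k => (m k : ℂ) + s (j.succAbove k) / 2 := by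
  ext i
  refine j.succAboveCases ?_ (fun k => ?_) i <;> simp [halfShift]

theorem thetaSeries_eq_iterated {τ : Matrix (Fin 4) (Fin 4) ℂ} (hτ : τ ∈ siegelSpace) (j : Fin 4)
    (s : Fin 4 → ℤ) :
    Summable (fun m : Fin 3 → ℤ => ∑' n : ℤ,
      quadExp τ (halfShift s (j.insertNth (α := fun _ => ℤ) n m))) ∧
    thetaSeries τ s = ∑' m : Fin 3 → ℤ, ∑' n : ℤ,
      quadExp τ (halfShift s (j.insertNth (α := fun _ => ℤ) n m)) := by
  let e : (Fin 3 → ℤ) × ℤ ≃ (Fin 4 → ℤ) :=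
    (Equiv.prodComm _ _).trans (Fin.insertNthEquiv (fun _ => ℤ) j)
  have hs : Summable fun p => quadExp τ (halfShift s (e p)) :=
    e.summable_iff.mpr (summable_quadExp hτ s)
  refine ⟨hs.prod, ?_⟩
  rw [thetaSeries, ← e.tsum_eq]
  exact hs.tsum_prod

/-- For fixed values of the other three variables, the sum over the variable j is a one-dimensional
Gaussian sum with linear term `crossTerm`, to which `tsum_gaussian_inversion` applies. Absolute
convergence allows the iterated summation. -/
theorem thetaSeries_invTau {τ : Matrix (Fin 4) (Fin 4) ℂ} (hτ : τ ∈ siegelSpace) (j : Fin 4)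
    (s : Fin 4 → ℤ) :
    thetaSeries (invTau j τ) s = (-Complex.I * (τ j j / 2)) ^ (1 / 2 : ℂ) *
      (thetaSeries τ (Function.update s j 0) +
        (-1) ^ s j * thetaSeries τ (Function.update s j 1)) := by
  have hτ' : invTau j τ ∈ siegelSpace := siegelAct_spInv j hτ ▸ siegelAct_mem (spInv j) hτ
  obtain ⟨h0, e0⟩ := thetaSeries_eq_iterated hτ j (Function.update s j 0)
  obtain ⟨h1, e1⟩ := thetaSeries_eq_iterated hτ j (Function.update s j 1)
  rw [(thetaSeries_eq_iterated hτ' j s).2, e0, e1, ← tsum_mul_left, ← (h0.tsum_add (h1.mul_left _)),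
    ← tsum_mul_left]
  refine tsum_congr fun m => ?_
  have hup : ∀ (x : ℤ) (k : Fin 3), Function.update s j x (j.succAbove k) = s (j.succAbove k) :=
    fun x k => Function.update_of_ne (Fin.succAbove_ne j k) _ _
  simp only [halfShift_insertNth, quadExp_insertNth hτ.1, quadExp_insertNth hτ'.1, hup,
    Function.update_self, tsum_mul_left, crossTerm_invTau, restTerm_invTau hτ.1]
  set w : Fin 3 → ℂ := fun k => (m k : ℂ) + s (j.succAbove k) / 2
  have key := tsum_gaussian_inversion (im_diag_pos hτ j) (crossTerm τ j w) (s j)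
  have e2 : ∀ n : ℤ, Complex.exp (2 * Real.pi * Complex.I * (-1 / τ j j * (n + s j / 2) ^ 2 +
      2 * (n + s j / 2) * (crossTerm τ j w / τ j j) - crossTerm τ j w ^ 2 / τ j j)) =
      Complex.exp (-(2 * Real.pi * Complex.I * (crossTerm τ j w ^ 2 / τ j j))) *
      Complex.exp (2 * Real.pi * Complex.I * (invTau j τ j j * (n + s j / 2) ^ 2 +
        2 * (n + s j / 2) * (crossTerm τ j w / τ j j))) := fun n => by
    rw [← Complex.exp_add]
    congr 1
    simp only [invTau, if_true]
    ring
  simp_rw [e2] at key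
  rw [tsum_mul_left] at key
  rw [mul_sub, sub_eq_add_neg, Complex.exp_add, mul_assoc, key]
  ring

theorem zmod_two_cases : ∀ t : ZMod 2, t = 0 ∨ t = 1 := by decide

/-- The partial Fourier transform in the coordinate `j`. -/
def partialFourier (j : Fin 4) : ((Fin 4 → ZMod 2) → ℂ) ≃ₗ[ℂ] ((Fin 4 → ZMod 2) → ℂ) where
  toFun X σ := X (Function.update σ j 0) + (-1) ^ (σ j).val * X (Function.update σ j 1)
  map_add' X Y := by ext σ; simp; ring
  map_smul' c X := by ext σ; simp; ring
  invFun X σ := (X (Function.update σ j 0) + (-1) ^ (σ j).val * X (Function.update σ j 1)) / 2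
  left_inv X := by
    ext σ
    rcases zmod_two_cases (σ j) with h | h <;>
      have e : Function.update σ j (σ j) = σ := Function.update_eq_self j σ <;>
      rw [h] at e <;>
      simp only [Function.update_idem, Function.update_self, h, ZMod.val_zero, ZMod.val_one, e] <;>
      ring
  right_inv X := by
    ext σ
    rcases zmod_two_cases (σ j) with h | h <;>
      have e : Function.update σ j (σ j) = σ := Function.update_eq_self j σ <;>
      rw [h] at e <;>
      simp only [Function.update_idem, Function.update_self, h, ZMod.val_zero, ZMod.val_one, e] <;>
      ring

theorem partialFourier_apply (j : Fin 4) (X : (Fin 4 → ZMod 2) → ℂ) (σ : Fin 4 → ZMod 2) :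
    partialFourier j X σ =
      X (Function.update σ j 0) + (-1) ^ (σ j).val * X (Function.update σ j 1) := rfl

theorem actsOnP15_spInv (j : Fin 4) : ActsOnP15 (spInv j) (partialFourier j) := by
  intro τ hτ
  refine ⟨(-Complex.I * (τ j j / 2)) ^ (1 / 2 : ℂ), ?_, ?_⟩
  · rw [Complex.cpow_ne_zero_iff_of_exponent_ne_zero (by norm_num)]
    have h0 : τ j j ≠ 0 := fun h => by have := im_diag_pos hτ j; simp [h] at this
    simp [h0]
  · ext σ
    rw [siegelAct_spInv j hτ, Pi.smul_apply, smul_eq_mul, partialFourier_apply]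
    obtain ⟨s, rfl⟩ := exists_int_lift σ
    have hu : ∀ x : ℤ, Function.update (fun i => (s i : ZMod 2)) j (x : ZMod 2) =
        fun i => (Function.update s j x i : ZMod 2) := fun x => by
      ext i
      by_cases h : i = j
      · subst h; simp
      · simp [h]
    have h0 := hu 0
    have h1 := hu 1
    simp only [Int.cast_zero, Int.cast_one] at h0 h1
    rw [h0, h1, thetaNulls_intCast, thetaNulls_intCast, thetaNulls_intCast, thetaSeries_invTau hτ]
    congr 3
    change _ = (-1 : ℂ) ^ (s j : ZMod 2).val
    rcases Int.even_or_odd (s j) with h | h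
    · rw [h.neg_one_zpow, (ZMod.intCast_eq_zero_iff_even).mpr h]; simp
    · rw [h.neg_one_zpow, (ZMod.intCast_eq_one_iff_odd).mpr h]; simp [ZMod.val_one]

/-! ### The Weyl group -/

theorem bForm_apply (X Y : Fin 6 → ℂ) : bForm X Y =
    1 / 3 * (X 0 * Y 0) + X 1 * Y 1 + X 2 * Y 2 + X 3 * Y 3 + X 4 * Y 4 + X 5 * Y 5 := rfl

theorem simpleReflection_apply (i : Fin 6) (X : Fin 6 → ℂ) :
    simpleReflection i X = X - bForm X (simpleRoot i) • simpleRoot i := rfl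

theorem simpleReflection_mem (i : Fin 6) : simpleReflection i ∈ weylE6 :=
  Subgroup.subset_closure ⟨i, rfl⟩

theorem simpleReflection_zero_apply (X : Fin 6 → ℂ) :
    simpleReflection 0 X = ![X 0, -X 2, -X 1, X 3, X 4, X 5] := by
  rw [simpleReflection_apply]
  ext i; fin_cases i <;> simp [bForm_apply, simpleRoot]

theorem simpleReflection_one_apply (X : Fin 6 → ℂ) :
    simpleReflection 1 X =
      let t := (X 0 - X 1 + X 2 + X 3 + X 4 + X 5) / 4
      ![X 0 - 3 * t, X 1 + t, X 2 - t, X 3 - t, X 4 - t, X 5 - t] := by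
  rw [simpleReflection_apply]
  ext i; fin_cases i <;> simp [bForm_apply, simpleRoot] <;> ring

theorem simpleReflection_two_apply (X : Fin 6 → ℂ) :
    simpleReflection 2 X = ![X 0, X 2, X 1, X 3, X 4, X 5] := by
  rw [simpleReflection_apply]
  ext i; fin_cases i <;> simp [bForm_apply, simpleRoot]

theorem simpleReflection_three_apply (X : Fin 6 → ℂ) :
    simpleReflection 3 X = ![X 0, X 1, X 3, X 2, X 4, X 5] := by
  rw [simpleReflection_apply]
  ext i; fin_cases i <;> simp [bForm_apply, simpleRoot]

theorem simpleReflection_four_apply (X : Fin 6 → ℂ) :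
    simpleReflection 4 X = ![X 0, X 1, X 2, X 4, X 3, X 5] := by
  rw [simpleReflection_apply]
  ext i; fin_cases i <;> simp [bForm_apply, simpleRoot]

theorem simpleReflection_five_apply (X : Fin 6 → ℂ) :
    simpleReflection 5 X = ![X 0, X 1, X 2, X 3, X 5, X 4] := by
  rw [simpleReflection_apply]
  ext i; fin_cases i <;> simp [bForm_apply, simpleRoot]

theorem linB_eq_simpleReflection : linB = simpleReflection 5 := by
  ext X : 1
  rw [simpleReflection_five_apply]
  rfl

/-- The permutation of coordinates `X ↦ X ∘ π`. -/
def permLin (π : Equiv.Perm (Fin 6)) : (Fin 6 → ℂ) ≃ₗ[ℂ] (Fin 6 → ℂ) :=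
  LinearEquiv.funCongrLeft ℂ ℂ π

theorem permLin_apply (π : Equiv.Perm (Fin 6)) (X : Fin 6 → ℂ) (i : Fin 6) :
    permLin π X i = X (π i) := rfl

theorem permLin_mul (π π' : Equiv.Perm (Fin 6)) :
    permLin (π * π') = permLin π' * permLin π := rfl

/-- The reflections in α₃, …, α₆ are the adjacent transpositions of the last five coordinates, which
generate the symmetric group S₅. -/
theorem permLin_mem_weylE6 {π : Equiv.Perm (Fin 6)} (h : π 0 = 0) : permLin π ∈ weylE6 := by
  obtain ⟨⟨p, e⟩, rfl⟩ := Equiv.Perm.decomposeFin.symm.surjective π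
  rw [Equiv.Perm.decomposeFin_symm_apply_zero] at h
  subst h
  have htop : e ∈ Submonoid.closure
      (Set.range fun i : Fin 4 => Equiv.swap i.castSucc i.succ) := by
    rw [Equiv.Perm.mclosure_swap_castSucc_succ]
    trivial
  have hadj : ∀ i : Fin 4, permLin (Equiv.Perm.decomposeFin.symm (0, Equiv.swap i.castSucc i.succ)) =
      simpleReflection ⟨i + 2, by omega⟩ := by
    intro i
    ext X k
    rw [permLin_apply]
    fin_cases i
    · change _ = simpleReflection 2 X k
      rw [simpleReflection_two_apply]; fin_cases k <;> rfl
    · change _ = simpleReflection 3 X k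
      rw [simpleReflection_three_apply]; fin_cases k <;> rfl
    · change _ = simpleReflection 4 X k
      rw [simpleReflection_four_apply]; fin_cases k <;> rfl
    · change _ = simpleReflection 5 X k
      rw [simpleReflection_five_apply]; fin_cases k <;> rfl
  have hmul : ∀ e e' : Equiv.Perm (Fin 5), Equiv.Perm.decomposeFin.symm (0, e * e') =
      Equiv.Perm.decomposeFin.symm (0, e) * Equiv.Perm.decomposeFin.symm (0, e') := by
    intro e e'
    ext k
    refine Fin.cases ?_ (fun k => ?_) k <;> simp
  induction htop using Submonoid.closure_induction with
  | mem x hx =>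
    obtain ⟨i, rfl⟩ := hx
    change permLin (Equiv.Perm.decomposeFin.symm (0, Equiv.swap i.castSucc i.succ)) ∈ _
    rw [hadj]
    exact simpleReflection_mem _
  | one =>
    convert one_mem weylE6
    ext X k
    rw [permLin_apply]
    refine Fin.cases ?_ (fun k => ?_) k <;> simp
  | mul x y _ _ hx hy =>
    rw [hmul, permLin_mul]
    exact mul_mem hy hx

/-- The diagonal transformation with the signs `(-1) ^ e i`. -/
def signLin (e : Fin 6 → ℤ) : (Fin 6 → ℂ) ≃ₗ[ℂ] (Fin 6 → ℂ) :=
  diagEquiv (fun i => (-1 : ℂ) ^ e i) fun i => zpow_ne_zero _ (by norm_num)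

theorem signLin_apply (e : Fin 6 → ℤ) (X : Fin 6 → ℂ) (i : Fin 6) :
    signLin e X i = (-1 : ℂ) ^ e i * X i := rfl

theorem signLin_add (e e' : Fin 6 → ℤ) : signLin (e + e') = signLin e * signLin e' := by
  ext X i
  simp only [signLin_apply, LinearEquiv.mul_apply, Pi.add_apply]
  rw [zpow_add₀ (by norm_num), mul_assoc]

theorem signLin_congr {e e' : Fin 6 → ℤ} (h : ∀ i, Even (e i - e' i)) : signLin e = signLin e' := by
  ext X i
  rw [signLin_apply, signLin_apply]
  congr 1
  rw [← sub_add_cancel (e i) (e' i), zpow_add₀ (by norm_num), (h i).neg_one_zpow, one_mul]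

theorem signLin_zsmul_single_mem {j : Fin 6} (hj : j ≠ 0) (hj' : j ≠ 1) (n : ℤ) :
    signLin (n • (Pi.single 1 1 + Pi.single j 1)) ∈ weylE6 := by
  have h2 : signLin (Pi.single 1 1 + Pi.single 2 1) ∈ weylE6 := by
    -- α₁ = -e₁ - e₂ and α₃ = e₁ - e₂ are orthogonal, and their reflections compose to -1 on the
    -- plane of e₁, e₂.
    have e : signLin (Pi.single 1 1 + Pi.single 2 1) = simpleReflection 0 * simpleReflection 2 := by
      ext X i
      rw [signLin_apply, LinearEquiv.mul_apply, simpleReflection_zero_apply,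
        simpleReflection_two_apply]
      fin_cases i <;> simp
    rw [e]
    exact mul_mem (simpleReflection_mem _) (simpleReflection_mem _)
  have hj2 : signLin (Pi.single 1 1 + Pi.single j 1) ∈ weylE6 := by
    have hπ : permLin (Equiv.swap 2 j) ∈ weylE6 :=
      permLin_mem_weylE6 (Equiv.swap_apply_of_ne_of_ne (by decide) hj.symm)
    have e : signLin (Pi.single 1 1 + Pi.single j 1) =
        permLin (Equiv.swap 2 j) * signLin (Pi.single 1 1 + Pi.single 2 1) *
          permLin (Equiv.swap 2 j) := by
      ext X i
      simp only [LinearEquiv.mul_apply, permLin_apply, signLin_apply, Equiv.swap_apply_self]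
      congr 2
      have h1 : Equiv.swap 2 j i = 1 ↔ i = 1 := by
        rw [Equiv.swap_apply_eq_iff, Equiv.swap_apply_of_ne_of_ne (by decide) hj'.symm]
      have h2 : Equiv.swap 2 j i = 2 ↔ i = j := by
        rw [Equiv.swap_apply_eq_iff, Equiv.swap_apply_left]
      simp only [Pi.add_apply, Pi.single_apply, h1, h2]
    rw [e]
    exact mul_mem (mul_mem hπ h2) hπ
  rcases Int.even_or_odd n with hn | hn
  · convert one_mem weylE6
    ext X i
    rw [signLin_apply, Pi.smul_apply, smul_eq_mul, (hn.mul_right _).neg_one_zpow, one_mul]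
    rfl
  · rw [signLin_congr (e' := Pi.single 1 1 + Pi.single j 1)]
    · exact hj2
    · intro i
      rw [Pi.smul_apply, smul_eq_mul, ← sub_one_mul]
      exact (hn.sub_odd odd_one).mul_right _

/-- Flips of the pairs {1, j} suffice, since the parity condition determines the sign at 1 from
those at 2, …, 5. -/
theorem signLin_mem_weylE6 {e : Fin 6 → ℤ} (h0 : Even (e 0)) (h : Even (∑ i, e i)) :
    signLin e ∈ weylE6 := by
  have e' : signLin e = signLin (e 2 • (Pi.single 1 1 + Pi.single 2 1)) *
      signLin (e 3 • (Pi.single 1 1 + Pi.single 3 1)) *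
      signLin (e 4 • (Pi.single 1 1 + Pi.single 4 1)) *
      signLin (e 5 • (Pi.single 1 1 + Pi.single 5 1)) := by
    rw [← signLin_add, ← signLin_add, ← signLin_add]
    apply signLin_congr
    simp only [Fin.sum_univ_six] at h
    intro i
    fin_cases i <;> simp <;> grind
  rw [e']
  exact mul_mem (mul_mem (mul_mem (signLin_zsmul_single_mem (by decide) (by decide) _)
    (signLin_zsmul_single_mem (by decide) (by decide) _))
    (signLin_zsmul_single_mem (by decide) (by decide) _))
    (signLin_zsmul_single_mem (by decide) (by decide) _)

theorem linD_eq_signLin : linD = signLin ![0, 0, 1, 1, 1, 1] := by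
  ext X i
  rw [signLin_apply]
  fin_cases i <;> simp [linD]

theorem linE_eq_signLin : linE = signLin ![0, 0, 0, 1, 1, 0] := by
  ext X i
  rw [signLin_apply]
  fin_cases i <;> simp [linE]

theorem linB_mem_weylE6 : linB ∈ weylE6 := linB_eq_simpleReflection ▸ simpleReflection_mem 5

theorem linD_mem_weylE6 : linD ∈ weylE6 := by
  rw [linD_eq_signLin]
  exact signLin_mem_weylE6 (by decide) (by decide)

theorem linE_mem_weylE6 : linE ∈ weylE6 := by
  rw [linE_eq_signLin]
  exact signLin_mem_weylE6 (by decide) (by decide)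

theorem linF_apply (X : Fin 6 → ℂ) : linF X =
    ![(X 0 + 3 * X 1 + 3 * X 2 + 3 * X 3 + 3 * X 4 + 3 * X 5) / 4,
      (X 0 - X 1 + 3 * X 2 - X 3 - X 4 - X 5) / 4,
      (X 0 + 3 * X 1 - X 2 - X 3 - X 4 - X 5) / 4,
      (X 0 - X 1 - X 2 + 3 * X 3 - X 4 - X 5) / 4,
      (X 0 - X 1 - X 2 - X 3 - X 4 + 3 * X 5) / 4,
      (X 0 - X 1 - X 2 - X 3 + 3 * X 4 - X 5) / 4] := by
  change matF *ᵥ X = _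
  ext i
  fin_cases i <;> simp [matF, mulVec, dotProduct, Fin.sum_univ_six] <;> ring

theorem linF_mem_weylE6 : linF ∈ weylE6 := by
  -- Conjugating s_{α₂} by `linD` gives the reflection in ½(3, -1, -1, -1, -1, -1), symmetric in the
  -- last five coordinates; M_f is this reflection times two commuting transpositions.
  have e : linF = linD * simpleReflection 1 * linD * simpleReflection 2 * simpleReflection 5 := by
    ext X : 1
    simp only [LinearEquiv.mul_apply, linF_apply, simpleReflection_one_apply,
      simpleReflection_two_apply, simpleReflection_five_apply]
    ext i
    fin_cases i <;> simp [linD] <;> ring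
  rw [e]
  exact mul_mem (mul_mem (mul_mem (mul_mem linD_mem_weylE6 (simpleReflection_mem _))
    linD_mem_weylE6) (simpleReflection_mem _)) (simpleReflection_mem _)

theorem bForm_linB (X Y : Fin 6 → ℂ) : bForm (linB X) (linB Y) = bForm X Y := by
  simp [bForm_apply, linB]; ring

theorem bForm_linD (X Y : Fin 6 → ℂ) : bForm (linD X) (linD Y) = bForm X Y := by
  simp [bForm_apply, linD]

theorem bForm_linE (X Y : Fin 6 → ℂ) : bForm (linE X) (linE Y) = bForm X Y := by
  simp [bForm_apply, linE]

theorem bForm_linF (X Y : Fin 6 → ℂ) : bForm (linF X) (linF Y) = bForm X Y := by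
  simp [bForm_apply, linF_apply]; ring

theorem bForm_comm (X Y : Fin 6 → ℂ) : bForm X Y = bForm Y X := by
  simp only [bForm_apply]; ring

theorem bForm_simpleReflection (i : Fin 6) (X Y : Fin 6 → ℂ) :
    bForm (simpleReflection i X) (simpleReflection i Y) = bForm X Y := by
  simp only [simpleReflection_apply, map_sub, LinearMap.sub_apply, map_smul, LinearMap.smul_apply,
    smul_eq_mul, bForm_simpleRoot_self, bForm_comm (simpleRoot i)]
  ring

theorem bForm_weylE6 {w : (Fin 6 → ℂ) ≃ₗ[ℂ] (Fin 6 → ℂ)} (hw : w ∈ weylE6) (X Y : Fin 6 → ℂ) :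
    bForm (w X) (w Y) = bForm X Y := by
  induction hw using Subgroup.closure_induction generalizing X Y with
  | mem x hx => obtain ⟨i, rfl⟩ := hx; exact bForm_simpleReflection i X Y
  | one => rfl
  | mul x y _ _ hx hy => rw [LinearEquiv.mul_apply, LinearEquiv.mul_apply, hx, hy]
  | inv x _ hx =>
    conv_rhs => rw [← x.apply_symm_apply X, ← x.apply_symm_apply Y]
    exact (hx _ _).symm

theorem simpleReflection_eq_conj {g : (Fin 6 → ℂ) ≃ₗ[ℂ] (Fin 6 → ℂ)}
    (hg : ∀ X Y, bForm (g X) (g Y) = bForm X Y) {i : Fin 6}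
    (h : g (simpleRoot 5) = simpleRoot i) : simpleReflection i = g * linB * g⁻¹ := by
  ext X : 1
  have hX : X = g (g⁻¹ X) := (g.apply_symm_apply X).symm
  rw [LinearEquiv.mul_apply, LinearEquiv.mul_apply, linB_eq_simpleReflection, simpleReflection_apply,
    simpleReflection_apply, map_sub, map_smul, h, ← hX, ← hg _ (simpleRoot 5), h, ← hX]

theorem simpleRoot_five : simpleRoot 5 = ![0, 0, 0, 0, 1, -1] := rfl

theorem linB_vec (a b c d e f : ℂ) : linB ![a, b, c, d, e, f] = ![a, b, c, d, f, e] := rfl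

theorem linD_vec (a b c d e f : ℂ) : linD ![a, b, c, d, e, f] = ![a, b, -c, -d, -e, -f] := rfl

theorem linE_vec (a b c d e f : ℂ) : linE ![a, b, c, d, e, f] = ![a, b, c, -d, -e, f] := rfl

theorem linF_vec (a b c d e f : ℂ) : linF ![a, b, c, d, e, f] =
    ![(a + 3 * b + 3 * c + 3 * d + 3 * e + 3 * f) / 4, (a - b + 3 * c - d - e - f) / 4,
      (a + 3 * b - c - d - e - f) / 4, (a - b - c + 3 * d - e - f) / 4,
      (a - b - c - d - e + 3 * f) / 4, (a - b - c - d + 3 * e - f) / 4] := linF_apply _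

/-- An isometry carrying α₆ to αᵢ conjugates `linB` = s_{α₆} to s_{αᵢ}. The words below are paths
from α₆ to the other simple roots in its orbit under the four transformations. -/
theorem closure_eq_weylE6 : Subgroup.closure {linB, linD, linE, linF} = weylE6 := by
  apply le_antisymm
  · rw [Subgroup.closure_le]
    rintro x (rfl | rfl | rfl | rfl)
    exacts [linB_mem_weylE6, linD_mem_weylE6, linE_mem_weylE6, linF_mem_weylE6]
  · have hB : linB ∈ Subgroup.closure {linB, linD, linE, linF} :=
      Subgroup.subset_closure (by simp)
    have hD : linD ∈ Subgroup.closure {linB, linD, linE, linF} :=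
      Subgroup.subset_closure (by simp)
    have hE : linE ∈ Subgroup.closure {linB, linD, linE, linF} :=
      Subgroup.subset_closure (by simp)
    have hF : linF ∈ Subgroup.closure {linB, linD, linE, linF} :=
      Subgroup.subset_closure (by simp)
    have key : ∀ g ∈ Subgroup.closure {linB, linD, linE, linF}, ∀ i,
        g (simpleRoot 5) = simpleRoot i →
        simpleReflection i ∈ Subgroup.closure {linB, linD, linE, linF} := by
      intro g hg i h
      rw [simpleReflection_eq_conj (g := g) _ h]
      · exact mul_mem (mul_mem hg hB) (inv_mem hg)
      · clear h
        induction hg using Subgroup.closure_induction with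
        | mem x hx =>
          rcases hx with rfl | rfl | rfl | rfl
          exacts [bForm_linB, bForm_linD, bForm_linE, bForm_linF]
        | one => intro X Y; rfl
        | mul x y _ _ hx hy =>
          intro X Y
          rw [LinearEquiv.mul_apply, LinearEquiv.mul_apply, hx, hy]
        | inv x _ hx =>
          intro X Y
          conv_rhs => rw [← x.apply_symm_apply X, ← x.apply_symm_apply Y]
          exact (hx _ _).symm
    unfold weylE6
    rw [Subgroup.closure_le]
    rintro _ ⟨i, rfl⟩
    fin_cases i
    · refine key (linF * linD * linF * linE * linB * linE * linD * linF * linE) ?_ 0 ?_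
      · repeat' first | exact hB | exact hD | exact hE | exact hF | apply mul_mem
      · simp only [LinearEquiv.mul_apply, simpleRoot_five, linB_vec, linD_vec, linE_vec, linF_vec]
        ext k; fin_cases k <;> simp [simpleRoot] <;> norm_num
    · refine key (linE * linB * linE * linD * linF * linE * linB) ?_ 1 ?_
      · repeat' first | exact hB | exact hD | exact hE | exact hF | apply mul_mem
      · simp only [LinearEquiv.mul_apply, simpleRoot_five, linB_vec, linD_vec, linE_vec, linF_vec]
        ext k; fin_cases k <;> simp [simpleRoot] <;> norm_num
    · refine key (linD * linF * linD * linF * linE * linB * linE * linD * linF * linE * linB) ?_ 2 ?_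
      · repeat' first | exact hB | exact hD | exact hE | exact hF | apply mul_mem
      · simp only [LinearEquiv.mul_apply, simpleRoot_five, linB_vec, linD_vec, linE_vec, linF_vec]
        ext k; fin_cases k <;> simp [simpleRoot] <;> norm_num
    · refine key (linF * linD * linF * linD * linF * linE * linB) ?_ 3 ?_
      · repeat' first | exact hB | exact hD | exact hE | exact hF | apply mul_mem
      · simp only [LinearEquiv.mul_apply, simpleRoot_five, linB_vec, linD_vec, linE_vec, linF_vec]
        ext k; fin_cases k <;> simp [simpleRoot] <;> norm_num
    · refine key (linB * linE * linF * linB * linE * linF * linE) ?_ 4 ?_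
      · repeat' first | exact hB | exact hD | exact hE | exact hF | apply mul_mem
      · simp only [LinearEquiv.mul_apply, simpleRoot_five, linB_vec, linE_vec, linF_vec]
        ext k; fin_cases k <;> simp [simpleRoot] <;> norm_num
    · exact linB_eq_simpleReflection ▸ hB

/-! ### The root lattice -/

theorem bForm_simpleRoot (i j : Fin 6) : bForm (simpleRoot i) (simpleRoot j) =
    (CartanMatrix.E₆ (Equiv.swap 0 1 i) (Equiv.swap 0 1 j) : ℂ) := by
  have h : ∀ i : Fin 6, Equiv.swap (0 : Fin 6) 1 i = ![1, 0, 2, 3, 4, 5] i := by decide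
  rw [h, h]
  fin_cases i <;> fin_cases j <;>
    simp [bForm_apply, simpleRoot, CartanMatrix.E₆] <;> norm_num

theorem linearIndependent_simpleRoot : LinearIndependent ℂ simpleRoot := by
  rw [Fintype.linearIndependent_iff]
  intro g hg
  have h0 := congrFun hg 0
  have h1 := congrFun hg 1
  have h2 := congrFun hg 2
  have h3 := congrFun hg 3
  have h4 := congrFun hg 4
  have h5 := congrFun hg 5
  simp [Fin.sum_univ_six, simpleRoot] at h0 h1 h2 h3 h4 h5
  simp only [h0, zero_mul, add_zero, zero_add] at h1 h2 h3 h4 h5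
  have g5 : g 5 = 0 := by linear_combination -h5
  have g4 : g 4 = 0 := by linear_combination -h4 - h5
  have g3 : g 3 = 0 := by linear_combination -h3 - h4 - h5
  have g2 : g 2 = 0 := by linear_combination h1 / 2 - h2 / 2 + g3 / 2
  have g0 : g 0 = 0 := by linear_combination -h1 + g2
  intro i
  fin_cases i
  exacts [g0, h0, g2, g3, g4, g5]

theorem bijective_liftBaseChange_rootLattice :
    Function.Bijective (LinearMap.liftBaseChange ℂ rootLattice.subtype :
      ℂ ⊗[ℤ] rootLattice →ₗ[ℂ] (Fin 6 → ℂ)) := by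
  let bC : Module.Basis (Fin 6) ℂ (Fin 6 → ℂ) :=
    basisOfLinearIndependentOfCardEqFinrank linearIndependent_simpleRoot (by simp)
  let bZ : Module.Basis (Fin 6) ℤ rootLattice :=
    Module.Basis.span (linearIndependent_simpleRoot.restrict_scalars' ℤ)
  let e := (Algebra.TensorProduct.basis ℂ bZ).equiv bC (Equiv.refl _)
  have he : (LinearMap.liftBaseChange ℂ rootLattice.subtype :
      ℂ ⊗[ℤ] rootLattice →ₗ[ℂ] (Fin 6 → ℂ)) = e := by
    apply (Algebra.TensorProduct.basis ℂ bZ).ext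
    intro i
    have h1 : ((bZ i : rootLattice) : Fin 6 → ℂ) = simpleRoot i := by
      exact congrArg Subtype.val
        (Module.Basis.span_apply (linearIndependent_simpleRoot.restrict_scalars' ℤ) i)
    have h2 : e (Algebra.TensorProduct.basis ℂ bZ i) = bC i := by
      simp only [e, Module.Basis.equiv_apply, Equiv.refl_apply]
    rw [LinearEquiv.coe_coe, h2, Algebra.TensorProduct.basis_apply]
    simp [bC, h1]
  rw [he]
  exact e.bijective

theorem exists_int_bForm_of_mem_rootLattice {X : Fin 6 → ℂ} (hX : X ∈ rootLattice) (i : Fin 6) :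
    ∃ n : ℤ, bForm X (simpleRoot i) = n := by
  induction hX using Submodule.span_induction with
  | mem x hx => obtain ⟨j, rfl⟩ := hx; exact ⟨_, bForm_simpleRoot j i⟩
  | zero => exact ⟨0, by simp⟩
  | add x y _ _ hx hy =>
    obtain ⟨a, ha⟩ := hx
    obtain ⟨b, hb⟩ := hy
    exact ⟨a + b, by simp [ha, hb]⟩
  | smul a x _ hx =>
    obtain ⟨b, hb⟩ := hx
    exact ⟨a * b, by rw [← Int.cast_smul_eq_zsmul ℂ]; simp [hb]⟩

theorem simpleRoot_mem (i : Fin 6) : simpleRoot i ∈ rootLattice := Submodule.subset_span ⟨i, rfl⟩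

theorem simpleReflection_sub_mem {X : Fin 6 → ℂ} {i : Fin 6}
    (h : ∃ n : ℤ, bForm X (simpleRoot i) = n) : simpleReflection i X - X ∈ rootLattice := by
  obtain ⟨n, hn⟩ := h
  rw [simpleReflection_apply, hn, sub_sub_cancel_left, Int.cast_smul_eq_zsmul]
  exact neg_mem (Submodule.smul_mem _ _ (simpleRoot_mem i))

theorem weylE6_apply_mem_rootLattice {w : (Fin 6 → ℂ) ≃ₗ[ℂ] (Fin 6 → ℂ)} (hw : w ∈ weylE6)
    (X : Fin 6 → ℂ) : w X ∈ rootLattice ↔ X ∈ rootLattice := by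
  induction hw using Subgroup.closure_induction generalizing X with
  | mem x hx =>
    obtain ⟨i, rfl⟩ := hx
    have h : ∀ X ∈ rootLattice, simpleReflection i X ∈ rootLattice := fun X hX => by
      have := add_mem (simpleReflection_sub_mem (exists_int_bForm_of_mem_rootLattice hX i)) hX
      rwa [sub_add_cancel] at this
    refine ⟨fun hX => ?_, h X⟩
    have h2 := h _ hX
    rwa [show simpleReflection i (simpleReflection i X) = X from
      Module.involutive_reflection (f := bForm.flip (simpleRoot i)) (bForm_simpleRoot_self i) X]
      at h2
  | one => rfl
  | mul x y _ _ hx hy => rw [LinearEquiv.mul_apply, hx, hy]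
  | inv x _ hx =>
    rw [← hx]
    exact iff_of_eq (congrArg (· ∈ rootLattice) (x.apply_symm_apply X))

/-- The Weyl group acts trivially on weights modulo roots: a simple reflection moves a weight by an
integral multiple of a root. -/
theorem weylE6_sub_mem_rootLattice {X : Fin 6 → ℂ}
    (hX : ∀ i, ∃ n : ℤ, bForm X (simpleRoot i) = n) {w : (Fin 6 → ℂ) ≃ₗ[ℂ] (Fin 6 → ℂ)}
    (hw : w ∈ weylE6) : w X - X ∈ rootLattice := by
  induction hw using Subgroup.closure_induction with
  | mem x hx => obtain ⟨i, rfl⟩ := hx; exact simpleReflection_sub_mem (hX i)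
  | one => simp
  | mul x y hx' _ hx hy =>
    have := add_mem ((weylE6_apply_mem_rootLattice hx' _).mpr hy) hx
    rw [map_sub, sub_add_sub_cancel] at this
    exact this
  | inv x hx' hx =>
    have := neg_mem ((weylE6_apply_mem_rootLattice (inv_mem hx') _).mpr hx)
    rw [map_sub, neg_sub] at this
    rwa [show x⁻¹ (x X) = X from x.symm_apply_apply X] at this

/-- Only α₂ has a nonzero first coordinate, namely 3/2. -/
theorem exists_int_apply_zero_of_mem_rootLattice {X : Fin 6 → ℂ} (hX : X ∈ rootLattice) :
    ∃ n : ℤ, X 0 = 3 / 2 * n := by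
  induction hX using Submodule.span_induction with
  | mem x hx =>
    obtain ⟨j, rfl⟩ := hx
    fin_cases j
    exacts [⟨0, by simp [simpleRoot]⟩, ⟨1, by simp [simpleRoot]⟩, ⟨0, by simp [simpleRoot]⟩,
      ⟨0, by simp [simpleRoot]⟩, ⟨0, by simp [simpleRoot]⟩, ⟨0, by simp [simpleRoot]⟩]
  | zero => exact ⟨0, by simp⟩
  | add x y _ _ hx hy =>
    obtain ⟨a, ha⟩ := hx
    obtain ⟨b, hb⟩ := hy
    exact ⟨a + b, by simp [ha, hb]; ring⟩
  | smul a x _ hx =>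
    obtain ⟨b, hb⟩ := hx
    exact ⟨a * b, by rw [← Int.cast_smul_eq_zsmul ℂ]; simp [hb]; ring⟩

/-- 2e₀ is the fundamental weight dual to α₂, so its difference with any Weyl translate lies in the
root lattice. The value -2e₀ would put -4e₀ there, but -4 is not a multiple of 3/2. In particular -1
is not in W(E₆). -/
theorem neg_not_mem_weylE6 {w : (Fin 6 → ℂ) ≃ₗ[ℂ] (Fin 6 → ℂ)} (hw : w ∈ weylE6) :
    w (Pi.single 0 1) ≠ -Pi.single 0 1 := by
  intro h
  have h2 : w (Pi.single 0 2) - Pi.single 0 2 ∈ rootLattice := by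
    refine weylE6_sub_mem_rootLattice (fun i => ?_) hw
    fin_cases i
    exacts [⟨0, by simp [simpleRoot, bForm_apply]⟩, ⟨1, by simp [simpleRoot, bForm_apply]; norm_num⟩,
      ⟨0, by simp [simpleRoot, bForm_apply]⟩, ⟨0, by simp [simpleRoot, bForm_apply]⟩,
      ⟨0, by simp [simpleRoot, bForm_apply]⟩, ⟨0, by simp [simpleRoot, bForm_apply]⟩]
  have e : (Pi.single 0 2 : Fin 6 → ℂ) = (2 : ℂ) • Pi.single 0 1 := by
    rw [← Pi.single_smul, smul_eq_mul, mul_one]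
  rw [e, map_smul, h] at h2
  obtain ⟨n, hn⟩ := exists_int_apply_zero_of_mem_rootLattice h2
  simp at hn
  have : (3 * n : ℂ) = -8 := by linear_combination -2 * hn
  have : 3 * n = -8 := by exact_mod_cast this
  omega

/-- An element of the Weyl group for which all weights in the orbit of the first coordinate
vector are eigenvectors is trivial. -/
theorem eq_one_of_forall_eigenvector {h : (Fin 6 → ℂ) ≃ₗ[ℂ] (Fin 6 → ℂ)} (hh : h ∈ weylE6)
    (H : ∀ g ∈ weylE6, ∃ c : ℂ, h (g (Pi.single 0 1)) = c • g (Pi.single 0 1)) : h = 1 := by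
  obtain ⟨c, hc⟩ := H 1 (one_mem _)
  change h (Pi.single 0 1) = c • Pi.single 0 1 at hc
  have hc2 : c * c = 1 := by
    have := bForm_weylE6 hh (Pi.single 0 1) (Pi.single 0 1)
    rw [hc] at this
    simp [bForm_apply] at this
    linear_combination 3 * this
  -- Up to the factor 1/4 these sixteen vectors are images of `linF` e₀ under even sign changes,
  -- hence lie in the orbit. As h preserves b and they pair nontrivially with e₀, their eigenvalue d
  -- satisfies cd = 1, so d = c.
  have hsign : ∀ e : Fin 6 → ℤ, Even (e 0) → Even (∑ i, e i) →
      h (signLin e 1) = c • signLin e 1 := by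
    intro e h0 he
    obtain ⟨d, hd⟩ := H (signLin e * linF) (mul_mem (signLin_mem_weylE6 h0 he) linF_mem_weylE6)
    have e1 : linF (Pi.single 0 1) = (4⁻¹ : ℂ) • 1 := by
      rw [linF_apply]; ext i; fin_cases i <;> simp
    rw [LinearEquiv.mul_apply, e1, map_smul, map_smul, smul_comm] at hd
    have hd' := smul_right_injective _ (by norm_num : (4⁻¹ : ℂ) ≠ 0) hd
    have hb := bForm_weylE6 hh (Pi.single 0 1) (signLin e 1)
    rw [hc, hd'] at hb
    simp [bForm_apply, signLin_apply, h0.neg_one_zpow] at hb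
    have hcd : c * d = 1 := by linear_combination 3 * hb
    have : d = c := by linear_combination c * hcd - d * hc2
    rw [hd', this]
  have hone : h 1 = c • 1 := by
    have := hsign 0 (by simp) (by simp)
    have e : signLin 0 1 = 1 := by ext i; simp [signLin_apply]
    rwa [e] at this
  have hpair : ∀ i j : Fin 6, i ≠ 0 → j ≠ 0 → i ≠ j →
      h (Pi.single i 1 + Pi.single j 1) = c • (Pi.single i 1 + Pi.single j 1) := by
    intro i j hi hj hij
    have := hsign (Pi.single i 1 + Pi.single j 1) (by simp [hi.symm, hj.symm])
      (by simp [Finset.sum_add_distrib])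
    -- Flipping the signs at i and j in the all-ones vector changes it by 2(eᵢ + eⱼ).
    have e : (Pi.single i 1 + Pi.single j 1 : Fin 6 → ℂ) =
        (2⁻¹ : ℂ) • (1 - signLin (Pi.single i 1 + Pi.single j 1) 1) := by
      ext k
      by_cases h1 : k = i
      · subst h1; simp [signLin_apply, hij]; norm_num
      · by_cases h2 : k = j
        · subst h2; simp [signLin_apply, hij.symm]; norm_num
        · simp [signLin_apply, h1, h2]
    rw [e, map_smul, map_sub, this, hone, ← smul_sub, smul_comm]
  have hbasis : ∀ i j k : Fin 6, i ≠ 0 → j ≠ 0 → k ≠ 0 → i ≠ j → i ≠ k → j ≠ k →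
      h (Pi.single i 1) = c • Pi.single i 1 := by
    intro i j k hi hj hk hij hik hjk
    have e : (Pi.single i 1 : Fin 6 → ℂ) = (2⁻¹ : ℂ) • ((Pi.single i 1 + Pi.single j 1) +
        (Pi.single i 1 + Pi.single k 1) - (Pi.single j 1 + Pi.single k 1)) := by
      module
    rw [e, map_smul, map_sub, map_add, hpair _ _ hi hj hij, hpair _ _ hi hk hik, hpair _ _ hj hk hjk]
    module
  have hall : ∀ i, h (Pi.single i 1) = c • Pi.single i 1 := by
    intro i
    fin_cases i
    · exact hc
    · exact hbasis 1 2 3 (by decide) (by decide) (by decide) (by decide) (by decide) (by decide)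
    · exact hbasis 2 1 3 (by decide) (by decide) (by decide) (by decide) (by decide) (by decide)
    · exact hbasis 3 2 1 (by decide) (by decide) (by decide) (by decide) (by decide) (by decide)
    · exact hbasis 4 2 1 (by decide) (by decide) (by decide) (by decide) (by decide) (by decide)
    · exact hbasis 5 2 1 (by decide) (by decide) (by decide) (by decide) (by decide) (by decide)
  have hc1 : c = 1 := by
    have h1 : (c - 1) * (c + 1) = 0 := by linear_combination hc2
    rcases mul_eq_zero.mp h1 with h1 | h1
    · exact sub_eq_zero.mp h1
    · refine absurd ?_ (neg_not_mem_weylE6 hh)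
      rw [hc, eq_neg_of_add_eq_zero_left h1, neg_one_smul]
  apply LinearEquiv.toLinearMap_injective
  apply (Pi.basisFun ℂ (Fin 6)).ext
  intro i
  rw [Pi.basisFun_apply]
  exact (hall i).trans (by rw [hc1, one_smul]; rfl)

/-! ### The eigenspace `ℙ⁵` -/

/-- The index of the coordinate of `ℂ⁶` giving `X_σ`. -/
def coordIndex (σ : Fin 4 → ZMod 2) : Fin 6 :=
  (![0, 1, 2, 3, 1, 1, 4, 5, 2, 5, 2, 4, 3, 4, 5, 3] : Fin 16 → Fin 6) (charNumber σ)

/-- A characteristic with given coordinate index. -/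
def coordRep (i : Fin 6) : Fin 4 → ZMod 2 :=
  (![![0, 0, 0, 0], ![0, 0, 0, 1], ![0, 0, 1, 0], ![0, 0, 1, 1], ![0, 1, 1, 0], ![0, 1, 1, 1]] :
    Fin 6 → Fin 4 → ZMod 2) i

/-- The reduction of `A` modulo `2`. -/
def matA₂ : Matrix (Fin 4) (Fin 4) (ZMod 2) := matA.map (Int.cast : ℤ → ZMod 2)

theorem paramP5_apply (X : Fin 6 → ℂ) (σ : Fin 4 → ZMod 2) : paramP5 X σ = X (coordIndex σ) := rfl

theorem coordIndex_coordRep : ∀ i, coordIndex (coordRep i) = i := by decide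

theorem coordIndex_vecMul : ∀ σ, coordIndex (σ ᵥ* matA₂) = coordIndex σ := by decide

theorem coordRep_coordIndex : ∀ σ, coordRep (coordIndex σ) = σ ∨
    coordRep (coordIndex σ) = σ ᵥ* matA₂ ∨ coordRep (coordIndex σ) = σ ᵥ* matA₂ ᵥ* matA₂ := by
  decide

theorem coordIndex_vec :
    coordIndex ![0, 0, 0, 0] = 0 ∧ coordIndex ![0, 0, 0, 1] = 1 ∧
    coordIndex ![0, 0, 1, 0] = 2 ∧ coordIndex ![0, 0, 1, 1] = 3 ∧
    coordIndex ![0, 1, 0, 0] = 1 ∧ coordIndex ![0, 1, 0, 1] = 1 ∧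
    coordIndex ![0, 1, 1, 0] = 4 ∧ coordIndex ![0, 1, 1, 1] = 5 ∧
    coordIndex ![1, 0, 0, 0] = 2 ∧ coordIndex ![1, 0, 0, 1] = 5 ∧
    coordIndex ![1, 0, 1, 0] = 2 ∧ coordIndex ![1, 0, 1, 1] = 4 ∧
    coordIndex ![1, 1, 0, 0] = 3 ∧ coordIndex ![1, 1, 0, 1] = 4 ∧
    coordIndex ![1, 1, 1, 0] = 5 ∧ coordIndex ![1, 1, 1, 1] = 3 := by
  decide

theorem zmod_two_cast_one : ((1 : ZMod 2).cast : ℤ) = 1 := rfl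

theorem paramP5_injective : Function.Injective paramP5 :=
  LinearMap.funLeft_injective_of_surjective ℂ ℂ _ fun i => ⟨coordRep i, coordIndex_coordRep i⟩

theorem eq_paramP5_of_mem {X : (Fin 4 → ZMod 2) → ℂ} (hX : X ∈ eigenspaceM) :
    X = paramP5 fun i => X (coordRep i) := by
  have h : ∀ σ, X (σ ᵥ* matA₂) = X σ := fun σ => (hX σ).symm
  ext σ
  rw [paramP5_apply]
  rcases coordRep_coordIndex σ with e | e | e <;> rw [e] <;> simp only [h]

theorem range_paramP5 : LinearMap.range paramP5 = eigenspaceM := by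
  ext X
  constructor
  · rintro ⟨Y, rfl⟩ σ
    rw [paramP5_apply, paramP5_apply, ← coordIndex_vecMul]
    rfl
  · exact fun hX => ⟨_, (eq_paramP5_of_mem hX).symm⟩

theorem matM_eq_spLevi : matM = spLevi matA matAInvT (by decide) := rfl

theorem thetaNulls_mem_eigenspaceM {τ : Matrix (Fin 4) (Fin 4) ℂ} (hτ : τ ∈ siegelFixed) :
    thetaNulls τ ∈ eigenspaceM := by
  intro σ
  have h := hτ.2
  rw [matM_eq_spLevi, siegelAct_spLevi _ hτ.1] at h
  conv_lhs => rw [← h]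
  exact thetaNulls_conj (d := matAInvT) (by decide) τ σ

theorem thetaNulls_eq_paramP5 {τ : Matrix (Fin 4) (Fin 4) ℂ} (hτ : τ ∈ siegelFixed) :
    thetaNulls τ = paramP5 (thetaP5 τ) := by
  rw [eq_paramP5_of_mem (thetaNulls_mem_eigenspaceM hτ)]
  congr 1
  ext i
  fin_cases i <;> rfl

/-! ### Composition and normalization of induced actions -/

section Induced

variable {N N' : Sp8} {g g' : (Fin 6 → ℂ) ≃ₗ[ℂ] (Fin 6 → ℂ)}

theorem InducedOnP5.mul (h : InducedOnP5 N g) (h' : InducedOnP5 N' g') :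
    InducedOnP5 (N * N') (g * g') := by
  obtain ⟨U, hU, e⟩ := h
  obtain ⟨U', hU', e'⟩ := h'
  exact ⟨U * U', hU.mul hU', fun X => by
    rw [LinearEquiv.mul_apply, LinearEquiv.mul_apply, e', e]⟩

theorem InducedOnP5.one : InducedOnP5 1 1 := ⟨1, ActsOnP15.one, fun _ => rfl⟩

theorem InducedOnP5.inv (h : InducedOnP5 N g) : InducedOnP5 N⁻¹ g⁻¹ := by
  obtain ⟨U, hU, e⟩ := h
  refine ⟨U⁻¹, hU.inv, fun X => ?_⟩
  have := e (g⁻¹ X)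
  rw [show g (g⁻¹ X) = X from g.apply_symm_apply X] at this
  rw [← this]
  exact U.symm_apply_apply _

/-- The action on ℙ¹⁵ is only projective, so the scalar k can be moved from U into the automorphy
factor. This normalizes products of Fourier transforms. -/
theorem InducedOnP5.of_smul {U : ((Fin 4 → ZMod 2) → ℂ) ≃ₗ[ℂ] ((Fin 4 → ZMod 2) → ℂ)}
    (hU : ActsOnP15 N U) {k : ℂ} (hk : k ≠ 0) (e : ∀ X, U (paramP5 X) = k • paramP5 (g X)) :
    InducedOnP5 N g := by
  refine ⟨LinearEquiv.smulOfNeZero ℂ _ k⁻¹ (inv_ne_zero hk) * U, fun τ hτ => ?_, fun X => ?_⟩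
  · obtain ⟨c, hc, h⟩ := hU τ hτ
    refine ⟨c * k, mul_ne_zero hc hk, ?_⟩
    rw [h, LinearEquiv.mul_apply]
    change _ = (c * k) • k⁻¹ • U (thetaNulls τ)
    rw [smul_smul, mul_assoc, mul_inv_cancel₀ hk, mul_one]
  · rw [LinearEquiv.mul_apply, e]
    change k⁻¹ • k • paramP5 (g X) = _
    rw [smul_smul, inv_mul_cancel₀ hk, one_smul]

theorem InducedOnP5.thetaP5_siegelAct (h : InducedOnP5 N g) (hN : N ∈ normM)
    {τ : Matrix (Fin 4) (Fin 4) ℂ} (hτ : τ ∈ siegelFixed) :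
    ∃ c : ℂ, c ≠ 0 ∧ thetaP5 (siegelAct N τ) = c • g (thetaP5 τ) := by
  obtain ⟨U, hU, e⟩ := h
  obtain ⟨c, hc, h⟩ := hU τ hτ.1
  refine ⟨c, hc, paramP5_injective ?_⟩
  rw [← thetaNulls_eq_paramP5 (siegelAct_mem_siegelFixed hN hτ), h, thetaNulls_eq_paramP5 hτ, e,
    map_smul]

end Induced

/-! ### Elements of the normalizer acting through the Weyl group -/

/-- Commuting with A, the reduction of a modulo 2 permutes the A-orbits of characteristics and fixes
{0}. It thus permutes the last five coordinates. -/
theorem exists_weylE6_inducedOnP5_spLevi {a d : Matrix (Fin 4) (Fin 4) ℤ} (h : aᵀ * d = 1)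
    (ha : a * matA = matA * a) : ∃ w ∈ weylE6, InducedOnP5 (spLevi a d h) w := by
  set a₂ : Matrix (Fin 4) (Fin 4) (ZMod 2) := a.map (Int.cast : ℤ → ZMod 2) with ha₂
  have hcomm : ∀ σ, σ ᵥ* a₂ ᵥ* matA₂ = σ ᵥ* matA₂ ᵥ* a₂ := by
    have := congrArg (fun X : Matrix (Fin 4) (Fin 4) ℤ => X.map (Int.castRingHom (ZMod 2))) ha
    simp only [Matrix.map_mul] at this
    intro σ
    rw [vecMul_vecMul, vecMul_vecMul]
    exact congrArg (σ ᵥ* ·) this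
  let f : Fin 6 → Fin 6 := fun i => coordIndex (coordRep i ᵥ* a₂)
  have hf : ∀ σ, coordIndex (σ ᵥ* a₂) = f (coordIndex σ) := by
    intro σ
    simp only [f]
    rcases coordRep_coordIndex σ with e | e | e <;> rw [e]
    · rw [← hcomm, coordIndex_vecMul]
    · rw [← hcomm, ← hcomm, coordIndex_vecMul, coordIndex_vecMul]
  have hfsurj : Function.Surjective f := fun j => by
    refine ⟨coordIndex ((charPerm a d h).symm (coordRep j)), ?_⟩
    rw [← hf]
    exact (congrArg coordIndex ((charPerm a d h).apply_symm_apply _)).trans (coordIndex_coordRep j)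
  let π : Equiv.Perm (Fin 6) := Equiv.ofBijective f (Finite.surjective_iff_bijective.mp hfsurj)
  have hπ : π 0 = 0 := by
    change coordIndex (coordRep 0 ᵥ* a₂) = 0
    have : coordRep 0 = 0 := by decide
    rw [this, zero_vecMul]
    decide
  refine ⟨permLin π, permLin_mem_weylE6 hπ, _, actsOnP15_spLevi h, fun X => ?_⟩
  ext σ
  change paramP5 X (σ ᵥ* a₂) = permLin π X (coordIndex σ)
  rw [paramP5_apply, hf]
  rfl

theorem I_zpow_eq_neg_one_zpow {m n : ℤ} (h : 4 ∣ m - 2 * n) :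
    Complex.I ^ m = (-1 : ℂ) ^ n := by
  obtain ⟨k, hk⟩ := h
  rw [sub_eq_iff_eq_add.mp hk, zpow_add₀ Complex.I_ne_zero, _root_.zpow_mul, _root_.zpow_mul]
  norm_num

/-- The symmetric integral matrices `S` with `A S ᵗA = S`. -/
def invSymm (p q x z : ℤ) : Matrix (Fin 4) (Fin 4) ℤ :=
  !![2 * p, x, -p, -(x + z);
     x, 2 * q, z, -q;
     -p, z, 2 * p, x;
     -(x + z), -q, x, 2 * q]

theorem invSymm_isSymm (p q x z : ℤ) : (invSymm p q x z).IsSymm := by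
  ext i j; fin_cases i <;> fin_cases j <;> rfl

theorem exists_eq_invSymm {S : Matrix (Fin 4) (Fin 4) ℤ} (hS : S.IsSymm)
    (hA : matA * S * matAᵀ = S) : ∃ p q x z, S = invSymm p q x z := by
  have hs : ∀ i j, S i j = S j i := fun i j => congrFun (congrFun hS j) i
  obtain ⟨e01, e02, e03, e12, e13, e23⟩ : S 1 0 = S 0 1 ∧ S 2 0 = S 0 2 ∧ S 3 0 = S 0 3 ∧
    S 2 1 = S 1 2 ∧ S 3 1 = S 1 3 ∧ S 3 2 = S 2 3 := ⟨hs _ _, hs _ _, hs _ _, hs _ _, hs _ _, hs _ _⟩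
  have h00 := congrFun (congrFun hA 0) 0
  have h02 := congrFun (congrFun hA 0) 2
  have h22 := congrFun (congrFun hA 2) 2
  have h11 := congrFun (congrFun hA 1) 1
  have h13 := congrFun (congrFun hA 1) 3
  have h33 := congrFun (congrFun hA 3) 3
  have h01 := congrFun (congrFun hA 0) 1
  have h03 := congrFun (congrFun hA 0) 3
  have h12 := congrFun (congrFun hA 1) 2
  have h23 := congrFun (congrFun hA 2) 3
  simp [Matrix.mul_apply, Matrix.vecMul, dotProduct, Fin.sum_univ_four, matA] at h00 h02 h22 h11 h13 h33 h01 h03 h12 h23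
  refine ⟨-S 0 2, -S 1 3, S 0 1, S 1 2, ?_⟩
  ext i j
  fin_cases i <;> fin_cases j <;> simp [invSymm] <;> omega

/-- The exponents of the signs by which the translation by `invSymm p q x z` acts. -/
def signExp (p q x z : ℤ) : Fin 6 → ℤ := ![0, q, p, p + q + x, p + q + z, p + q + x + z]

/-- The quadratic form of an M-invariant S takes even values 2n, so the power of i is a sign (-1)ⁿ;
the parity of n is constant on A-orbits. -/
theorem transFactor_invSymm (p q x z : ℤ) (σ : Fin 4 → ZMod 2) :
    transFactor (invSymm p q x z) σ = (-1 : ℂ) ^ signExp p q x z (coordIndex σ) := by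
  apply I_zpow_eq_neg_one_zpow
  have hσ : σ = ![σ 0, σ 1, σ 2, σ 3] := by ext i; fin_cases i <;> rfl
  rw [hσ]
  rcases zmod_two_cases (σ 0) with h0 | h0 <;> rcases zmod_two_cases (σ 1) with h1 | h1 <;>
  rcases zmod_two_cases (σ 2) with h2 | h2 <;> rcases zmod_two_cases (σ 3) with h3 | h3 <;>
  rw [h0, h1, h2, h3] <;>
  simp [dotProduct, mulVec, Fin.sum_univ_four, invSymm, signExp, coordIndex_vec, zmod_two_cast_one] <;>
  omega

theorem inducedOnP5_spTrans (p q x z : ℤ) :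
    InducedOnP5 (spTrans (invSymm p q x z) (invSymm_isSymm p q x z)) (signLin (signExp p q x z)) := by
  refine ⟨_, actsOnP15_spTrans _, fun X => ?_⟩
  ext σ
  rw [diagEquiv_apply, transFactor_invSymm]
  rfl

/-- The exponents sum to 4p + 4q + 2x + 2z: the number of sign changes is always even. -/
theorem exists_weylE6_inducedOnP5_spTrans (p q x z : ℤ) :
    ∃ w ∈ weylE6, InducedOnP5 (spTrans (invSymm p q x z) (invSymm_isSymm p q x z)) w := by
  refine ⟨_, signLin_mem_weylE6 (by simp [signExp]) ?_, inducedOnP5_spTrans p q x z⟩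
  simp only [Fin.sum_univ_six, signExp]
  simp
  exact ⟨2 * p + 2 * q + x + z, by ring⟩

theorem inducedOnP5_nD : InducedOnP5 nD linD := by
  have e : (nD : Sp8) = spTrans (invSymm 1 0 0 0) (invSymm_isSymm _ _ _ _) := by
    apply Subtype.ext
    change fromBlocks _ _ _ _ = fromBlocks _ _ _ _
    congr 1
  have h := inducedOnP5_spTrans 1 0 0 0
  rw [← e] at h
  rw [linD_eq_signLin]
  exact h

theorem inducedOnP5_nE : InducedOnP5 nE linE := by
  let D : Matrix (Fin 4) (Fin 4) ℤ := !![-1, 0, 0, 0; 0, 1, 0, 0; 0, 0, -1, 0; 0, 0, 0, 1]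
  have hD : Dᵀ * D = 1 := by decide
  have e : (nE : Sp8) = spTrans (invSymm 0 0 1 1) (invSymm_isSymm _ _ _ _) * spLevi D D hD := by
    apply Subtype.ext
    change _ = fromBlocks 1 (invSymm 0 0 1 1) 0 1 * fromBlocks D 0 0 D
    rw [fromBlocks_multiply]
    change fromBlocks _ _ _ _ = _
    congr 1 <;> decide
  -- D is the identity modulo 2, so it fixes every characteristic.
  have hL : InducedOnP5 (spLevi D D hD) 1 := by
    refine ⟨_, actsOnP15_spLevi hD, fun X => ?_⟩
    ext σ
    change paramP5 X (σ ᵥ* D.map (Int.cast : ℤ → ZMod 2)) = _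
    have : D.map (Int.cast : ℤ → ZMod 2) = 1 := by decide
    rw [this, vecMul_one]
    rfl
  -- The translation has exponents (0, 0, 0, 1, 1, 2), which agree modulo 2 with those of `linE`.
  rw [e, linE_eq_signLin, signLin_congr (e' := signExp 0 0 1 1) (by decide), ← mul_one (signLin _)]
  exact (inducedOnP5_spTrans 0 0 1 1).mul hL

theorem inducedOnP5_nB : InducedOnP5 nB linB := by
  refine ⟨_, (actsOnP15_spLevi (a := !![0, 0, 1, 0; 0, 0, 0, 1; 1, 0, 0, 0; 0, 1, 0, 0])
    (d := !![0, 0, 1, 0; 0, 0, 0, 1; 1, 0, 0, 0; 0, 1, 0, 0]) (by decide) :), fun X => ?_⟩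
  ext σ
  have h : ∀ σ : Fin 4 → ZMod 2, coordIndex (σ ᵥ* (!![0, 0, 1, 0; 0, 0, 0, 1; 1, 0, 0, 0;
      0, 1, 0, 0] : Matrix (Fin 4) (Fin 4) ℤ).map (Int.cast : ℤ → ZMod 2)) =
      ![0, 1, 2, 3, 5, 4] (coordIndex σ) := by decide
  change X (coordIndex _) = linB X (coordIndex σ)
  erw [h]
  generalize coordIndex σ = i
  fin_cases i <;> rfl


/-- The matrix of the inversion of the coordinates with indices `0` and `2`, followed by a rotation. -/
def spJ : Sp8 :=
  ⟨fromBlocks !![0, 0, 0, 0; 0, 1, 0, 0; 0, 0, 0, 0; 0, 0, 0, 1]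
    !![0, 0, -1, 0; 0, 0, 0, 0; 1, 0, 0, 0; 0, 0, 0, 0]
    !![0, 0, 1, 0; 0, 0, 0, 0; -1, 0, 0, 0; 0, 0, 0, 0]
    !![0, 0, 0, 0; 0, 1, 0, 0; 0, 0, 0, 0; 0, 0, 0, 1], by rw [SymplecticGroup.mem_iff]; decide⟩

theorem vec_four_update (a b c d t : ZMod 2) :
    Function.update ![a, b, c, d] 0 t = ![t, b, c, d] ∧
    Function.update ![a, b, c, d] 1 t = ![a, t, c, d] ∧
    Function.update ![a, b, c, d] 2 t = ![a, b, t, d] ∧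
    Function.update ![a, b, c, d] 3 t = ![a, b, c, t] := by
  refine ⟨?_, ?_, ?_, ?_⟩ <;> ext i <;> fin_cases i <;> rfl

theorem exists_weylE6_inducedOnP5_spJ : ∃ w ∈ weylE6, InducedOnP5 spJ w := by
  let R : Matrix (Fin 4) (Fin 4) ℤ := !![0, 0, 1, 0; 0, 1, 0, 0; -1, 0, 0, 0; 0, 0, 0, 1]
  have hR : Rᵀ * R = 1 := by decide
  have e : spJ = spLevi R R hR * (spInv 0 * spInv 2) := by
    apply Subtype.ext
    change _ = fromBlocks _ _ _ _ * (fromBlocks _ _ _ _ * fromBlocks _ _ _ _)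
    rw [fromBlocks_multiply, fromBlocks_multiply]
    change fromBlocks _ _ _ _ = _
    congr 1 <;> decide
  -- The product of the two Fourier transforms with the permutation squares to 4, so the scalar is
  -- ±2. Its sign is forced to be -, since the claimed element is in W(E₆) and -1 is not.
  refine ⟨simpleReflection 1 * signLin ![0, 1, 0, 1, 1, 1] * simpleReflection 1,
    mul_mem (mul_mem (simpleReflection_mem _) (signLin_mem_weylE6 (by decide) (by decide)))
      (simpleReflection_mem _), ?_⟩
  rw [e]
  refine InducedOnP5.of_smul ((actsOnP15_spLevi hR).mul
    ((actsOnP15_spInv 0).mul (actsOnP15_spInv 2))) (k := -2) (by norm_num) fun X => ?_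
  ext σ
  have hσ : σ = ![σ 0, σ 1, σ 2, σ 3] := by ext i; fin_cases i <;> rfl
  have hRσ : ∀ a b c d : ZMod 2, ![a, b, c, d] ᵥ* R.map (Int.cast : ℤ → ZMod 2) = ![c, b, a, d] := by
    decide
  change partialFourier 0 (partialFourier 2 (paramP5 X)) (σ ᵥ* R.map (Int.cast : ℤ → ZMod 2)) = _
  rw [hσ, hRσ]
  simp only [partialFourier_apply, vec_four_update, Pi.smul_apply, smul_eq_mul, paramP5_apply,
    LinearEquiv.mul_apply]
  rcases zmod_two_cases (σ 0) with h0 | h0 <;> rcases zmod_two_cases (σ 1) with h1 | h1 <;>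
  rcases zmod_two_cases (σ 2) with h2 | h2 <;> rcases zmod_two_cases (σ 3) with h3 | h3 <;>
  rw [h0, h1, h2, h3] <;>
  simp [coordIndex_vec, ZMod.val_one, simpleReflection_one_apply, signLin_apply] <;>
  ring

theorem inducedOnP5_nF : InducedOnP5 nF linF := by
  let R : Matrix (Fin 4) (Fin 4) ℤ := !![-1, 0, 0, 0; 0, -1, 0, 0; 0, 0, 1, 0; 0, 0, 0, 1]
  have hR : Rᵀ * R = 1 := by decide
  have e : (nF : Sp8) = spLevi R R hR * (spInv 0 * (spInv 1 * (spInv 2 * spInv 3))) := by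
    apply Subtype.ext
    change _ = fromBlocks _ _ _ _ * (fromBlocks _ _ _ _ * (fromBlocks _ _ _ _ *
      (fromBlocks _ _ _ _ * fromBlocks _ _ _ _)))
    rw [fromBlocks_multiply, fromBlocks_multiply, fromBlocks_multiply, fromBlocks_multiply]
    change fromBlocks _ _ _ _ = _
    congr 1 <;> decide
  rw [e]
  -- Each unnormalized partial Fourier transform squares to 2, so four of them square to 16 and the
  -- scalar 4 leaves an involution.
  refine InducedOnP5.of_smul ((actsOnP15_spLevi hR).mul ((actsOnP15_spInv 0).mul
    ((actsOnP15_spInv 1).mul ((actsOnP15_spInv 2).mul (actsOnP15_spInv 3)))))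
    (k := 4) (by norm_num) fun X => ?_
  ext σ
  have hσ : σ = ![σ 0, σ 1, σ 2, σ 3] := by ext i; fin_cases i <;> rfl
  have hRσ : R.map (Int.cast : ℤ → ZMod 2) = 1 := by decide
  change partialFourier 0 (partialFourier 1 (partialFourier 2 (partialFourier 3 (paramP5 X))))
    (σ ᵥ* R.map (Int.cast : ℤ → ZMod 2)) = _
  rw [hRσ, vecMul_one, hσ]
  simp only [partialFourier_apply, vec_four_update, Pi.smul_apply, smul_eq_mul, paramP5_apply,
    linF_apply]
  rcases zmod_two_cases (σ 0) with h0 | h0 <;> rcases zmod_two_cases (σ 1) with h1 | h1 <;>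
  rcases zmod_two_cases (σ 2) with h2 | h2 <;> rcases zmod_two_cases (σ 3) with h3 | h3 <;>
  rw [h0, h1, h2, h3] <;>
  simp [coordIndex_vec, ZMod.val_one] <;>
  ring

section Cusp

open Filter Topology

/-! ### The cusp and uniqueness of the induced element of the Weyl group -/

/-- A ray in `ℋ₄ᴹ` tending to a cusp. -/
def cuspRay (n : ℕ) : Matrix (Fin 4) (Fin 4) ℂ :=
  ((n + 1 : ℝ) * Complex.I : ℂ) • (invSymm 1 1 0 0).map (Int.cast : ℤ → ℂ)

theorem posDef_invSymm_one : ((invSymm 1 1 0 0).map (Int.cast : ℤ → ℝ)).PosDef := by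
  refine .of_dotProduct_mulVec_pos ?_ fun x hx => ?_
  · ext i j; fin_cases i <;> fin_cases j <;> simp [invSymm]
  · have e : star x ⬝ᵥ ((invSymm 1 1 0 0).map (Int.cast : ℤ → ℝ) *ᵥ x) =
        x 0 ^ 2 + x 2 ^ 2 + (x 0 - x 2) ^ 2 + (x 1 ^ 2 + x 3 ^ 2 + (x 1 - x 3) ^ 2) := by
      simp [dotProduct, mulVec, Fin.sum_univ_four, invSymm]
      ring
    rw [e]
    by_contra hneg
    have a0 := sq_nonneg (x 0)
    have a1 := sq_nonneg (x 1)
    have a2 := sq_nonneg (x 2)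
    have a3 := sq_nonneg (x 3)
    have a4 := sq_nonneg (x 0 - x 2)
    have a5 := sq_nonneg (x 1 - x 3)
    have h0 : x 0 ^ 2 = 0 := by linarith
    have h1 : x 1 ^ 2 = 0 := by linarith
    have h2 : x 2 ^ 2 = 0 := by linarith
    have h3 : x 3 ^ 2 = 0 := by linarith
    refine hx ?_
    ext i
    fin_cases i
    exacts [pow_eq_zero_iff two_ne_zero |>.mp h0, pow_eq_zero_iff two_ne_zero |>.mp h1,
      pow_eq_zero_iff two_ne_zero |>.mp h2, pow_eq_zero_iff two_ne_zero |>.mp h3]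

theorem im_cuspRay (n : ℕ) :
    (cuspRay n).map Complex.im = (n + 1 : ℝ) • (invSymm 1 1 0 0).map (Int.cast : ℤ → ℝ) := by
  ext i j
  simp [cuspRay]

theorem cuspRay_mem_siegelSpace (n : ℕ) : cuspRay n ∈ siegelSpace := by
  refine ⟨?_, ?_⟩
  · ext i j
    simp only [cuspRay, transpose_apply, Matrix.smul_apply, map_apply]
    rw [(invSymm_isSymm 1 1 0 0).apply]
  · rw [im_cuspRay]
    exact posDef_invSymm_one.smul (by positivity)

theorem cuspRay_mem_siegelFixed (n : ℕ) : cuspRay n ∈ siegelFixed := by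
  refine ⟨cuspRay_mem_siegelSpace n, ?_⟩
  rw [matM_eq_spLevi, siegelAct_spLevi _ (cuspRay_mem_siegelSpace n)]
  have h : matA * invSymm 1 1 0 0 * matAᵀ = invSymm 1 1 0 0 := by decide
  have h' := congrArg (fun X : Matrix (Fin 4) (Fin 4) ℤ => X.map (Int.castRingHom ℂ)) h
  simp only [Matrix.map_mul] at h'
  rw [cuspRay, Matrix.mul_smul, Matrix.smul_mul]
  exact congrArg _ h'

theorem quadExp_cuspRay (n : ℕ) (v : Fin 4 → ℂ) :
    quadExp (cuspRay n) v = quadExp (cuspRay 0) v ^ (n + 1) := by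
  rw [quadExp, quadExp, ← Complex.exp_nat_mul]
  congr 1
  simp only [cuspRay, smul_mulVec, dotProduct_smul, smul_eq_mul]
  push_cast
  ring

/-- Along the ray each term is a power of its value at n = 0, which has norm < 1 unless m + s/2 = 0.
The series at n = 0 dominates all the others. -/
theorem tendsto_thetaSeries_cuspRay (s : Fin 4 → ℤ) :
    Tendsto (fun n => thetaSeries (cuspRay n) s) atTop
      (𝓝 (∑' m, if halfShift s m = 0 then 1 else 0)) := by
  have hle : ∀ (v : Fin 4 → ℝ), ‖quadExp (cuspRay 0) fun i => (v i : ℂ)‖ ≤ 1 ∧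
      (v ≠ 0 → ‖quadExp (cuspRay 0) fun i => (v i : ℂ)‖ < 1) := by
    intro v
    have hp := (cuspRay_mem_siegelSpace 0).2
    rw [norm_quadExp_ofReal]
    constructor
    · rw [Real.exp_le_one_iff]
      have := hp.posSemidef.dotProduct_mulVec_nonneg v
      rw [star_trivial] at this
      nlinarith [Real.pi_pos]
    · intro hv
      rw [Real.exp_lt_one_iff]
      have := hp.dotProduct_mulVec_pos hv
      rw [star_trivial] at this
      nlinarith [Real.pi_pos]
  refine tendsto_tsum_of_dominated_convergence
    (summable_norm_quadExp (cuspRay_mem_siegelSpace 0) s) (fun m => ?_)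
    (Eventually.of_forall fun n m => ?_)
  · have e : (fun n => quadExp (cuspRay n) (halfShift s m)) =
        fun n => quadExp (cuspRay 0) (halfShift s m) ^ (n + 1) :=
      funext fun n => quadExp_cuspRay n _
    rw [e]
    split_ifs with h
    · rw [h]
      simp [quadExp]
    · refine (tendsto_pow_atTop_nhds_zero_of_norm_lt_one ?_).comp (tendsto_add_atTop_nat 1)
      rw [halfShift_eq_ofReal] at h ⊢
      refine (hle _).2 fun h0 => h ?_
      ext i
      have := congrFun h0 i
      simp only [Pi.zero_apply] at this ⊢
      rw [this, Complex.ofReal_zero]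
  · rw [quadExp_cuspRay, norm_pow]
    refine pow_le_of_le_one (norm_nonneg _) ?_ (Nat.succ_ne_zero n)
    rw [halfShift_eq_ofReal]
    exact (hle _).1

theorem thetaP5_apply (τ : Matrix (Fin 4) (Fin 4) ℂ) (i : Fin 6) :
    thetaP5 τ i = thetaNulls τ (coordRep i) := by
  fin_cases i <;> rfl

/-- Only the characteristic 0 has a lattice point at the origin, so only the first coordinate
survives. -/
theorem tendsto_thetaP5_cuspRay :
    Tendsto (fun n => thetaP5 (cuspRay n)) atTop (𝓝 (Pi.single 0 1)) := by
  rw [tendsto_pi_nhds]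
  intro i
  simp_rw [thetaP5_apply, thetaNulls_eq]
  convert tendsto_thetaSeries_cuspRay _ using 2
  by_cases hi : i = 0
  · subst hi
    rw [Pi.single_eq_same, tsum_eq_single 0]
    · rw [if_pos]
      ext k
      fin_cases k <;> simp [halfShift, coordRep]
    · intro m hm
      rw [if_neg]
      intro h
      refine hm ?_
      ext k
      have := congrFun h k
      fin_cases k <;> simpa [halfShift, coordRep] using this
  · rw [Pi.single_eq_of_ne hi]
    have h1 : ∃ k, coordRep i k = 1 := by revert i; decide
    obtain ⟨k, hk⟩ := h1
    have h2 : ∀ m, halfShift (fun i_1 => ((coordRep i i_1).val : ℤ)) m ≠ 0 := by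
      intro m h
      have := congrFun h k
      simp only [halfShift, hk, ZMod.val_one, Pi.zero_apply] at this
      have h3 : (2 * m k + 1 : ℂ) = 0 := by
        push_cast at this
        linear_combination 2 * this
      have h4 : 2 * m k + 1 = 0 := by exact_mod_cast h3
      omega
    simp only [h2, if_false, tsum_zero]

/-- Being an eigenvector is expressed by vanishing 2 × 2 minors of (v, h v), a closed condition that
passes to the limit at the cusp. -/
theorem exists_eigenvalue_of_forall_thetaP5 (h : (Fin 6 → ℂ) →ₗ[ℂ] (Fin 6 → ℂ))
    (H : ∀ τ ∈ siegelFixed, ∃ c : ℂ, h (thetaP5 τ) = c • thetaP5 τ) :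
    ∃ c : ℂ, h (Pi.single 0 1) = c • Pi.single 0 1 := by
  have hcont : Continuous h := h.continuous_of_finiteDimensional
  have key : ∀ i j, (Pi.single 0 1 : Fin 6 → ℂ) i * h (Pi.single 0 1) j =
      (Pi.single 0 1 : Fin 6 → ℂ) j * h (Pi.single 0 1) i := by
    intro i j
    have hclosed : IsClosed {v : Fin 6 → ℂ | v i * h v j = v j * h v i} :=
      isClosed_eq (by fun_prop) (by fun_prop)
    refine hclosed.mem_of_tendsto tendsto_thetaP5_cuspRay (Eventually.of_forall fun n => ?_)
    obtain ⟨c, hc⟩ := H _ (cuspRay_mem_siegelFixed n)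
    simp only [Set.mem_ofPred_eq, hc, Pi.smul_apply, smul_eq_mul]
    ring
  refine ⟨h (Pi.single 0 1) 0, ?_⟩
  ext j
  have := key 0 j
  rw [Pi.single_eq_same, one_mul] at this
  rw [this, Pi.smul_apply, smul_eq_mul, mul_comm]

/-- The quotient h of w and w' has all Θ(τ) as eigenvectors. If K induces g, then Θ(K · τ) is
proportional to g Θ(τ), so g⁻¹hg has the same property; the cusp makes e₀ an eigenvector of g⁻¹hg,
that is, g e₀ one of h. -/
theorem weylE6_eq_of_inducedOnP5
    (hW : ∀ g ∈ weylE6, ∃ N ∈ normM, InducedOnP5 N g) {N : Sp8} (hN : N ∈ normM)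
    {w w' : (Fin 6 → ℂ) ≃ₗ[ℂ] (Fin 6 → ℂ)} (hw : w ∈ weylE6) (hw' : w' ∈ weylE6)
    (h : InducedOnP5 N w) (h' : InducedOnP5 N w') : w = w' := by
  have heig : ∀ τ ∈ siegelFixed, ∃ c : ℂ, (w'⁻¹ * w) (thetaP5 τ) = c • thetaP5 τ := by
    intro τ hτ
    obtain ⟨c, hc, e⟩ := h.thetaP5_siegelAct hN hτ
    obtain ⟨c', hc', e'⟩ := h'.thetaP5_siegelAct hN hτ
    refine ⟨c⁻¹ * c', ?_⟩
    have e2 : w (thetaP5 τ) = (c⁻¹ * c') • w' (thetaP5 τ) := by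
      rw [mul_smul, ← e', e, smul_smul, inv_mul_cancel₀ hc, one_smul]
    rw [LinearEquiv.mul_apply, e2, map_smul]
    congr 1
    exact w'.symm_apply_apply _
  have h1 : w'⁻¹ * w = 1 := by
    refine eq_one_of_forall_eigenvector (mul_mem (inv_mem hw') hw) fun g hg => ?_
    obtain ⟨K, hK, hKg⟩ := hW g hg
    obtain ⟨c, hc⟩ := exists_eigenvalue_of_forall_thetaP5
      (g⁻¹ * (w'⁻¹ * w) * g : (Fin 6 → ℂ) ≃ₗ[ℂ] (Fin 6 → ℂ)).toLinearMap fun τ hτ => by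
        obtain ⟨a, ha, e⟩ := hKg.thetaP5_siegelAct hK hτ
        obtain ⟨c, hc⟩ := heig _ (siegelAct_mem_siegelFixed hK hτ)
        rw [e, map_smul, smul_comm] at hc
        have hc' := smul_right_injective _ ha hc
        refine ⟨c, ?_⟩
        change g⁻¹ ((w'⁻¹ * w) (g (thetaP5 τ))) = _
        rw [hc', map_smul]
        congr 1
        exact g.symm_apply_apply _
    refine ⟨c, ?_⟩
    have := congrArg g hc
    rw [map_smul] at this
    rw [← this]
    exact (g.apply_symm_apply _).symm
  rw [inv_mul_eq_one] at h1
  exact h1.symm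

end Cusp

/-! ### Generators of the centralizer of `M` -/

theorem exists_two_mul_abs_add_mul_le (P : ℤ) {n : ℤ} (hn : 0 < n) :
    ∃ k : ℤ, 2 * |P + k * n| ≤ n := by
  -- The floor of P/n + 1/2 is a nearest integer to P/n.
  refine ⟨-((2 * P + n) / (2 * n)), ?_⟩
  have h1 := Int.emod_add_mul_ediv (2 * P + n) (2 * n)
  have h2 := Int.emod_nonneg (2 * P + n) (by omega : 2 * n ≠ 0)
  have h3 := Int.emod_lt_of_pos (2 * P + n) (by omega : 0 < 2 * n)
  set q := (2 * P + n) / (2 * n)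
  set r := (2 * P + n) % (2 * n)
  have h4 : 2 * (P + -q * n) = r - n := by linear_combination -h1
  rw [← abs_two, ← abs_mul, h4, abs_le]
  constructor <;> omega

/-- The norm of the Eisenstein integer `a + b ω`. -/
def eisNorm (a b : ℤ) : ℤ := a ^ 2 - a * b + b ^ 2

theorem four_mul_eisNorm (a b : ℤ) : 4 * eisNorm a b = (2 * a - b) ^ 2 + 3 * b ^ 2 := by
  unfold eisNorm; ring

theorem eisNorm_nonneg (a b : ℤ) : 0 ≤ eisNorm a b := by
  have := four_mul_eisNorm a b
  nlinarith [sq_nonneg (2 * a - b), sq_nonneg b]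

theorem eq_zero_of_eisNorm_eq_zero {a b : ℤ} (h : eisNorm a b = 0) : a = 0 ∧ b = 0 := by
  have h1 := four_mul_eisNorm a b
  rw [h] at h1
  have h2 : b ^ 2 = 0 := by nlinarith [sq_nonneg (2 * a - b), sq_nonneg b]
  have hb : b = 0 := pow_eq_zero_iff two_ne_zero |>.mp h2
  subst hb
  have h3 : a ^ 2 = 0 := by nlinarith
  exact ⟨pow_eq_zero_iff two_ne_zero |>.mp h3, rfl⟩

/-- Division with remainder in the Eisenstein integers. -/
theorem exists_eisNorm_add_mul_lt (a b : ℤ) {c d : ℤ} (h : 0 < eisNorm c d) :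
    ∃ k l : ℤ, eisNorm (a + k * c - l * d) (b + l * c + (k - l) * d) < eisNorm c d := by
  -- The two integers are the coordinates of (a + bω) times the conjugate of c + dω. Rounding each
  -- quotient to within 1/2 leaves a remainder whose norm is at most 3/4 of that of c + dω.
  obtain ⟨k, hk⟩ := exists_two_mul_abs_add_mul_le (a * c - a * d + b * d) h
  obtain ⟨l, hl⟩ := exists_two_mul_abs_add_mul_le (b * c - a * d) h
  refine ⟨k, l, ?_⟩
  set P := a * c - a * d + b * d + k * eisNorm c d with hP
  set Q := b * c - a * d + l * eisNorm c d with hQ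
  have key : eisNorm (a + k * c - l * d) (b + l * c + (k - l) * d) * eisNorm c d =
      eisNorm P Q := by
    rw [hP, hQ]; unfold eisNorm; ring
  have hP2 : 4 * P ^ 2 ≤ eisNorm c d ^ 2 := by
    have := pow_le_pow_left₀ (by positivity) hk 2
    rw [mul_pow, sq_abs] at this
    linarith
  have hQ2 : 4 * Q ^ 2 ≤ eisNorm c d ^ 2 := by
    have := pow_le_pow_left₀ (by positivity) hl 2
    rw [mul_pow, sq_abs] at this
    linarith
  have hle : 4 * eisNorm P Q ≤ 3 * eisNorm c d ^ 2 := by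
    unfold eisNorm at hP2 hQ2 ⊢
    nlinarith [sq_nonneg (P + Q)]
  by_contra hcon
  have := mul_le_mul_of_nonneg_right (not_lt.mp hcon) h.le
  nlinarith

/-- Pairs of mutually contragredient matrices commuting with `A` and `ᵗA⁻¹`. -/
structure LeviPair (a d : Matrix (Fin 4) (Fin 4) ℤ) : Prop where
  contra : aᵀ * d = 1
  comm : a * matA = matA * a

theorem matA_mul_matAInvT : matAInvT * matAᵀ = 1 ∧ matAᵀ * matAInvT = 1 := by decide

theorem LeviPair.comm' {a d : Matrix (Fin 4) (Fin 4) ℤ} (h : LeviPair a d) :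
    d * matAInvT = matAInvT * d := by
  obtain ⟨e1, e2⟩ := matA_mul_matAInvT
  have h1 : d * aᵀ = 1 := mul_eq_one_comm.mp h.contra
  have h2 : matAᵀ * aᵀ = aᵀ * matAᵀ := by
    rw [← transpose_mul, ← transpose_mul, h.comm]
  calc d * matAInvT = matAInvT * (matAᵀ * (d * (aᵀ * d)) * matAInvT) := by
        rw [h.contra, mul_one, ← mul_assoc, ← mul_assoc, e1, one_mul]
    _ = matAInvT * ((d * aᵀ) * (matAᵀ * d) * matAInvT) := by
        rw [h1, h.contra, mul_one, one_mul]
    _ = matAInvT * (d * (matAᵀ * aᵀ) * d * matAInvT) := by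
        rw [h2]; noncomm_ring
    _ = matAInvT * d * (matAᵀ * (aᵀ * d) * matAInvT) := by noncomm_ring
    _ = matAInvT * d := by rw [h.contra, mul_one, e2, mul_one]

theorem LeviPair.mul {a d a' d' : Matrix (Fin 4) (Fin 4) ℤ} (h : LeviPair a d)
    (h' : LeviPair a' d') : LeviPair (a * a') (d * d') where
  contra := by
    rw [transpose_mul, mul_assoc, ← mul_assoc aᵀ, h.contra, one_mul, h'.contra]
  comm := by rw [mul_assoc, h'.comm, ← mul_assoc, h.comm, mul_assoc]

/-- ᵗA⁻¹ is multiplication by ω when the entries 0, 2 and 1, 3 are read as the Eisenstein integers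
y₀ + y₂ω and y₁ + y₃ω. The Euclidean algorithm on this pair ends with the second one zero. -/
theorem exists_leviPair_mulVec (y : Fin 4 → ℤ) :
    ∃ a d, LeviPair a d ∧ (d *ᵥ y) 1 = 0 ∧ (d *ᵥ y) 3 = 0 := by
  induction hn : (eisNorm (y 1) (y 3)).toNat using Nat.strong_induction_on generalizing y with
  | _ n ih =>
    rcases (eisNorm_nonneg (y 1) (y 3)).eq_or_lt with h0 | h0
    · obtain ⟨e1, e3⟩ := eq_zero_of_eisNorm_eq_zero h0.symm
      exact ⟨1, 1, ⟨by simp, by simp⟩, by simpa using e1, by simpa using e3⟩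
    · obtain ⟨k, l, hkl⟩ := exists_eisNorm_add_mul_lt (y 0) (y 2) h0
      -- One Euclidean step: exchange the two Eisenstein coordinates and add k + lω times the
      -- divisor to the dividend; a₁ is the contragredient.
      let d₁ : Matrix (Fin 4) (Fin 4) ℤ := !![0, 1, 0, 0; 1, k, 0, -l; 0, 0, 0, 1; 0, l, 1, k - l]
      let a₁ : Matrix (Fin 4) (Fin 4) ℤ := !![-k, 1, -l, 0; 1, 0, 0, 0; l, 0, l - k, 1; 0, 0, 1, 0]
      have hp : LeviPair a₁ d₁ := by
        constructor
        · ext i j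
          fin_cases i <;> fin_cases j <;> simp [a₁, d₁, Matrix.mul_apply, Fin.sum_univ_four]
        · ext i j
          fin_cases i <;> fin_cases j <;>
            (simp [a₁, matA, Matrix.mul_apply, Fin.sum_univ_four]; try ring)
      have h1 : (d₁ *ᵥ y) 1 = y 0 + k * y 1 - l * y 3 := by
        simp [d₁, mulVec, dotProduct, Fin.sum_univ_four]; ring
      have h3 : (d₁ *ᵥ y) 3 = y 2 + l * y 1 + (k - l) * y 3 := by
        simp [d₁, mulVec, dotProduct, Fin.sum_univ_four]; ring
      obtain ⟨a, d, had, e1, e3⟩ := ih _ (by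
        rw [← hn, h1, h3]
        exact (Int.toNat_lt_toNat h0).mpr hkl) (d₁ *ᵥ y) rfl
      rw [mulVec_mulVec] at e1 e3
      exact ⟨a * a₁, d * d₁, had.mul hp, e1, e3⟩

/-- R intertwines ᵗA⁻¹ with A, so conjugation by R exchanges the roles of a and d and carries over
the reduction of lower halves to upper halves. -/
theorem exists_leviPair_mulVec' (x : Fin 4 → ℤ) :
    ∃ a d, LeviPair a d ∧ (a *ᵥ x) 1 = 0 ∧ (a *ᵥ x) 3 = 0 := by
  let R : Matrix (Fin 4) (Fin 4) ℤ := !![0, 0, 1, 0; 0, 0, 0, 1; -1, 0, 0, 0; 0, -1, 0, 0]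
  have hR : Rᵀ * R = 1 := by decide
  have hR' : R * Rᵀ = 1 := by decide
  have hRA : Rᵀ * matA = matAInvT * Rᵀ := by decide
  have hAR : R * matAInvT = matA * R := by decide
  obtain ⟨a, d, had, e1, e3⟩ := exists_leviPair_mulVec (Rᵀ *ᵥ x)
  refine ⟨R * d * Rᵀ, R * a * Rᵀ, ⟨?_, ?_⟩, ?_, ?_⟩
  · have hd : dᵀ * a = 1 := by simpa using congrArg transpose had.contra
    calc (R * d * Rᵀ)ᵀ * (R * a * Rᵀ) = R * dᵀ * (Rᵀ * R) * a * Rᵀ := by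
          simp only [transpose_mul, transpose_transpose]; noncomm_ring
      _ = R * (dᵀ * a) * Rᵀ := by rw [hR]; noncomm_ring
      _ = 1 := by rw [hd, mul_one, hR']
  · calc R * d * Rᵀ * matA = R * d * (Rᵀ * matA) := by noncomm_ring
      _ = R * (d * matAInvT) * Rᵀ := by rw [hRA]; noncomm_ring
      _ = (R * matAInvT) * d * Rᵀ := by rw [had.comm']; noncomm_ring
      _ = matA * (R * d * Rᵀ) := by rw [hAR]; noncomm_ring
  · rw [← mulVec_mulVec, ← mulVec_mulVec]
    have : ∀ z : Fin 4 → ℤ, (R *ᵥ z) 1 = z 3 := fun z => by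
      simp [R, mulVec, dotProduct, Fin.sum_univ_four]
    rw [this, e3]
  · rw [← mulVec_mulVec, ← mulVec_mulVec]
    have : ∀ z : Fin 4 → ℤ, (R *ᵥ z) 3 = -z 1 := fun z => by
      simp [R, mulVec, dotProduct, Fin.sum_univ_four]
    rw [this, e1, neg_zero]

theorem mem_centralizer_iff {N : Sp8} :
    N ∈ Subgroup.centralizer {matM} ↔ matM.1 * N.1 = N.1 * matM.1 := by
  rw [Subgroup.mem_centralizer_singleton_iff]
  constructor
  · intro h; exact (congrArg Subtype.val h).symm
  · intro h; exact Subtype.ext h.symm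

theorem LeviPair.mem_centralizer {a d : Matrix (Fin 4) (Fin 4) ℤ} (h : LeviPair a d) :
    spLevi a d h.contra ∈ Subgroup.centralizer {matM} := by
  rw [mem_centralizer_iff]
  change fromBlocks matA 0 0 matAInvT * fromBlocks a 0 0 d =
    fromBlocks a 0 0 d * fromBlocks matA 0 0 matAInvT
  rw [fromBlocks_multiply, fromBlocks_multiply]
  simp [h.comm, h.comm']

theorem spTrans_invSymm_mem_centralizer (p q x z : ℤ) :
    spTrans (invSymm p q x z) (invSymm_isSymm p q x z) ∈ Subgroup.centralizer {matM} := by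
  rw [mem_centralizer_iff]
  change fromBlocks matA 0 0 matAInvT * fromBlocks 1 _ 0 1 =
    fromBlocks 1 _ 0 1 * fromBlocks matA 0 0 matAInvT
  rw [fromBlocks_multiply, fromBlocks_multiply]
  have : matA * invSymm p q x z = invSymm p q x z * matAInvT := by
    ext i j
    fin_cases i <;> fin_cases j <;>
      simp [matA, matAInvT, invSymm, Matrix.mul_apply, Fin.sum_univ_four] <;> ring
  simp [this]

theorem spJ_mem_centralizer : spJ ∈ Subgroup.centralizer {matM} := by
  rw [mem_centralizer_iff]
  decide

/-- The upper half of a column of the left half of `N`. -/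
def colX (N : Sp8) (j : Fin 4) : Fin 4 → ℤ := fun i => N.1 (Sum.inl i) (Sum.inl j)
/-- The lower half of a column of the left half of `N`. -/
def colY (N : Sp8) (j : Fin 4) : Fin 4 → ℤ := fun i => N.1 (Sum.inr i) (Sum.inl j)

theorem col_mul {g : Sp8} {a b c d : Matrix (Fin 4) (Fin 4) ℤ} (hg : g.1 = fromBlocks a b c d)
    (N : Sp8) (j : Fin 4) :
    colX (g * N) j = a *ᵥ colX N j + b *ᵥ colY N j ∧
    colY (g * N) j = c *ᵥ colX N j + d *ᵥ colY N j := by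
  have e : (g * N).1 = fromBlocks a b c d * N.1 := by rw [← hg]; rfl
  constructor <;> ext i <;>
    simp [colX, colY, e, Matrix.mul_apply, Fintype.sum_sum_type, mulVec, dotProduct]

/-! ### Hermitian relations between the columns of an element of the centralizer -/

section Columns

variable {N : Sp8}

theorem exists_eq_fromBlocks (N : Sp8) : ∃ a b c d : Matrix (Fin 4) (Fin 4) ℤ, N.1 = fromBlocks a b c d :=
  ⟨_, _, _, _, (fromBlocks_toBlocks N.1).symm⟩

theorem blocks_centralizer (hN : N ∈ Subgroup.centralizer {matM})
    {a b c d : Matrix (Fin 4) (Fin 4) ℤ} (e : N.1 = fromBlocks a b c d) :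
    matA * a = a * matA ∧ matA * b = b * matAInvT ∧ matAInvT * c = c * matA := by
  rw [mem_centralizer_iff, e] at hN
  change fromBlocks matA 0 0 matAInvT * _ = _ * fromBlocks matA 0 0 matAInvT at hN
  rw [fromBlocks_multiply, fromBlocks_multiply, fromBlocks_inj] at hN
  simp only [Matrix.zero_mul, Matrix.mul_zero, add_zero, zero_add] at hN
  exact ⟨hN.1, hN.2.1, hN.2.2.1⟩

theorem col_pairing (N : Sp8) (j k : Fin 4) :
    colX N j ⬝ᵥ colY N k = colY N j ⬝ᵥ colX N k := by
  obtain ⟨a, b, c, d, e⟩ := exists_eq_fromBlocks N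
  have h := N.2
  rw [e, SymplecticGroup.fromBlocks_mem_iff] at h
  have h1 := congrFun (congrFun h.1 j) k
  simpa [colX, colY, e, Matrix.mul_apply, dotProduct] using h1

theorem col_pairing_matA (hN : N ∈ Subgroup.centralizer {matM}) (j k : Fin 4) :
    colX N j ⬝ᵥ (matAInvT *ᵥ colY N k) = colY N j ⬝ᵥ (matA *ᵥ colX N k) := by
  obtain ⟨a, b, c, d, e⟩ := exists_eq_fromBlocks N
  obtain ⟨h1, -, h3⟩ := blocks_centralizer hN e
  have h := N.2
  rw [e, SymplecticGroup.fromBlocks_mem_iff] at h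
  have h2 : aᵀ * (matAInvT * c) = cᵀ * (matA * a) := by
    rw [h3, h1, ← mul_assoc, h.1, mul_assoc]
  have h4 := congrFun (congrFun h2 j) k
  simpa [colX, colY, e, Matrix.mul_apply, dotProduct, mulVec] using h4

/-- The twisted pairing of a column with itself expresses its isotropy for the Hermitian form; here
only one Eisenstein coordinate of the lower half is nonzero. -/
theorem col_isotropic (hN : N ∈ Subgroup.centralizer {matM}) (j : Fin 4) {p q : Fin 4}
    (hpq : (p = 0 ∧ q = 2 ∧ colY N j 1 = 0 ∧ colY N j 3 = 0) ∨
      (p = 1 ∧ q = 3 ∧ colY N j 0 = 0 ∧ colY N j 2 = 0)) :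
    colX N j p * colY N j p + 2 * colX N j q * colY N j p - 2 * colX N j p * colY N j q -
      colX N j q * colY N j q = 0 := by
  have h := col_pairing_matA hN j j
  rcases hpq with ⟨rfl, rfl, h1, h2⟩ | ⟨rfl, rfl, h1, h2⟩ <;>
  · simp [dotProduct, mulVec, Fin.sum_univ_four, matA, matAInvT, h1, h2] at h
    linear_combination h

theorem colX_ne_zero_of_colY_eq_zero {j : Fin 4} (h : colY N j = 0) : colX N j ≠ 0 := by
  intro hx
  have h1 : (N⁻¹ * N).1 (Sum.inl j) (Sum.inl j) = 1 := by
    rw [inv_mul_cancel]; exact Matrix.one_apply_eq _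
  have h2 : (N⁻¹ * N).1 (Sum.inl j) (Sum.inl j) = 0 := by
    change (N⁻¹.1 * N.1) _ _ = 0
    rw [Matrix.mul_apply, Fintype.sum_sum_type]
    have e1 : ∀ i, N.1 (Sum.inl i) (Sum.inl j) = 0 := congrFun hx
    have e2 : ∀ i, N.1 (Sum.inr i) (Sum.inl j) = 0 := congrFun h
    simp [e1, e2]
  omega

/-- The ordinary and the twisted pairing with column 0 give two linear equations for these entries.
Up to sign their determinant is the norm of the only Eisenstein coordinate of column 0, nonzero
because N is invertible. -/
theorem colY_eq_zero_of_orthogonal (hN : N ∈ Subgroup.centralizer {matM}) (h0 : colY N 0 = 0)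
    (h1 : colX N 0 1 = 0) (h3 : colX N 0 3 = 0) : colY N 1 0 = 0 ∧ colY N 1 2 = 0 := by
  have e1 := col_pairing N 0 1
  have e2 := col_pairing_matA hN 0 1
  simp [dotProduct, mulVec, Fin.sum_univ_four, matAInvT, h0, h1, h3] at e1 e2
  have hx : colX N 0 0 ^ 2 + colX N 0 0 * colX N 0 2 + colX N 0 2 ^ 2 ≠ 0 := by
    intro h
    have h' : eisNorm (colX N 0 0) (-colX N 0 2) = 0 := by unfold eisNorm; linear_combination h
    obtain ⟨g0, g2⟩ := eq_zero_of_eisNorm_eq_zero h'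
    refine colX_ne_zero_of_colY_eq_zero h0 ?_
    ext i
    fin_cases i
    exacts [g0, h1, by simpa using g2, h3]
  constructor
  · refine (mul_eq_zero.mp ?_).resolve_left hx
    linear_combination (colX N 0 0 + colX N 0 2) * e1 + colX N 0 2 * e2
  · refine (mul_eq_zero.mp ?_).resolve_left hx
    linear_combination colX N 0 2 * e1 - colX N 0 0 * e2

end Columns

/-- A translation makes the upper half of an isotropic vector smaller than its lower half. -/
theorem exists_eisNorm_translate_lt {x₀ x₂ y₀ y₂ : ℤ}
    (h : x₀ * y₀ + 2 * x₂ * y₀ - 2 * x₀ * y₂ - x₂ * y₂ = 0) (hy : 0 < eisNorm y₀ y₂) :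
    ∃ p : ℤ, eisNorm (x₂ + (-p * y₀ + 2 * p * y₂)) (-(x₀ + (2 * p * y₀ - p * y₂))) <
      eisNorm y₀ y₂ := by
  obtain ⟨p, hp⟩ := exists_two_mul_abs_add_mul_le (x₀ * y₀ + x₂ * y₂)
    (n := 2 * eisNorm y₀ y₂) (by omega)
  refine ⟨p, ?_⟩
  set m := x₀ * y₀ + x₂ * y₂ + p * (2 * eisNorm y₀ y₂) with hm
  have hm2 : m ^ 2 ≤ eisNorm y₀ y₂ ^ 2 := by
    have := pow_le_pow_left₀ (by positivity) hp 2
    rw [mul_pow, sq_abs] at this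
    linarith
  -- In general the left side is 3m² plus the square of the isotropy expression, which vanishes. So
  -- a single integer m, adjustable modulo 2N(y), controls the norm; |m| ≤ N(y) gives a ratio of at
  -- most 3/4.
  have key : 4 * eisNorm y₀ y₂ *
      eisNorm (x₂ + (-p * y₀ + 2 * p * y₂)) (-(x₀ + (2 * p * y₀ - p * y₂))) = 3 * m ^ 2 := by
    rw [hm]
    unfold eisNorm
    linear_combination (x₀ * y₀ + 2 * x₂ * y₀ - 2 * x₀ * y₂ - x₂ * y₂) * h
  by_contra hcon
  have := mul_le_mul_of_nonneg_left (not_lt.mp hcon) hy.le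
  nlinarith

/-- The involution that exchanges the two copies of the `2 × 2` structure. -/
def swapMat : Matrix (Fin 4) (Fin 4) ℤ := !![0, 1, 0, 0; 1, 0, 0, 0; 0, 0, 0, 1; 0, 0, 1, 0]

theorem leviPair_swapMat : LeviPair swapMat swapMat := ⟨by decide, by decide⟩

/-- The conjugate of `spJ` by the exchange of coordinates. -/
def spJSwap : Sp8 :=
  spLevi swapMat swapMat leviPair_swapMat.contra * spJ *
    spLevi swapMat swapMat leviPair_swapMat.contra

theorem spJSwap_mem_centralizer : spJSwap ∈ Subgroup.centralizer {matM} :=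
  mul_mem (mul_mem leviPair_swapMat.mem_centralizer spJ_mem_centralizer)
    leviPair_swapMat.mem_centralizer

theorem col_spTrans_mul {S : Matrix (Fin 4) (Fin 4) ℤ} (hS : S.IsSymm) (N : Sp8) (j : Fin 4) :
    colX (spTrans S hS * N) j = colX N j + S *ᵥ colY N j ∧
    colY (spTrans S hS * N) j = colY N j := by
  have h := col_mul (g := spTrans S hS) rfl N j
  simpa using h

theorem col_spLevi_mul {a d : Matrix (Fin 4) (Fin 4) ℤ} (had : aᵀ * d = 1) (N : Sp8) (j : Fin 4) :
    colX (spLevi a d had * N) j = a *ᵥ colX N j ∧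
    colY (spLevi a d had * N) j = d *ᵥ colY N j := by
  have h := col_mul (g := spLevi a d had) rfl N j
  simpa using h

theorem col_spJ_mul (N : Sp8) (j : Fin 4) :
    colX (spJ * N) j = ![-colY N j 2, colX N j 1, colY N j 0, colX N j 3] ∧
    colY (spJ * N) j = ![colX N j 2, colY N j 1, -colX N j 0, colY N j 3] := by
  have h := col_mul (g := spJ) rfl N j
  rw [h.1, h.2]
  constructor <;> ext i <;> fin_cases i <;> simp [dotProduct, Fin.sum_univ_four]

theorem col_spJSwap_mul (N : Sp8) (j : Fin 4) :
    colX (spJSwap * N) j = ![colX N j 0, -colY N j 3, colX N j 2, colY N j 1] ∧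
    colY (spJSwap * N) j = ![colY N j 0, colX N j 3, colY N j 2, -colX N j 1] := by
  have h := col_spLevi_mul leviPair_swapMat.contra
  have h' := col_spJ_mul (spLevi swapMat swapMat leviPair_swapMat.contra * N) j
  rw [(h N j).1, (h N j).2] at h'
  rw [spJSwap, mul_assoc, mul_assoc, (h _ j).1, (h _ j).2, h'.1, h'.2]
  constructor <;> ext i <;> fin_cases i <;>
    simp [swapMat, mulVec, dotProduct, Fin.sum_univ_four]

/-! ### Reduction of a centralizing matrix by the generators -/

section Generation

variable {H : Subgroup Sp8} (hL : ∀ a d (h : LeviPair a d), spLevi a d h.contra ∈ H)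
  (hT : ∀ p q x z, spTrans (invSymm p q x z) (invSymm_isSymm p q x z) ∈ H) (hJ : spJ ∈ H)

include hL hT in
-- Commutation with M determines columns 2 and 3 of c by columns 0 and 1, so c = 0. Then N is the
-- translation by bᵗa times a block-diagonal matrix, and bᵗa is M-invariant.
theorem mem_of_colY_eq_zero {N : Sp8} (hN : N ∈ Subgroup.centralizer {matM})
    (h0 : colY N 0 = 0) (h1 : colY N 1 = 0) : N ∈ H := by
  obtain ⟨a, b, c, d, e⟩ := exists_eq_fromBlocks N
  obtain ⟨e1, e2, e3⟩ := blocks_centralizer hN e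
  have hc : c = 0 := by
    have c0 : ∀ i, c i 0 = 0 := fun i => by simpa [colY, e] using congrFun h0 i
    have c1 : ∀ i, c i 1 = 0 := fun i => by simpa [colY, e] using congrFun h1 i
    have c2 : ∀ i, c i 2 = 0 := fun i => by
      have := congrFun (congrFun e3 i) 0
      simpa [Matrix.mul_apply, Fin.sum_univ_four, matA, c0] using this.symm
    have c3 : ∀ i, c i 3 = 0 := fun i => by
      have := congrFun (congrFun e3 i) 1
      simpa [Matrix.mul_apply, Fin.sum_univ_four, matA, c1] using this.symm
    ext i j
    fin_cases j
    exacts [c0 i, c1 i, c2 i, c3 i]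
  subst hc
  have hs := N.2
  rw [e, SymplecticGroup.fromBlocks_mem_iff] at hs
  obtain ⟨-, h2, h3⟩ := hs
  rw [transpose_zero, zero_mul, sub_zero] at h3
  have hda : d * aᵀ = 1 := mul_eq_one_comm.mp h3
  have had : a * dᵀ = 1 := by simpa using congrArg transpose hda
  have hp : LeviPair a d := ⟨h3, e1.symm⟩
  have hsymm : (b * aᵀ).IsSymm := by
    rw [IsSymm, transpose_mul, transpose_transpose]
    calc a * bᵀ = a * (bᵀ * d) * aᵀ := by rw [mul_assoc, mul_assoc, hda, mul_one]
      _ = (a * dᵀ) * b * aᵀ := by rw [h2]; noncomm_ring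
      _ = b * aᵀ := by rw [had, one_mul]
  have hA : matA * (b * aᵀ) * matAᵀ = b * aᵀ := by
    calc matA * (b * aᵀ) * matAᵀ = matA * b * (matA * a)ᵀ := by
          rw [transpose_mul]; noncomm_ring
      _ = b * (matAInvT * matAᵀ) * aᵀ := by rw [e1, e2, transpose_mul]; noncomm_ring
      _ = b * aᵀ := by rw [matA_mul_matAInvT.1, mul_one]
  obtain ⟨p, q, x, z, hS⟩ := exists_eq_invSymm hsymm hA
  have hprod : N = spTrans (invSymm p q x z) (invSymm_isSymm p q x z) * spLevi a d hp.contra := by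
    apply Subtype.ext
    change N.1 = fromBlocks 1 _ 0 1 * fromBlocks a 0 0 d
    have hb : b * aᵀ * d = b := by rw [mul_assoc, h3, mul_one]
    rw [e, fromBlocks_multiply, ← hS, hb]
    simp
  rw [hprod]
  exact mul_mem (hT p q x z) (hL a d hp)

include hT hJ in
-- Descent on the norm of the lower half: a translation makes the upper half smaller, and `spJ`
-- exchanges the two halves in the coordinates 0 and 2.
theorem exists_colY_zero_eq_zero_of {N : Sp8} (hN : N ∈ Subgroup.centralizer {matM})
    (h1 : colY N 0 1 = 0) (h3 : colY N 0 3 = 0) :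
    ∃ g ∈ H ⊓ Subgroup.centralizer {matM}, colY (g * N) 0 = 0 := by
  induction hn : (eisNorm (colY N 0 0) (colY N 0 2)).toNat using Nat.strong_induction_on
    generalizing N with
  | _ n ih =>
    rcases (eisNorm_nonneg (colY N 0 0) (colY N 0 2)).eq_or_lt with h0 | h0
    · obtain ⟨e0, e2⟩ := eq_zero_of_eisNorm_eq_zero h0.symm
      refine ⟨1, one_mem _, ?_⟩
      rw [one_mul]
      ext i
      fin_cases i
      exacts [e0, h1, e2, h3]
    · obtain ⟨p, hp⟩ := exists_eisNorm_translate_lt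
        (col_isotropic hN 0 (Or.inl ⟨rfl, rfl, h1, h3⟩)) h0
      set g := spJ * spTrans (invSymm p 0 0 0) (invSymm_isSymm p 0 0 0) with hg
      have hgm : g ∈ H ⊓ Subgroup.centralizer {matM} :=
        mul_mem ⟨hJ, spJ_mem_centralizer⟩ ⟨hT _ _ _ _, spTrans_invSymm_mem_centralizer _ _ _ _⟩
      have hY : colY (g * N) 0 = ![colX N 0 2 + (-p * colY N 0 0 + 2 * p * colY N 0 2), 0,
          -(colX N 0 0 + (2 * p * colY N 0 0 - p * colY N 0 2)), 0] := by
        rw [hg, mul_assoc, (col_spJ_mul _ _).2, (col_spTrans_mul _ _ _).1,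
          (col_spTrans_mul _ _ _).2]
        ext i
        fin_cases i <;> simp [invSymm, dotProduct, Fin.sum_univ_four, h1, h3]
        ring
      obtain ⟨g', hg', e⟩ := ih _ (by
        rw [← hn]
        refine (Int.toNat_lt_toNat h0).mpr ?_
        rw [hY]
        exact hp) (mul_mem hgm.2 hN) (by rw [hY]; rfl) (by rw [hY]; rfl) rfl
      exact ⟨g' * g, mul_mem hg' hgm, by rw [mul_assoc, e]⟩

include hL hT hJ in
theorem exists_col_zero_normalized {N : Sp8} (hN : N ∈ Subgroup.centralizer {matM}) :
    ∃ g ∈ H ⊓ Subgroup.centralizer {matM}, colY (g * N) 0 = 0 ∧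
      colX (g * N) 0 1 = 0 ∧ colX (g * N) 0 3 = 0 := by
  obtain ⟨a, d, had, e1, e3⟩ := exists_leviPair_mulVec (colY N 0)
  rw [← (col_spLevi_mul had.contra N 0).2] at e1 e3
  obtain ⟨g, hg, e⟩ := exists_colY_zero_eq_zero_of hT hJ (mul_mem had.mem_centralizer hN) e1 e3
  rw [← mul_assoc] at e
  obtain ⟨a', d', had', f1, f3⟩ :=
    exists_leviPair_mulVec' (colX (g * spLevi a d had.contra * N) 0)
  refine ⟨spLevi a' d' had'.contra * (g * spLevi a d had.contra),
    mul_mem ⟨hL _ _ had', had'.mem_centralizer⟩ (mul_mem hg ⟨hL _ _ had, had.mem_centralizer⟩), ?_⟩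
  rw [mul_assoc (spLevi a' d' _), (col_spLevi_mul _ _ _).1, (col_spLevi_mul _ _ _).2, e]
  exact ⟨mulVec_zero _, f1, f3⟩

include hL hT hJ in
-- The same descent on column 1, in the coordinates 1 and 3. The elements used fix column 0, whose
-- lower half is zero and whose upper half lives in the coordinates 0 and 2.
theorem mem_of_col_zero_normalized {N : Sp8} (hN : N ∈ Subgroup.centralizer {matM})
    (hY : colY N 0 = 0) (hX1 : colX N 0 1 = 0) (hX3 : colX N 0 3 = 0) : N ∈ H := by
  induction hn : (eisNorm (colY N 1 1) (colY N 1 3)).toNat using Nat.strong_induction_on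
    generalizing N with
  | _ n ih =>
    obtain ⟨h0, h2⟩ := colY_eq_zero_of_orthogonal hN hY hX1 hX3
    rcases (eisNorm_nonneg (colY N 1 1) (colY N 1 3)).eq_or_lt with hpos | hpos
    · obtain ⟨e1, e3⟩ := eq_zero_of_eisNorm_eq_zero hpos.symm
      refine mem_of_colY_eq_zero hL hT hN hY ?_
      ext i
      fin_cases i
      exacts [h0, e1, h2, e3]
    · obtain ⟨p, hp⟩ := exists_eisNorm_translate_lt
        (col_isotropic hN 1 (Or.inr ⟨rfl, rfl, h0, h2⟩)) hpos
      set g := spJSwap * spTrans (invSymm 0 p 0 0) (invSymm_isSymm 0 p 0 0) with hg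
      have hgH : g ∈ H :=
        mul_mem (mul_mem (mul_mem (hL _ _ leviPair_swapMat) hJ) (hL _ _ leviPair_swapMat))
          (hT _ _ _ _)
      have hgC : g ∈ Subgroup.centralizer {matM} :=
        mul_mem spJSwap_mem_centralizer (spTrans_invSymm_mem_centralizer _ _ _ _)
      have hX0 : colX (g * N) 0 = colX N 0 := by
        rw [hg, mul_assoc, (col_spJSwap_mul _ _).1, (col_spTrans_mul _ _ _).1,
          (col_spTrans_mul _ _ _).2, hY]
        ext i
        fin_cases i <;> simp [hX1, hX3]
      have hY0 : colY (g * N) 0 = 0 := by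
        rw [hg, mul_assoc, (col_spJSwap_mul _ _).2, (col_spTrans_mul _ _ _).1,
          (col_spTrans_mul _ _ _).2, hY]
        ext i
        fin_cases i <;> simp [hX1, hX3]
      have hY1 : colY (g * N) 1 1 = colX N 1 3 + (-p * colY N 1 1 + 2 * p * colY N 1 3) ∧
          colY (g * N) 1 3 = -(colX N 1 1 + (2 * p * colY N 1 1 - p * colY N 1 3)) := by
        rw [hg, mul_assoc, (col_spJSwap_mul _ _).2, (col_spTrans_mul _ _ _).1,
          (col_spTrans_mul _ _ _).2]
        constructor <;> simp [invSymm, dotProduct, Fin.sum_univ_four, h0, h2]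
        ring
      have hmem := ih _ (by
        rw [← hn]
        refine (Int.toNat_lt_toNat hpos).mpr ?_
        rw [hY1.1, hY1.2]
        exact hp) (mul_mem hgC hN) hY0 (by rw [hX0, hX1]) (by rw [hX0, hX3]) rfl
      exact (Subgroup.mul_mem_cancel_left H hgH).mp hmem

include hL hT hJ in
/-- The centralizer of `M` is generated by its block-diagonal elements, its translations, and
an element of order four. -/
theorem centralizer_matM_le : Subgroup.centralizer {matM} ≤ H := fun N hN => by
  obtain ⟨g, hg, e0, e1, e3⟩ := exists_col_zero_normalized hL hT hJ hN
  exact (Subgroup.mul_mem_cancel_left H hg.1).mp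
    (mem_of_col_zero_normalized hL hT hJ (mul_mem hg.2 hN) e0 e1 e3)

end Generation

end Symplectic

/-! ### The action of the normalizer -/

/-- ⟨M⟩ is cyclic of order 3, so conjugation by N sends M to M or M⁻¹; as M_B inverts M, multiplying
by it reduces the second case to the first. -/
theorem mem_centralizer_or_mul_mem_centralizer {N : Sp8} (hN : N ∈ normM) :
    N ∈ Subgroup.centralizer {matM} ∨ N * spB ∈ Subgroup.centralizer {matM} := by
  have hB : spB * matM = matM⁻¹ * spB := by
    rw [matM_sq_inv]; apply Subtype.ext; change spB.1 * matM.1 = matM.1 * matM.1 * spB.1; decide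
  have hne : matM ≠ 1 := by
    intro h
    exact absurd (congrArg Subtype.val h) (by change matM.1 ≠ 1; decide)
  have h3 : matM ^ 3 = 1 := by
    rw [pow_succ, pow_two, ← matM_sq_inv, inv_mul_cancel]
  have hmem : N * matM * N⁻¹ ∈ Subgroup.zpowers matM :=
    (hN matM).mp (Subgroup.mem_zpowers matM)
  obtain ⟨k, hk⟩ := hmem
  have hcases : N * matM * N⁻¹ = 1 ∨ N * matM * N⁻¹ = matM ∨ N * matM * N⁻¹ = matM⁻¹ := by
    rw [← hk]
    change matM ^ k = 1 ∨ matM ^ k = matM ∨ matM ^ k = matM⁻¹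
    have h3' : matM ^ (3 : ℤ) = 1 := by exact_mod_cast h3
    rw [← Int.emod_add_mul_ediv k 3, zpow_add, zpow_mul, h3', one_zpow, mul_one]
    have h1 := Int.emod_nonneg k (by norm_num : (3 : ℤ) ≠ 0)
    have h2 := Int.emod_lt_of_pos k (by norm_num : (0 : ℤ) < 3)
    interval_cases k % 3
    · left; exact zpow_zero _
    · right; left; exact zpow_one _
    · right; right
      rw [matM_sq_inv]
      exact zpow_two _
  simp only [Subgroup.mem_centralizer_singleton_iff]
  rcases hcases with h | h | h
  · rw [mul_inv_eq_iff_eq_mul, one_mul] at h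
    exact absurd (mul_eq_left.mp h) hne
  · left
    exact mul_inv_eq_iff_eq_mul.mp h
  · right
    have h' : N * matM⁻¹ = matM * N := by
      have := congrArg (·⁻¹) h
      simp only [mul_inv_rev, inv_inv] at this
      rw [← mul_assoc] at this
      exact mul_inv_eq_iff_eq_mul.mp this
    rw [mul_assoc, hB, ← mul_assoc, h', mul_assoc]

/-- The transformations in `Sp(8, ℤ)` that act on `ℙ⁵` through `W(E₆)`. -/
def weylInduced : Subgroup Sp8 where
  carrier := {N | ∃ w ∈ weylE6, InducedOnP5 N w}
  mul_mem' := fun ⟨_, hw, h⟩ ⟨_, hw', h'⟩ => ⟨_, mul_mem hw hw', h.mul h'⟩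
  one_mem' := ⟨1, one_mem _, InducedOnP5.one⟩
  inv_mem' := fun ⟨_, hw, h⟩ => ⟨_, inv_mem hw, h.inv⟩

theorem normM_le_weylInduced : normM ≤ weylInduced := fun N hN => by
  have hC : Subgroup.centralizer {matM} ≤ weylInduced :=
    centralizer_matM_le (fun _ _ h => exists_weylE6_inducedOnP5_spLevi h.contra h.comm)
      exists_weylE6_inducedOnP5_spTrans exists_weylE6_inducedOnP5_spJ
  rcases mem_centralizer_or_mul_mem_centralizer hN with h | h
  · exact hC h
  · exact (Subgroup.mul_mem_cancel_right weylInduced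
      (show spB ∈ weylInduced from ⟨linB, linB_mem_weylE6, inducedOnP5_nB⟩)).mp (hC h)

theorem exists_mem_normM_inducedOnP5 (g : (Fin 6 → ℂ) ≃ₗ[ℂ] (Fin 6 → ℂ)) (hg : g ∈ weylE6) :
    ∃ N ∈ normM, InducedOnP5 N g := by
  rw [← closure_eq_weylE6] at hg
  induction hg using Subgroup.closure_induction with
  | mem x hx =>
    rcases hx with rfl | rfl | rfl | rfl
    exacts [⟨nB, nB.2, inducedOnP5_nB⟩, ⟨nD, nD.2, inducedOnP5_nD⟩, ⟨nE, nE.2, inducedOnP5_nE⟩,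
      ⟨nF, nF.2, inducedOnP5_nF⟩]
  | one => exact ⟨1, one_mem _, InducedOnP5.one⟩
  | mul x y _ _ hx hy =>
    obtain ⟨N, hN, h⟩ := hx
    obtain ⟨N', hN', h'⟩ := hy
    exact ⟨N * N', mul_mem hN hN', h.mul h'⟩
  | inv x _ hx =>
    obtain ⟨N, hN, h⟩ := hx
    exact ⟨N⁻¹, inv_mem hN, h.inv⟩

theorem existsUnique_weylE6_inducedOnP5 (N : normM) : ∃! w : weylE6, InducedOnP5 N w.1 := by
  obtain ⟨w, hw, h⟩ := normM_le_weylInduced N.2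
  exact ⟨⟨w, hw⟩, h, fun w' h' => Subtype.ext
    (weylE6_eq_of_inducedOnP5 exists_mem_normM_inducedOnP5 N.2 w'.2 hw h' h)⟩

/-- The homomorphism `N_M → W(E₆)`. -/
def normToWeyl : normM →* weylE6 :=
  MonoidHom.mk' (fun N => (existsUnique_weylE6_inducedOnP5 N).choose) fun N N' =>
    ((existsUnique_weylE6_inducedOnP5 (N * N')).choose_spec.2 _
      ((existsUnique_weylE6_inducedOnP5 N).choose_spec.1.mul
        (existsUnique_weylE6_inducedOnP5 N').choose_spec.1)).symm

theorem inducedOnP5_normToWeyl (N : normM) : InducedOnP5 N (normToWeyl N).1 :=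
  (existsUnique_weylE6_inducedOnP5 N).choose_spec.1

theorem normToWeyl_eq {N : normM} {w : (Fin 6 → ℂ) ≃ₗ[ℂ] (Fin 6 → ℂ)} (hw : w ∈ weylE6)
    (h : InducedOnP5 N w) : (normToWeyl N).1 = w :=
  congrArg Subtype.val ((existsUnique_weylE6_inducedOnP5 N).choose_spec.2 ⟨w, hw⟩ h).symm

theorem normToWeyl_surjective : Function.Surjective normToWeyl := fun w => by
  obtain ⟨N, hN, h⟩ := exists_mem_normM_inducedOnP5 w.1 w.2
  exact ⟨⟨N, hN⟩, Subtype.ext (normToWeyl_eq w.2 h)⟩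

/-! ### The action on the variety -/

theorem eval_smul_of_isHomogeneous {σ R : Type*} [CommSemiring R] {n : ℕ} {G : MvPolynomial σ R}
    (hG : G.IsHomogeneous n) (c : R) (v : σ → R) :
    MvPolynomial.eval (c • v) G = c ^ n * MvPolynomial.eval v G := by
  rw [MvPolynomial.eval_eq, MvPolynomial.eval_eq, Finset.mul_sum]
  refine Finset.sum_congr rfl fun d hd => ?_
  have hdeg : ∑ i ∈ d.support, d i = n := by
    have := hG (MvPolynomial.mem_support_iff.mp hd)
    rwa [Finsupp.weight_apply, Finsupp.sum, Finset.sum_congr rfl] at this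
    intro i _
    simp
  simp only [Pi.smul_apply, smul_eq_mul, mul_pow, Finset.prod_mul_distrib, Finset.prod_pow_eq_pow_sum,
    hdeg]
  ring

/-- The composition of a polynomial with a linear map. -/
def polyComp (g : (Fin 6 → ℂ) →ₗ[ℂ] (Fin 6 → ℂ)) (G : MvPolynomial (Fin 6) ℂ) :
    MvPolynomial (Fin 6) ℂ :=
  MvPolynomial.aeval (fun i => ∑ j, MvPolynomial.C (g (Pi.single j 1) i) * MvPolynomial.X j) G

theorem polyComp_isHomogeneous (g : (Fin 6 → ℂ) →ₗ[ℂ] (Fin 6 → ℂ)) {G : MvPolynomial (Fin 6) ℂ}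
    {n : ℕ} (hG : G.IsHomogeneous n) : (polyComp g G).IsHomogeneous n := by
  have := hG.aeval (S := ℂ) (n := 1)
    (fun i => ∑ j, MvPolynomial.C (g (Pi.single j 1) i) * MvPolynomial.X j)
    fun i => MvPolynomial.IsHomogeneous.sum _ _ _ fun j _ => by
      simpa using (MvPolynomial.isHomogeneous_C (Fin 6) (g (Pi.single j 1) i)).mul
        (MvPolynomial.isHomogeneous_X ℂ j)
  rwa [one_mul] at this

theorem eval_polyComp (g : (Fin 6 → ℂ) →ₗ[ℂ] (Fin 6 → ℂ)) (G : MvPolynomial (Fin 6) ℂ)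
    (v : Fin 6 → ℂ) :
    MvPolynomial.eval v (polyComp g G) = MvPolynomial.eval (g v) G := by
  have hv : g v = fun i => ∑ j, g (Pi.single j 1) i * v j := by
    ext i
    have e : ∀ j : Fin 6, (fun k => if j = k then (1 : ℂ) else 0) = Pi.single j 1 := fun j => by
      ext k
      simp [Pi.single_apply, eq_comm]
    conv_lhs => rw [g.pi_apply_eq_sum_univ v]
    simp only [e, Finset.sum_apply, Pi.smul_apply, smul_eq_mul, mul_comm (v _)]
  rw [polyComp, MvPolynomial.aeval_def, ← MvPolynomial.coe_eval₂Hom,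
    ← RingHom.comp_apply]
  simp only [hv]
  refine congrArg (fun f : MvPolynomial (Fin 6) ℂ →+* ℂ => f G) ?_
  apply MvPolynomial.ringHom_ext
  · intro r; simp
  · intro i; simp

theorem eval_rep_mk_eq_zero_iff {n : ℕ} {G : MvPolynomial (Fin 6) ℂ} (hG : G.IsHomogeneous n)
    (v : Fin 6 → ℂ) (hv : v ≠ 0) :
    MvPolynomial.eval (Projectivization.mk ℂ v hv).rep G = 0 ↔ MvPolynomial.eval v G = 0 := by
  obtain ⟨a, ha⟩ := Projectivization.exists_smul_eq_mk_rep ℂ v hv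
  rw [← ha, Units.smul_def, eval_smul_of_isHomogeneous hG]
  simp

theorem smul_eq_mk (g : (Fin 6 → ℂ) ≃ₗ[ℂ] (Fin 6 → ℂ)) (p : ℙ ℂ (Fin 6 → ℂ)) :
    g • p = Projectivization.mk ℂ (g p.rep) (g.map_ne_zero_iff.mpr p.rep_nonzero) := by
  conv_lhs => rw [← p.mk_rep]
  exact Projectivization.smul_mk g p.rep_nonzero

theorem eval_rep_smul_eq_zero_iff (g : (Fin 6 → ℂ) ≃ₗ[ℂ] (Fin 6 → ℂ)) {n : ℕ}
    {G : MvPolynomial (Fin 6) ℂ} (hG : G.IsHomogeneous n) (p : ℙ ℂ (Fin 6 → ℂ)) :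
    MvPolynomial.eval (g • p).rep G = 0 ↔
      MvPolynomial.eval p.rep (polyComp g.toLinearMap G) = 0 := by
  rw [smul_eq_mk, eval_rep_mk_eq_zero_iff hG, eval_polyComp]
  rfl

theorem smul_mem_thetaImage (N : normM) {p : ℙ ℂ (Fin 6 → ℂ)} (hp : p ∈ thetaImage) :
    (normToWeyl N).1 • p ∈ thetaImage := by
  obtain ⟨τ, hτ, h, rfl⟩ := hp
  obtain ⟨c, hc, e⟩ := (inducedOnP5_normToWeyl N).thetaP5_siegelAct N.2 hτ
  have h' : (normToWeyl N).1 (thetaP5 τ) ≠ 0 := (normToWeyl N).1.map_ne_zero_iff.mpr h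
  refine ⟨_, siegelAct_mem_siegelFixed N.2 hτ, by rw [e]; exact smul_ne_zero hc h', ?_⟩
  refine (Projectivization.smul_mk _ h).trans ?_
  rw [Projectivization.mk_eq_mk_iff']
  refine ⟨c⁻¹, ?_⟩
  rw [e, smul_smul, inv_mul_cancel₀ hc, one_smul]
  rfl

/-- A form vanishing on Θ(ℋ₄ᴹ), pulled back by ρ(N), again vanishes there, because ρ(N) preserves
this image; so the pullback vanishes at p. -/
theorem smul_mem_varietyX (N : normM) {p : ℙ ℂ (Fin 6 → ℂ)} (hp : p ∈ varietyX) :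
    (normToWeyl N).1 • p ∈ varietyX := by
  intro n G hG hvan
  rw [eval_rep_smul_eq_zero_iff _ hG]
  refine hp n _ (polyComp_isHomogeneous _ hG) fun q hq => ?_
  rw [← eval_rep_smul_eq_zero_iff _ hG]
  exact hvan _ (smul_mem_thetaImage N hq)

theorem image_smul_varietyX (N : normM) :
    (fun p : ℙ ℂ (Fin 6 → ℂ) => (normToWeyl N).1 • p) '' varietyX = varietyX := by
  apply Set.Subset.antisymm
  · rintro _ ⟨p, hp, rfl⟩
    exact smul_mem_varietyX N hp
  · intro p hp
    refine ⟨_, smul_mem_varietyX N⁻¹ hp, ?_⟩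
    change (normToWeyl N).1 • (normToWeyl N⁻¹).1 • p = p
    rw [smul_smul, map_inv, InvMemClass.coe_inv, mul_inv_cancel, one_smul]

end PicardE6

end

theorem proposition3p8 :
    -- `ℂ⁶ → ℂ¹⁶` is an isomorphism onto the eigenspace, which contains `Θ(ℋ₄ᴹ)`
    (Function.Injective paramP5 ∧ LinearMap.range paramP5 = eigenspaceM ∧
      ∀ τ ∈ siegelFixed, thetaNulls τ = paramP5 (thetaP5 τ)) ∧
    -- the actions of `M_B, M_d, M_e, M_f` on `ℙ⁵`
    (InducedOnP5 nB linB ∧ InducedOnP5 nD linD ∧ InducedOnP5 nE linE ∧ InducedOnP5 nF linF) ∧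
    -- `M_B` acts as the reflection in `α₆`
    linB = simpleReflection 5 ∧
    -- the four transformations generate the Weyl group
    Subgroup.closure {linB, linD, linE, linF} = weylE6 ∧
    -- the `αᵢ` are simple roots of type `E₆` (Mathlib's numbering exchanges the first two),
    -- `R(E₆) ⊗ ℂ = ℂ⁶`, and the Weyl group acts on the root lattice
    ((∀ i j, bForm (simpleRoot i) (simpleRoot j) =
        (CartanMatrix.E₆ (Equiv.swap 0 1 i) (Equiv.swap 0 1 j) : ℂ)) ∧
      Function.Bijective (LinearMap.liftBaseChange ℂ rootLattice.subtype :
        ℂ ⊗[ℤ] rootLattice →ₗ[ℂ] (Fin 6 → ℂ)) ∧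
      ∀ w ∈ weylE6, ∀ X, w X ∈ rootLattice ↔ X ∈ rootLattice) ∧
    -- the normalizer acts on `ℙ⁵` and on `𝒳` through the Weyl group
    ∃ ρ : normM →* weylE6, Function.Surjective ρ ∧
      (ρ nB : (Fin 6 → ℂ) ≃ₗ[ℂ] (Fin 6 → ℂ)) = linB ∧
      (ρ nD : (Fin 6 → ℂ) ≃ₗ[ℂ] (Fin 6 → ℂ)) = linD ∧
      (ρ nE : (Fin 6 → ℂ) ≃ₗ[ℂ] (Fin 6 → ℂ)) = linE ∧
      (ρ nF : (Fin 6 → ℂ) ≃ₗ[ℂ] (Fin 6 → ℂ)) = linF ∧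
      ∀ N : normM,
        InducedOnP5 N (ρ N) ∧
        (∀ τ ∈ siegelFixed, siegelAct N τ ∈ siegelFixed ∧
          ∃ c : ℂ, c ≠ 0 ∧ thetaP5 (siegelAct N τ) =
            c • (ρ N : (Fin 6 → ℂ) ≃ₗ[ℂ] (Fin 6 → ℂ)) (thetaP5 τ)) ∧
        (fun p : ℙ ℂ (Fin 6 → ℂ) =>
          (ρ N : (Fin 6 → ℂ) ≃ₗ[ℂ] (Fin 6 → ℂ)) • p) '' varietyX = varietyX :=
  ⟨⟨paramP5_injective, range_paramP5, fun _ hτ => thetaNulls_eq_paramP5 hτ⟩,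
    ⟨inducedOnP5_nB, inducedOnP5_nD, inducedOnP5_nE, inducedOnP5_nF⟩,
    linB_eq_simpleReflection, closure_eq_weylE6,
    ⟨bForm_simpleRoot, bijective_liftBaseChange_rootLattice,
      fun _ hw X => weylE6_apply_mem_rootLattice hw X⟩,
    normToWeyl, normToWeyl_surjective,
    normToWeyl_eq linB_mem_weylE6 inducedOnP5_nB, normToWeyl_eq linD_mem_weylE6 inducedOnP5_nD,
    normToWeyl_eq linE_mem_weylE6 inducedOnP5_nE, normToWeyl_eq linF_mem_weylE6 inducedOnP5_nF,
    fun N => ⟨inducedOnP5_normToWeyl N,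
      fun _ hτ => ⟨siegelAct_mem_siegelFixed N.2 hτ,
        (inducedOnP5_normToWeyl N).thetaP5_siegelAct N.2 hτ⟩,
      image_smul_varietyX N⟩⟩
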